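/- Theorem A. Let $m\ge 2$. Let $N_1=\chi_{[0,1)}$ and $N_k(x)=\int_0^1N_{k-1}(x-y)\,dy$ for $k\ge2$ be the cardinal B-splines, and put $P(\theta)=2\pi\sum_{j\in\mathbb Z}|\widehat{N_m}(\theta+2\pi j)|^2$, where $\widehat f(\omega)=\frac1{\sqrt{2\pi}}\int_{\mathbb R} f(t)e^{-i\omega t}\,dt$. Let $$\varphi_m(x)=\sum_{j\in\mathbb Z}c_jN_m(x-j),\qquad c_j=\frac1{2\pi}\int_{-\pi}^{\pi}\frac{\cos j\theta}{\sqrt{P(\theta)}}\,d\theta .$$ There is a unique square-summable real sequence $(a_j)_{j\in\mathbb Z}$ (the scaling constants of $\varphi_m$) with $\varphi_m(x)=\sum_{j\in\mathbb Z}a_j\varphi_m(2x-j)$ for all $x\in\mathbb R$. Let $\psi_m(x)=\sum_{j\in\mathbb Z}(-1)^ja_{1-j}\varphi_m(2x-j)$ be the $m$-th order cardinal B-spline wavelet. The Euler–Frobenius polynomial $(2m-1)!\sum_{i=0}^{2m-2}N_{2m}(i+1)z^i$ of degree $2m-2$ has at least $m-1$ negative roots; let $\lambda_{m-1}$ be the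 $(m-1)$-st of them in the order $0>\lambda_1>\lambda_2>\cdots$, and put $$\mu=\frac{(\lambda_{m-1}+1)^2}{4|\lambda_{m-1}|},\qquad \alpha_0=\ln\left[\frac{\sqrt{\mu+1}+\sqrt{\mu}}{\sqrt{\mu+1}-\sqrt{\mu}}\right].$$ For $j\in\mathbb Z$ let $r_j=\lfloor |j|/2\rfloor$. Then there are constants $E_j$, depending only on the sign and the parity of $j$ and nonzero for $j\ne0$, and numbers $\varepsilon_j$ with $\varepsilon_j\to0$ as $|j|\to\infty$, such that for all real $x$ with $|x|$ sufficiently large $$\psi_m(x)=\sum_{2x-m\le j\le 2x}(-1)^{r_j}E_j\,\frac{e^{-\alpha_0r_j}}{\sqrt{r_j}}\,(1+\varepsilon_j)\,N_m(2x-j).$$ Moreover, as $|x|\to\infty$, $$\psi_m(x)=\sum_{2x-m\le j\le 2x}(-1)^{r_j}E_j\,\frac{e^{-\alpha_0r_j}}{\sqrt{r_j}}\,N_m(2x-j)+o\!\left(\frac{e^{-\alpha_0|x|}}{\sqrt{|x|}}\right).$$ -/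

import Mathlib

open Filter Topology Asymptotics

namespace CardinalBSpline

noncomputable section

/-- The cardinal B-spline `N_m` of order `m ≥ 1` (the value at order `0` is irrelevant):
`N_1` is the indicator function of `[0,1)` and `N_m(x) = ∫₀¹ N_{m-1}(x - y) dy`. -/
def bspline : ℕ → ℝ → ℝ
  | 0 => fun _ => 0
  | 1 => Set.indicator (Set.Ico (0 : ℝ) 1) (fun _ => 1)
  | (n + 2) => fun x => ∫ y in (0 : ℝ)..1, bspline (n + 1) (x - y)

/-- The unitary Fourier transform `(2π)^{-1/2} ∫ f(t) e^{-iωt} dt`. -/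
def fourierHat (f : ℝ → ℝ) (ω : ℝ) : ℂ :=
  ((Real.sqrt (2 * Real.pi))⁻¹ : ℂ) * ∫ t : ℝ, (f t : ℂ) * Complex.exp (-Complex.I * ω * t)

/-- `P_m(cos(θ/2)) = 2π ∑_{j ∈ ℤ} |N̂_m(θ + 2πj)|²`, as a function of `θ`. -/
def symbolP (m : ℕ) (θ : ℝ) : ℝ :=
  2 * Real.pi * ∑' j : ℤ, ‖fourierHat (bspline m) (θ + 2 * Real.pi * j)‖ ^ 2

/-- The coefficients `c_j = (2π)⁻¹ ∫_{-π}^{π} cos(jθ) / √P_m(cos(θ/2)) dθ`. -/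
def coeffC (m : ℕ) (j : ℤ) : ℝ :=
  (2 * Real.pi)⁻¹ *
    ∫ θ in (-Real.pi)..Real.pi, Real.cos (j * θ) / Real.sqrt (symbolP m θ)

/-- The orthonormalized scaling function `φ_m(x) = ∑_j c_j N_m(x - j)`. -/
def scalingFunction (m : ℕ) (x : ℝ) : ℝ :=
  ∑' j : ℤ, coeffC m j * bspline m (x - j)

/-- `a` is the square-summable sequence of scaling constants of `φ`:
`φ(x) = ∑_j a_j φ(2x - j)` for every `x`. -/
def IsScalingSequence (φ : ℝ → ℝ) (a : ℤ → ℝ) : Prop :=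
  Summable (fun j => a j ^ 2) ∧ ∀ x : ℝ, HasSum (fun j : ℤ => a j * φ (2 * x - j)) (φ x)

/-- The wavelet `ψ(x) = ∑_j (-1)^j a_{1-j} φ(2x - j)` determined by `φ` and its scaling
constants `a`. -/
def wavelet (φ : ℝ → ℝ) (a : ℤ → ℝ) (x : ℝ) : ℝ :=
  ∑' j : ℤ, (-1 : ℝ) ^ j * a (1 - j) * φ (2 * x - j)

/-- The Euler–Frobenius polynomial of degree `2m - 2` (for `m ≥ 1`),
`(2m-1)! z^{m-1} ∑_{k=-m+1}^{m-1} N_{2m}(m+k) z^k`, with the summation index `i = k + m - 1`. -/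
def eulerFrobenius (m : ℕ) : Polynomial ℝ :=
  ∑ i ∈ Finset.range (2 * m - 1),
    Polynomial.C ((Nat.factorial (2 * m - 1) : ℝ) * bspline (2 * m) (i + 1)) * Polynomial.X ^ i

/-- `lam` is the `n`-th negative root of `p`, the negative roots being enumerated in order of
increasing absolute value, `0 > λ_1 > λ_2 > ⋯`. -/
def IsNthNegativeRoot (p : Polynomial ℝ) (n : ℕ) (lam : ℝ) : Prop :=
  lam ∈ p.roots ∧ lam < 0 ∧
    (p.roots.filter (fun z => lam < z ∧ z < 0)).card + 1 = n

/-- `μ = (λ + 1)² / (4|λ|)`. -/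
def muOf (lam : ℝ) : ℝ := (lam + 1) ^ 2 / (4 * |lam|)

/-- `α₀ = ln [(√(μ+1) + √μ) / (√(μ+1) - √μ)]`. -/
def alphaOf (mu : ℝ) : ℝ :=
  Real.log ((Real.sqrt (mu + 1) + Real.sqrt mu) / (Real.sqrt (mu + 1) - Real.sqrt mu))

/-- `r_j = [|j| / 2]`. -/
def rIdx (j : ℤ) : ℕ := j.natAbs / 2

/-- `(-1)^{r_j} E_j e^{-α r_j} / √r_j`, where `E_j` is given as a function of the sign and the
parity of `j`. -/
def mainCoeff (α : ℝ) (E : SignType → ZMod 2 → ℝ) (j : ℤ) : ℝ :=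
  (-1) ^ rIdx j * E (SignType.sign j) (j : ZMod 2) *
    (Real.exp (-α * rIdx j) / Real.sqrt (rIdx j))

/-- The integers `j` with `2x - m ≤ j ≤ 2x`. -/
def activeIdx (m : ℕ) (x : ℝ) : Finset ℤ := Finset.Icc ⌈2 * x - m⌉ ⌊2 * x⌋

end

end CardinalBSpline

open CardinalBSpline

/-! ### B-splines: support, regularity, recurrence, symmetry, two-scale relation. -/

namespace CardinalBSpline

/-! Write `m = k + 1` and let P be the Laurent polynomial that represents `symbolP m` on the unit
circle. Poisson summation identifies its coefficients with the values of N_{2m} at the integers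
(`ofReal_symbolP_eq`), so P is the Euler–Frobenius polynomial up to a constant and a monomial. In
the variable t = 1/(1 - z), Eulerian polynomials arise by iterating (t² - t) d/dt, and Rolle's
theorem makes all roots real and simple (`card_roots_polylogPoly`). They are negative and closed
under inversion, so P(z) = K ∏ (1 + q z)(1 + q/z) with m - 1 numbers q in (0,1). For the largest of
them, r, one has λ_{m-1} = -r and e^{-α₀} = r.

On the unit circle the c_j have generating function P^{-1/2}, and the scaling constants 2^{-k} (1 +
z)^m P(z)^{1/2} P(z²)^{-1/2}. Hence ψ_m is a series in the N_m(2x - j) whose coefficients are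
generated, up to a constant and a monomial, by W(z) = (1 - z)^m (P(-z) / (P(z) P(z²)))^{1/2}
(`exists_wavelet_coefficients`). For each x only boundedly many terms survive, so everything reduces
to the asymptotics of the Laurent coefficients of W.

Going outwards from the unit circle, the first singularities of W are the zeros ±i r^{-1/2} of 1 + r
z², a factor of P(z²). Up to a constant, W = (1 + r z²)^{-1/2} G with G holomorphic on a larger
annulus. Darboux's method (`tendsto_conv_upsample_invSqrtCoeff`) compares the coefficient at 2n + s
with (-r)^n 4^{-n} C(2n, n), which is asymptotic to a constant times (-r)^n / √n; the limit of the
quotient is a number L_s. The symmetry of W under z ↦ 1/z handles negative indices.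

The delicate point is L_s ≠ 0, that is, G(z₀)² ≠ G(-z₀)² at z₀ = i r^{-1/2}. The two-scale relation
for P at z₀, where P(z₀²) = 0, reduces a failure to (1 + z₀)^{2m} = (1 - z₀)^{2m}. This would make
(2 + z₀ + 1/z₀)^m real or purely imaginary. But its argument lies strictly between 0 and π/2:
otherwise a continuity argument along the imaginary axis produces a zero of P(z²) closer to the unit
circle than z₀ (`mul_arctan_lt_pi_div_two`).

Uniqueness of the scaling constants follows from the independence of the B-spline shifts
(`eq_zero_of_hasSum_mul_bspline`) and the invertibility of P^{-1/2} under convolution. -/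

theorem bspline_succ_succ (n : ℕ) (x : ℝ) :
    bspline (n + 2) x = ∫ t in (x - 1)..x, bspline (n + 1) t := by
  simp only [bspline]
  rw [intervalIntegral.integral_comp_sub_left (fun t => bspline (n + 1) t) x, sub_zero]

theorem bspline_one (x : ℝ) : bspline 1 x = Set.indicator (Set.Ico (0 : ℝ) 1) (fun _ => 1) x := by
  rw [bspline]

theorem bspline_one_of_mem {x : ℝ} (h0 : 0 ≤ x) (h1 : x < 1) : bspline 1 x = 1 := by
  rw [bspline_one, Set.indicator_of_mem (Set.mem_Ico.2 ⟨h0, h1⟩)]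

theorem bspline_eq_zero_of_neg (n : ℕ) {x : ℝ} (hx : x < 0) : bspline n x = 0 := by
  induction n using Nat.strong_induction_on generalizing x with
  | _ n ih =>
    match n with
    | 0 => rfl
    | 1 => rw [bspline_one, Set.indicator_of_notMem]; exact fun h => absurd h.1 (not_le.2 hx)
    | k + 2 =>
      rw [bspline_succ_succ]
      refine (intervalIntegral.integral_congr (g := fun _ => 0) ?_).trans (by simp)
      intro t ht
      rw [Set.uIcc_of_le (by linarith)] at ht
      exact ih (k + 1) (by omega) (by linarith [ht.2])

theorem bspline_eq_zero_of_le (n : ℕ) {x : ℝ} (hx : n ≤ x) : bspline n x = 0 := by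
  induction n using Nat.strong_induction_on generalizing x with
  | _ n ih =>
    match n with
    | 0 => rfl
    | 1 =>
      rw [bspline_one, Set.indicator_of_notMem]
      exact fun h => absurd h.2 (not_lt.2 (by simpa using hx))
    | k + 2 =>
      rw [bspline_succ_succ]
      refine (intervalIntegral.integral_congr (g := fun _ => 0) ?_).trans (by simp)
      intro t ht
      rw [Set.uIcc_of_le (by linarith)] at ht
      refine ih (k + 1) (by omega) ?_
      push_cast at hx ⊢
      linarith [ht.1]

theorem bspline_succ_succ_eq_zero_of_nonpos (n : ℕ) {x : ℝ} (hx : x ≤ 0) :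
    bspline (n + 2) x = 0 := by
  rw [bspline_succ_succ]
  refine (intervalIntegral.integral_congr_Ioo_of_le (g := fun _ => 0) (by linarith) ?_).trans
    (by simp)
  intro t ht
  exact bspline_eq_zero_of_neg _ (by linarith [ht.2])

theorem bspline_measurable_and_mem_Icc (n : ℕ) :
    Measurable (bspline n) ∧ ∀ x, bspline n x ∈ Set.Icc (0 : ℝ) 1 := by
  induction n using Nat.strong_induction_on with
  | _ n ih =>
    match n with
    | 0 =>
      have : bspline 0 = fun _ => 0 := by funext x; rw [bspline]
      rw [this]
      exact ⟨measurable_const, fun x => by simp⟩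
    | 1 =>
      have : bspline 1 = Set.indicator (Set.Ico (0 : ℝ) 1) (fun _ => 1) := by
        funext x; rw [bspline_one]
      rw [this]
      refine ⟨measurable_const.indicator measurableSet_Ico, fun x => ?_⟩
      by_cases hx : x ∈ Set.Ico (0 : ℝ) 1 <;> simp [hx]
    | k + 2 =>
      obtain ⟨hm, hb⟩ := ih (k + 1) (by omega)
      have hInt : ∀ a b, IntervalIntegrable (bspline (k + 1)) MeasureTheory.volume a b := by
        intro a b
        refine (intervalIntegrable_const (c := (1 : ℝ))).mono_fun hm.aestronglyMeasurable ?_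
        refine Eventually.of_forall fun x => ?_
        simpa [abs_of_nonneg (hb x).1] using (hb x).2
      have hc : Continuous (bspline (k + 2)) := by
        have h1 := intervalIntegral.continuous_primitive hInt 0
        have : bspline (k + 2) = fun x => (∫ t in (0 : ℝ)..x, bspline (k + 1) t) -
            ∫ t in (0 : ℝ)..(x - 1), bspline (k + 1) t := by
          funext x
          rw [bspline_succ_succ, intervalIntegral.integral_interval_sub_left (hInt _ _) (hInt _ _)]
        rw [this]
        exact h1.sub (h1.comp (continuous_id.sub continuous_const))
      refine ⟨hc.measurable, fun x => ?_⟩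
      rw [bspline_succ_succ]
      refine ⟨intervalIntegral.integral_nonneg (by linarith) fun t _ => (hb t).1, ?_⟩
      calc _ ≤ ∫ t in (x - 1)..x, (1 : ℝ) :=
            intervalIntegral.integral_mono_on (by linarith) (hInt _ _) intervalIntegrable_const
              fun t _ => (hb t).2
        _ = 1 := by simp

theorem bspline_nonneg (n : ℕ) (x : ℝ) : 0 ≤ bspline n x :=
  ((bspline_measurable_and_mem_Icc n).2 x).1

theorem bspline_le_one (n : ℕ) (x : ℝ) : bspline n x ≤ 1 :=
  ((bspline_measurable_and_mem_Icc n).2 x).2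

theorem measurable_bspline (n : ℕ) : Measurable (bspline n) :=
  (bspline_measurable_and_mem_Icc n).1

theorem bspline_intervalIntegrable (n : ℕ) (a b : ℝ) :
    IntervalIntegrable (bspline n) MeasureTheory.volume a b := by
  refine (intervalIntegrable_const (c := (1 : ℝ))).mono_fun
    (measurable_bspline n).aestronglyMeasurable ?_
  refine Eventually.of_forall fun x => ?_
  simpa [abs_of_nonneg (bspline_nonneg n x)] using bspline_le_one n x

theorem bspline_succ_succ_eq_sub (n : ℕ) (x : ℝ) :
    bspline (n + 2) x = (∫ t in (0 : ℝ)..x, bspline (n + 1) t) -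
      ∫ t in (0 : ℝ)..(x - 1), bspline (n + 1) t := by
  rw [bspline_succ_succ, intervalIntegral.integral_interval_sub_left
    (bspline_intervalIntegrable _ _ _) (bspline_intervalIntegrable _ _ _)]

theorem continuous_bspline (n : ℕ) : Continuous (bspline (n + 2)) := by
  have h1 := intervalIntegral.continuous_primitive (bspline_intervalIntegrable (n + 1)) 0
  simp_rw [funext (bspline_succ_succ_eq_sub n)]
  exact h1.sub (h1.comp (continuous_id.sub continuous_const))

/-- N_1 jumps, but only from the left. Working with right derivatives throughout lets order 1 be
treated together with the higher orders. -/
theorem bspline_continuousWithinAt_Ici (n : ℕ) (x : ℝ) :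
    ContinuousWithinAt (bspline n) (Set.Ici x) x := by
  match n with
  | 0 => exact continuousWithinAt_const
  | k + 2 => exact (continuous_bspline k).continuousWithinAt
  | 1 =>
    have key : ∀ c : ℝ, (∀ᶠ y in 𝓝[≥] x, bspline 1 y = c) →
        ContinuousWithinAt (bspline 1) (Set.Ici x) x := fun c hc => by
      have hx : bspline 1 x = c := hc.self_of_nhdsWithin Set.self_mem_Ici
      rw [ContinuousWithinAt, hx]
      exact tendsto_const_nhds.congr' (hc.mono fun y hy => hy.symm)
    rcases lt_or_ge x 0 with hx | hx
    · refine key 0 ?_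
      filter_upwards [mem_nhdsWithin_of_mem_nhds (Iio_mem_nhds hx)] with y hy
      exact bspline_eq_zero_of_neg 1 hy
    rcases lt_or_ge x 1 with hx1 | hx1
    · refine key 1 ?_
      filter_upwards [mem_nhdsWithin_of_mem_nhds (Iio_mem_nhds hx1), self_mem_nhdsWithin]
        with y hy hy'
      exact bspline_one_of_mem (hx.trans hy') hy
    · refine key 0 ?_
      filter_upwards [self_mem_nhdsWithin] with y hy
      exact bspline_eq_zero_of_le 1 (by simpa using hx1.trans hy)

theorem hasDerivWithinAt_Ici_comp_sub_one {f : ℝ → ℝ} {f' x : ℝ}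
    (h : HasDerivWithinAt f f' (Set.Ici (x - 1)) (x - 1)) :
    HasDerivWithinAt (fun y => f (y - 1)) f' (Set.Ici x) x := by
  have := HasDerivWithinAt.comp x h
    (((hasDerivAt_id x).sub_const 1).hasDerivWithinAt (s := Set.Ici x))
    (fun y hy => by simpa using hy)
  rw [mul_one] at this
  exact this

theorem bspline_hasDerivWithinAt (n : ℕ) (x : ℝ) :
    HasDerivWithinAt (bspline (n + 2)) (bspline (n + 1) x - bspline (n + 1) (x - 1))
      (Set.Ici x) x := by
  have h : ∀ y, HasDerivWithinAt (fun u => ∫ t in (0 : ℝ)..u, bspline (n + 1) t)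
      (bspline (n + 1) y) (Set.Ici y) y := fun y =>
    intervalIntegral.integral_hasDerivWithinAt_right (t := Set.Ioi y)
      (bspline_intervalIntegrable _ _ _)
      ((measurable_bspline (n + 1)).stronglyMeasurable.stronglyMeasurableAtFilter)
      ((bspline_continuousWithinAt_Ici (n + 1) y).mono Set.Ioi_subset_Ici_self)
  have h2 : HasDerivWithinAt (fun u : ℝ => ∫ t in (0 : ℝ)..(u - 1), bspline (n + 1) t)
      (bspline (n + 1) (x - 1)) (Set.Ici x) x :=
    hasDerivWithinAt_Ici_comp_sub_one (h (x - 1))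
  rw [funext (bspline_succ_succ_eq_sub n)]
  exact (h x).sub h2

theorem eq_of_hasDerivWithinAt_Ici {f g f' : ℝ → ℝ} {a : ℝ} (hf : Continuous f) (hg : Continuous g)
    (hf' : ∀ x, HasDerivWithinAt f (f' x) (Set.Ici x) x)
    (hg' : ∀ x, HasDerivWithinAt g (f' x) (Set.Ici x) x)
    (ha : ∀ x ≤ a, f x = g x) (x : ℝ) : f x = g x := by
  rcases le_or_gt x a with hx | hx
  · exact ha x hx
  · exact eq_of_has_deriv_right_eq (fun y _ => hf' y) (fun y _ => hg' y) hf.continuousOn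
      hg.continuousOn (ha a le_rfl) x ⟨hx.le, le_rfl⟩

theorem bspline_two (x : ℝ) : bspline 2 x = x * bspline 1 x + (2 - x) * bspline 1 (x - 1) := by
  rcases le_or_gt x 0 with hx | hx
  · rw [bspline_succ_succ_eq_zero_of_nonpos 0 hx, bspline_eq_zero_of_neg 1 (x := x - 1) (by linarith)]
    rcases hx.lt_or_eq with h | rfl
    · rw [bspline_eq_zero_of_neg 1 h]; ring
    · ring
  rcases lt_or_ge x 1 with hx1 | hx1
  · rw [bspline_one_of_mem hx.le hx1, bspline_eq_zero_of_neg 1 (by linarith), bspline_succ_succ,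
      ← intervalIntegral.integral_add_adjacent_intervals (b := 0)
      (bspline_intervalIntegrable _ _ _) (bspline_intervalIntegrable _ _ _),
      intervalIntegral.integral_congr_Ioo_of_le (g := fun _ => 0) (by linarith),
      intervalIntegral.integral_congr_Ioo_of_le (a := 0) (g := fun _ => 1) (by linarith)]
    · simp
    · exact fun t ht => bspline_one_of_mem ht.1.le (ht.2.trans hx1)
    · exact fun t ht => bspline_eq_zero_of_neg _ ht.2
  rcases lt_or_ge x 2 with hx2 | hx2
  · rw [bspline_one_of_mem (x := x - 1) (by linarith) (by linarith),
      bspline_eq_zero_of_le 1 (by simpa using hx1), bspline_succ_succ,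
      ← intervalIntegral.integral_add_adjacent_intervals (b := 1)
      (bspline_intervalIntegrable _ _ _) (bspline_intervalIntegrable _ _ _),
      intervalIntegral.integral_congr_Ioo_of_le (b := 1) (g := fun _ => 1) (by linarith),
      intervalIntegral.integral_congr_Ioo_of_le (a := 1) (g := fun _ => 0) (by linarith)]
    · simp; ring
    · exact fun t ht => bspline_eq_zero_of_le 1 (by simpa using ht.1.le)
    · exact fun t ht => bspline_one_of_mem (by linarith [ht.1]) ht.2
  · rw [bspline_eq_zero_of_le 2 (by simpa using hx2), bspline_eq_zero_of_le 1 (by simpa using hx1),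
      bspline_eq_zero_of_le 1 (by push_cast; linarith)]
    ring

/-- Both sides vanish for x ≤ 0 and have the same right derivative; the difference of the
lower-order recurrences at x and at x - 1 is exactly what matches the derivatives. -/
theorem bspline_recurrence (n : ℕ) (x : ℝ) :
    (n + 1) * bspline (n + 2) x
      = x * bspline (n + 1) x + (n + 2 - x) * bspline (n + 1) (x - 1) := by
  induction n generalizing x with
  | zero => simpa using bspline_two x
  | succ n ih =>
    push_cast
    refine eq_of_hasDerivWithinAt_Ici (a := 0)
      (f' := fun x => (n + 2) * (bspline (n + 2) x - bspline (n + 2) (x - 1)))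
      (f := fun x => ((n : ℝ) + 1 + 1) * bspline (n + 3) x)
      (g := fun x => x * bspline (n + 2) x + ((n : ℝ) + 1 + 2 - x) * bspline (n + 2) (x - 1))
      ?_ ?_ ?_ ?_ ?_ x
    · exact continuous_const.mul (continuous_bspline _)
    · have := continuous_bspline n
      fun_prop
    · intro x
      have := (bspline_hasDerivWithinAt (n + 1) x).const_mul ((n : ℝ) + 1 + 1)
      exact this.congr_deriv (by ring)
    · intro x
      have h1 := bspline_hasDerivWithinAt n x
      have h2 : HasDerivWithinAt (fun y => bspline (n + 2) (y - 1))
          (bspline (n + 1) (x - 1) - bspline (n + 1) (x - 1 - 1)) (Set.Ici x) x :=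
        hasDerivWithinAt_Ici_comp_sub_one (bspline_hasDerivWithinAt n (x - 1))
      have h3 := ((hasDerivAt_id x).hasDerivWithinAt (s := Set.Ici x)).mul h1
      have h4 := ((hasDerivAt_id x).hasDerivWithinAt (s := Set.Ici x)).const_sub ((n : ℝ) + 1 + 2)
      have h5 := h3.add (h4.mul h2)
      have e1 := ih x
      have e2 := ih (x - 1)
      refine h5.congr_deriv ?_
      simp only [id]
      linear_combination e2 - e1
    · intro x hx
      rw [bspline_succ_succ_eq_zero_of_nonpos _ hx, bspline_succ_succ_eq_zero_of_nonpos _ hx,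
        bspline_succ_succ_eq_zero_of_nonpos _ (by linarith)]
      ring

/-- The reflection swaps the two terms of `bspline_recurrence`. Order 1 is left out because the
half-open interval breaks the symmetry at the endpoints. -/
theorem bspline_symm (n : ℕ) (x : ℝ) : bspline (n + 2) (n + 2 - x) = bspline (n + 2) x := by
  induction n generalizing x with
  | zero =>
    simp only [bspline_two, Nat.cast_zero, zero_add]
    rcases lt_trichotomy x 1 with h | rfl | h
    · rcases lt_trichotomy x 0 with h' | rfl | h'
      · rw [bspline_eq_zero_of_le 1 (by push_cast; linarith),
          bspline_eq_zero_of_le 1 (by push_cast; linarith), bspline_eq_zero_of_neg 1 h',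
          bspline_eq_zero_of_neg 1 (by linarith)]
        ring
      · rw [bspline_eq_zero_of_le 1 (by push_cast; linarith),
          bspline_eq_zero_of_neg 1 (by linarith : (0 : ℝ) - 1 < 0)]
        ring
      · rw [bspline_eq_zero_of_le 1 (by push_cast; linarith),
          bspline_one_of_mem (x := 2 - x - 1) (by linarith) (by linarith),
          bspline_one_of_mem h'.le h, bspline_eq_zero_of_neg 1 (by linarith)]
        ring
    · norm_num
    · rcases lt_trichotomy x 2 with h' | rfl | h'
      · rw [bspline_one_of_mem (x := 2 - x) (by linarith) (by linarith),
          bspline_eq_zero_of_neg 1 (by linarith), bspline_eq_zero_of_le 1 (by push_cast; linarith),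
          bspline_one_of_mem (x := x - 1) (by linarith) (by linarith)]
        ring
      · rw [bspline_eq_zero_of_neg 1 (by linarith : (2 : ℝ) - 2 - 1 < 0),
          bspline_eq_zero_of_le 1 (by push_cast; linarith : ((1 : ℕ) : ℝ) ≤ 2)]
        ring
      · rw [bspline_eq_zero_of_neg 1 (by linarith), bspline_eq_zero_of_neg 1 (by linarith),
          bspline_eq_zero_of_le 1 (by push_cast; linarith),
          bspline_eq_zero_of_le 1 (by push_cast; linarith)]
        ring
  | succ n ih =>
    have h1 := bspline_recurrence (n + 1) ((n + 1 : ℕ) + 2 - x)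
    have h2 := bspline_recurrence (n + 1) x
    have e1 := ih x
    have e2 := ih (x - 1)
    have a1 : ((n + 1 : ℕ) : ℝ) + 2 - x = n + 2 - (x - 1) := by push_cast; ring
    have a2 : (n : ℝ) + 2 - (x - 1) - 1 = n + 2 - x := by ring
    rw [a1] at h1 ⊢
    rw [a2, e1, e2] at h1
    have : ((n + 1 : ℕ) : ℝ) + 1 ≠ 0 := by positivity
    refine mul_left_cancel₀ this (h1.trans ?_)
    rw [h2]
    push_cast
    ring

/-- Averaging a shift of N(2·) over a unit interval gives half the sum of two adjacent shifts of the
next order, so the coefficients evolve by Pascal's rule. -/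
theorem bspline_two_scale (n : ℕ) (x : ℝ) :
    bspline (n + 1) x = (2 ^ n)⁻¹ *
      ∑ k ∈ Finset.range (n + 2), ((n + 1).choose k : ℝ) * bspline (n + 1) (2 * x - k) := by
  induction n generalizing x with
  | zero =>
    simp only [Finset.sum_range_succ, Finset.sum_range_zero]
    norm_num
    rcases lt_or_ge x 0 with h | h
    · rw [bspline_eq_zero_of_neg 1 h, bspline_eq_zero_of_neg 1 (by linarith),
        bspline_eq_zero_of_neg 1 (by linarith)]
      ring
    rcases lt_or_ge x (1 / 2) with h1 | h1
    · rw [bspline_one_of_mem h (by linarith), bspline_one_of_mem (x := 2 * x) (by linarith)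
        (by linarith), bspline_eq_zero_of_neg 1 (by linarith)]
      ring
    rcases lt_or_ge x 1 with h2 | h2
    · rw [bspline_one_of_mem h (by linarith), bspline_one_of_mem (x := 2 * x - 1) (by linarith)
        (by linarith), bspline_eq_zero_of_le 1 (by push_cast; linarith)]
      ring
    · rw [bspline_eq_zero_of_le 1 (by simpa using h2), bspline_eq_zero_of_le 1
        (by push_cast; linarith), bspline_eq_zero_of_le 1 (by push_cast; linarith)]
      ring
  | succ n ih =>
    have hI : ∀ k : ℕ, (∫ y in (0 : ℝ)..1, bspline (n + 1) (2 * (x - y) - k)) =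
        2⁻¹ * (bspline (n + 2) (2 * x - k) + bspline (n + 2) (2 * x - k - 1)) := by
      intro k
      have h1 : ∀ y, bspline (n + 1) (2 * (x - y) - k) = bspline (n + 1) (2 * x - k - 2 * y) :=
        fun y => by ring_nf
      simp_rw [h1]
      rw [intervalIntegral.integral_comp_sub_mul (fun t => bspline (n + 1) t) two_ne_zero,
        bspline_succ_succ, bspline_succ_succ, add_comm (intervalIntegral _ _ _ _),
        intervalIntegral.integral_add_adjacent_intervals (bspline_intervalIntegrable _ _ _)
        (bspline_intervalIntegrable _ _ _), smul_eq_mul]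
      congr 2 <;> ring
    have h0 : bspline (n + 1 + 1) x = (2 ^ n)⁻¹ * ∑ k ∈ Finset.range (n + 2),
        ((n + 1).choose k : ℝ) *
          (2⁻¹ * (bspline (n + 2) (2 * x - k) + bspline (n + 2) (2 * x - k - 1))) := by
      rw [show bspline (n + 1 + 1) x = ∫ y in (0 : ℝ)..1, bspline (n + 1) (x - y) by rw [bspline]]
      simp only [fun y => ih (x - y)]
      rw [intervalIntegral.integral_const_mul, intervalIntegral.integral_finsetSum]
      · simp_rw [intervalIntegral.integral_const_mul, hI]
      · intro k _
        refine IntervalIntegrable.const_mul ?_ _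
        refine (intervalIntegrable_const (c := (1 : ℝ))).mono_fun
          ((measurable_bspline _).comp (by fun_prop)).aestronglyMeasurable ?_
        refine Eventually.of_forall fun y => ?_
        simpa [abs_of_nonneg (bspline_nonneg _ _)] using bspline_le_one _ _
    rw [h0]
    have h2 : ∑ k ∈ Finset.range (n + 3), ((n + 2).choose k : ℝ) * bspline (n + 2) (2 * x - k) =
        ∑ k ∈ Finset.range (n + 2), ((n + 1).choose k : ℝ) *
          (bspline (n + 2) (2 * x - k) + bspline (n + 2) (2 * x - k - 1)) := by
      rw [Finset.sum_range_succ' _ (n + 2)]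
      have h3 := Finset.sum_range_succ' (fun k : ℕ => ((n + 1).choose k : ℝ) *
        bspline (n + 2) (2 * x - k)) (n + 2)
      rw [Finset.sum_range_succ] at h3
      simp only [Nat.choose_succ_self, Nat.cast_zero, zero_mul, add_zero] at h3
      simp_rw [mul_add, Finset.sum_add_distrib]
      rw [h3]
      have h4 : ∀ k : ℕ, ((n + 2).choose (k + 1) : ℝ) * bspline (n + 2) (2 * x - (k + 1 : ℕ)) =
          ((n + 1).choose (k + 1) : ℝ) * bspline (n + 2) (2 * x - (k + 1 : ℕ)) +
          ((n + 1).choose k : ℝ) * bspline (n + 2) (2 * x - k - 1) := by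
        intro k
        rw [Nat.choose_succ_succ' (n + 1) k]
        push_cast
        rw [sub_sub (2 * x)]
        ring
      simp_rw [h4, Finset.sum_add_distrib]
      simp
      ring
    rw [show n + 1 + 2 = n + 3 from rfl, show n + 1 + 1 = n + 2 from rfl, h2, Finset.mul_sum,
      Finset.mul_sum]
    refine Finset.sum_congr rfl fun k _ => ?_
    rw [pow_succ]
    ring

end CardinalBSpline

/-! ### Integer shifts of a B-spline: partition of unity and independence. -/

namespace CardinalBSpline

theorem bspline_sub_eq_zero_of_notMem (n : ℕ) {a b x : ℝ} (ha : a ≤ x) (hb : x ≤ b) {l : ℤ}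
    (hl : l ∉ Finset.Icc ⌈a - n⌉ ⌊b⌋) : bspline n (x - l) = 0 := by
  rw [Finset.mem_Icc, not_and_or, not_le, not_le, Int.lt_ceil, Int.floor_lt] at hl
  rcases hl with h | h
  · exact bspline_eq_zero_of_le n (by linarith)
  · exact bspline_eq_zero_of_neg n (by linarith)

theorem hasSum_mul_bspline_of_mem (n : ℕ) {a b x : ℝ} (ha : a ≤ x) (hb : x ≤ b) (e : ℤ → ℝ) :
    HasSum (fun l : ℤ => e l * bspline n (x - l))
      (∑ l ∈ Finset.Icc ⌈a - n⌉ ⌊b⌋, e l * bspline n (x - l)) :=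
  hasSum_sum_of_ne_finset_zero fun l hl => by
    rw [bspline_sub_eq_zero_of_notMem n ha hb hl, mul_zero]

theorem summable_mul_bspline (n : ℕ) (x : ℝ) (e : ℤ → ℝ) :
    Summable (fun l : ℤ => e l * bspline n (x - l)) :=
  (hasSum_mul_bspline_of_mem n le_rfl le_rfl e).summable

theorem hasSum_bspline_shifts (n : ℕ) (x : ℝ) :
    HasSum (fun l : ℤ => bspline (n + 1) (x - l)) 1 := by
  induction n generalizing x with
  | zero =>
    convert hasSum_single (f := fun l : ℤ => bspline (0 + 1) (x - l)) ⌊x⌋ ?_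
    · exact (bspline_one_of_mem (sub_nonneg.2 (Int.floor_le x))
        (by linarith [Int.lt_floor_add_one x])).symm
    · intro l hl
      rcases hl.lt_or_gt with h | h
      · refine bspline_eq_zero_of_le 1 ?_
        have : (l : ℝ) + 1 ≤ ⌊x⌋ := by exact_mod_cast h
        push_cast
        linarith [Int.floor_le x]
      · exact bspline_eq_zero_of_neg 1 (by linarith [Int.floor_lt.1 h])
  | succ n ih =>
    have h1 := fun (y : ℝ) (ha : x - 1 ≤ y) (hb : y ≤ x) =>
      hasSum_mul_bspline_of_mem (n + 1) ha hb (fun _ => 1)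
    simp only [one_mul] at h1
    have h2 : ∀ y ∈ Set.uIcc (0 : ℝ) 1,
        ∑ l ∈ Finset.Icc ⌈x - 1 - (n + 1 : ℕ)⌉ ⌊x⌋, bspline (n + 1) (x - l - y) = 1 := by
      intro y hy
      rw [Set.uIcc_of_le zero_le_one] at hy
      have := (h1 (x - y) (by linarith [hy.2]) (by linarith [hy.1])).unique (ih (x - y))
      exact (Finset.sum_congr rfl fun l _ => by rw [sub_right_comm]).trans this
    have h3 := hasSum_mul_bspline_of_mem (n + 2) (a := x - 1 + 1) (b := x) (x := x)
      (by linarith) le_rfl (fun _ => 1)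
    simp only [one_mul] at h3
    convert h3
    rw [show x - 1 + 1 - ((n + 2 : ℕ) : ℝ) = x - 1 - (n + 1 : ℕ) by push_cast; ring]
    simp only [bspline]
    rw [← intervalIntegral.integral_finsetSum, intervalIntegral.integral_congr h2]
    · simp
    · intro l _
      refine (intervalIntegrable_const (c := (1 : ℝ))).mono_fun
        ((measurable_bspline _).comp (by fun_prop)).aestronglyMeasurable ?_
      refine Eventually.of_forall fun y => ?_
      simpa [abs_of_nonneg (bspline_nonneg _ _)] using bspline_le_one _ _

/-- Differentiate the vanishing series from the right, which is legitimate since locally it is a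
fixed finite sum, and then sum by parts. -/
theorem hasSum_sub_mul_bspline_of_forall_eq_zero (n : ℕ) (e : ℤ → ℝ)
    (h : ∀ x : ℝ, HasSum (fun l : ℤ => e l * bspline (n + 2) (x - l)) 0) (x : ℝ) :
    HasSum (fun l : ℤ => (e l - e (l - 1)) * bspline (n + 1) (x - l)) 0 := by
  set S := Finset.Icc ⌈x - (n + 2 : ℕ)⌉ ⌊x + 1⌋ with hS
  have hd : HasDerivWithinAt (fun y => ∑ l ∈ S, e l * bspline (n + 2) (y - l))
      (∑ l ∈ S, e l * (bspline (n + 1) (x - l) - bspline (n + 1) (x - l - 1))) (Set.Ici x) x := by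
    refine HasDerivWithinAt.fun_sum fun l _ => HasDerivWithinAt.const_mul _ ?_
    have := HasDerivWithinAt.comp x (bspline_hasDerivWithinAt n (x - l))
      (((hasDerivAt_id x).sub_const (l : ℝ)).hasDerivWithinAt (s := Set.Ici x))
      (fun y hy => by simpa using hy)
    rw [mul_one] at this
    exact this
  have h0 : HasDerivWithinAt (fun y => ∑ l ∈ S, e l * bspline (n + 2) (y - l)) 0
      (Set.Ici x) x := by
    refine (hasDerivWithinAt_const x (Set.Ici x) (0 : ℝ)).congr_of_eventuallyEq ?_ ?_
    · filter_upwards [self_mem_nhdsWithin,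
        mem_nhdsWithin_of_mem_nhds (Iio_mem_nhds (lt_add_one x))] with y hy hy'
      exact (hasSum_mul_bspline_of_mem (n + 2) hy (le_of_lt hy') e).unique (h y)
    · exact (hasSum_mul_bspline_of_mem (n + 2) le_rfl (by linarith) e).unique (h x)
  have h1 : ∑ l ∈ S, e l * (bspline (n + 1) (x - l) - bspline (n + 1) (x - l - 1)) = 0 :=
    (uniqueDiffOn_Ici x x Set.self_mem_Ici).eq_deriv _ hd h0
  have h2 : HasSum (fun l : ℤ => e l * (bspline (n + 1) (x - l) - bspline (n + 1) (x - l - 1)))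
      0 := by
    rw [← h1]
    refine hasSum_sum_of_ne_finset_zero fun l hl => ?_
    rw [Finset.mem_Icc, not_and_or, not_le, not_le, Int.lt_ceil, Int.floor_lt] at hl
    push_cast at hl
    rcases hl with h | h
    · rw [bspline_eq_zero_of_le (n + 1) (by push_cast; linarith),
        bspline_eq_zero_of_le (n + 1) (by push_cast; linarith)]
      ring
    · rw [bspline_eq_zero_of_neg _ (by linarith), bspline_eq_zero_of_neg _ (by linarith)]
      ring
  have s1 := (summable_mul_bspline (n + 1) x e).hasSum
  have s2 := (Equiv.subRight (1 : ℤ)).hasSum_iff.2 (s1.sub h2)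
  have s3 := s1.sub s2
  simp only [sub_zero, sub_self] at s3
  convert! s3 using 2 with l
  simp only [Function.comp, Equiv.subRight_apply]
  push_cast
  rw [show x - ((l : ℝ) - 1) - 1 = x - l by ring]
  ring

/-- By induction on the order the differences of `e` vanish, so `e` is constant, and the partition
of unity forces that constant to be 0. -/
theorem eq_zero_of_hasSum_mul_bspline (n : ℕ) (e : ℤ → ℝ) (C : ℝ) (hC : ∀ l, |e l| ≤ C)
    (h : ∀ x : ℝ, HasSum (fun l : ℤ => e l * bspline (n + 1) (x - l)) 0) : e = 0 := by
  induction n generalizing e C with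
  | zero =>
    funext k
    have h1 := hasSum_single (f := fun l : ℤ => e l * bspline (0 + 1) (k - l)) k ?_
    · have := h1.unique (h k)
      rwa [sub_self, bspline_one_of_mem le_rfl one_pos, mul_one] at this
    · intro l hl
      rcases hl.lt_or_gt with h | h
      · have : (l : ℝ) + 1 ≤ k := by exact_mod_cast h
        rw [bspline_eq_zero_of_le 1 (by push_cast; linarith), mul_zero]
      · have : (k : ℝ) < l := by exact_mod_cast h
        rw [bspline_eq_zero_of_neg 1 (by linarith), mul_zero]
  | succ n ih =>
    have h1 := ih (fun l => e l - e (l - 1)) (C + C)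
      (fun l => (abs_sub _ _).trans (add_le_add (hC _) (hC _)))
      (hasSum_sub_mul_bspline_of_forall_eq_zero n e h)
    have h2 : ∀ l, e l = e 0 := by
      intro l
      induction l using Int.induction_on with
      | zero => rfl
      | succ i hi =>
        have := congrFun h1 (i + 1)
        simp only [add_sub_cancel_right, Pi.zero_apply] at this
        linarith
      | pred i hi =>
        have := congrFun h1 (-i)
        simp only [Pi.zero_apply] at this
        linarith
    have h3 := h 0
    simp_rw [h2] at h3
    have h4 := h3.unique ((hasSum_bspline_shifts (n + 1) 0).mul_left (e 0))
    funext l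
    rw [h2 l, Pi.zero_apply]
    linarith

end CardinalBSpline

/-! ### Real-rootedness of the Euler–Frobenius polynomial. -/

namespace CardinalBSpline

/-- The Eulerian number `⟨n, i⟩`, expressed through a B-spline value. -/
noncomputable def eulerianCoeff (n i : ℕ) : ℝ := (n.factorial : ℝ) * bspline (n + 1) (i + 1)

theorem eulerianCoeff_eq_zero {n i : ℕ} (h : n ≤ i) : eulerianCoeff n i = 0 := by
  rw [eulerianCoeff, bspline_eq_zero_of_le, mul_zero]
  exact_mod_cast Nat.succ_le_succ h

theorem eulerianCoeff_succ_succ (n i : ℕ) : eulerianCoeff (n + 2) (i + 1) =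
    (i + 2) * eulerianCoeff (n + 1) (i + 1) + (n + 1 - i) * eulerianCoeff (n + 1) i := by
  have := bspline_recurrence (n + 1) ((i : ℝ) + 2)
  rw [show (i : ℝ) + 2 - 1 = i + 1 by ring] at this
  simp only [eulerianCoeff, Nat.factorial_succ (n + 1)]
  push_cast at this ⊢
  rw [show (i : ℝ) + 1 + 1 = i + 2 by ring]
  linear_combination ((n + 1).factorial : ℝ) * this

theorem eulerianCoeff_succ_zero (n : ℕ) :
    eulerianCoeff (n + 2) 0 = eulerianCoeff (n + 1) 0 := by
  have := bspline_recurrence (n + 1) 1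
  rw [sub_self, bspline_succ_succ_eq_zero_of_nonpos n le_rfl] at this
  simp only [eulerianCoeff, Nat.factorial_succ (n + 1)]
  push_cast at this ⊢
  rw [zero_add]
  linear_combination ((n + 1).factorial : ℝ) * this

theorem eulerianCoeff_one_zero : eulerianCoeff 1 0 = 1 := by
  have := bspline_two 1
  rw [sub_self, bspline_eq_zero_of_le 1 (by simp), bspline_one_of_mem le_rfl one_pos] at this
  simp [eulerianCoeff, this]
  norm_num

theorem eulerianCoeff_pos {n i : ℕ} (h : i < n) : 0 < eulerianCoeff n i := by
  induction n generalizing i with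
  | zero => omega
  | succ n ih =>
    match n with
    | 0 =>
      obtain rfl : i = 0 := by omega
      rw [eulerianCoeff_one_zero]; exact one_pos
    | k + 1 =>
      match i with
      | 0 => rw [eulerianCoeff_succ_zero]; exact ih (by omega)
      | i + 1 =>
        rw [eulerianCoeff_succ_succ]
        have h1 : (i : ℝ) < k + 1 := by exact_mod_cast (by omega : i < k + 1)
        have h2 := ih (i := i) (by omega)
        have h3 : 0 ≤ eulerianCoeff (k + 1) (i + 1) :=
          mul_nonneg (by positivity) (bspline_nonneg _ _)
        have : 0 < ((k : ℝ) + 1 - i) * eulerianCoeff (k + 1) i := mul_pos (by linarith) h2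
        positivity

theorem eulerianCoeff_symm {n i : ℕ} (h : i < n) :
    eulerianCoeff n (n - 1 - i) = eulerianCoeff n i := by
  obtain ⟨k, rfl⟩ : ∃ k, n = k + 1 := ⟨n - 1, by omega⟩
  simp only [eulerianCoeff]
  congr 1
  rw [← bspline_symm]
  congr 1
  rw [show k + 1 - 1 - i = k - i by omega, Nat.cast_sub (by omega)]
  ring

open Polynomial

/-- The polynomial in `t` obtained from the polylogarithm `∑ jⁿ zʲ` by `t = 1 / (1 - z)`. -/
noncomputable def polylogPoly (n : ℕ) : ℝ[X] :=
  ∑ i ∈ Finset.range n, C (eulerianCoeff n i) * ((X - 1) ^ (i + 1) * X ^ (n - i))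

noncomputable def eulerianPoly (n : ℕ) : ℝ[X] :=
  ∑ i ∈ Finset.range n, C (eulerianCoeff n i) * X ^ i

/-- Under t = 1/(1 - z) the operator z d/dz, which raises the exponent n in ∑ jⁿ zʲ, becomes (t² -
t) d/dt. On coefficients this is the Eulerian recurrence. -/
theorem polylogPoly_succ (n : ℕ) :
    polylogPoly (n + 2) = (X ^ 2 - X) * derivative (polylogPoly (n + 1)) := by
  have h1 : (X ^ 2 - X) * derivative (polylogPoly (n + 1)) =
      ∑ i ∈ Finset.range (n + 1), (C ((i + 1) * eulerianCoeff (n + 1) i) *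
          ((X - 1) ^ (i + 1) * X ^ (n + 2 - i)) +
        C ((n + 1 - i) * eulerianCoeff (n + 1) i) * ((X - 1) ^ (i + 2) * X ^ (n + 1 - i))) := by
    rw [polylogPoly, derivative_sum, Finset.mul_sum]
    refine Finset.sum_congr rfl fun i hi => ?_
    obtain ⟨j, rfl⟩ : ∃ j, n = i + j := ⟨n - i, by have := Finset.mem_range.1 hi; omega⟩
    rw [show i + j + 1 - i = j + 1 by omega, show i + j + 2 - i = j + 2 by omega]
    simp only [derivative_mul, derivative_C, derivative_pow, derivative_X,
      derivative_one, map_mul, map_add, map_sub, map_one, map_natCast, Nat.add_sub_cancel]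
    push_cast
    ring
  rw [h1, Finset.sum_add_distrib, polylogPoly, Finset.sum_range_succ']
  have h2 := Finset.sum_range_succ' (fun i : ℕ => C (((i : ℝ) + 1) * eulerianCoeff (n + 1) i) *
          ((X - 1) ^ (i + 1) * X ^ (n + 2 - i))) (n + 1)
  rw [Finset.sum_range_succ, eulerianCoeff_eq_zero le_rfl] at h2
  simp only [mul_zero, map_zero, zero_mul, add_zero] at h2
  rw [h2, add_right_comm, ← Finset.sum_add_distrib]
  congr 1
  · refine Finset.sum_congr rfl fun i hi => ?_
    rw [eulerianCoeff_succ_succ, show n + 2 - (i + 1) = n + 1 - i by omega, ← add_mul, ← map_add]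
    push_cast
    ring_nf
  · rw [eulerianCoeff_succ_zero]
    simp

theorem polylogPoly_eval_zero (n : ℕ) : (polylogPoly n).eval 0 = 0 := by
  rw [polylogPoly, eval_finsetSum]
  refine Finset.sum_eq_zero fun i hi => ?_
  have := Finset.mem_range.1 hi
  simp [show n - i ≠ 0 by omega]

theorem polylogPoly_eval_one (n : ℕ) : (polylogPoly n).eval 1 = 0 := by
  rw [polylogPoly, eval_finsetSum]
  exact Finset.sum_eq_zero fun i hi => by simp

theorem polylogPoly_eval (n : ℕ) {t : ℝ} (ht : t ≠ 0) :
    (polylogPoly n).eval t = (t - 1) * t ^ n * (eulerianPoly n).eval ((t - 1) / t) := by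
  rw [polylogPoly, eulerianPoly, eval_finsetSum, eval_finsetSum, Finset.mul_sum]
  refine Finset.sum_congr rfl fun i hi => ?_
  obtain ⟨j, rfl⟩ : ∃ j, n = i + j := ⟨n - i, by have := Finset.mem_range.1 hi; omega⟩
  simp only [eval_mul, eval_C, eval_pow, eval_sub, eval_X, eval_one, Nat.add_sub_cancel_left, div_pow]
  field_simp
  ring

/-- Rolle's theorem gives a root of the derivative, not a root of the polynomial, between any two
consecutive roots. The factor X² - X restores 0 and 1, so each step gains one distinct root. -/
theorem card_roots_polylogPoly (n : ℕ) :
    n + 2 ≤ (polylogPoly (n + 1)).roots.toFinset.card := by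
  have ne_zero : ∀ {p : ℝ[X]} {k : ℕ}, k + 1 ≤ p.roots.toFinset.card → p ≠ 0 := by
    rintro p k h rfl
    simp at h
  induction n with
  | zero =>
    have h : polylogPoly 1 = (X - 1) * X := by
      simp [polylogPoly, eulerianCoeff_one_zero]
    have h0 : polylogPoly 1 ≠ 0 := by
      rw [h]; exact mul_ne_zero (X_sub_C_ne_zero 1) X_ne_zero
    calc 0 + 2 = ({0, 1} : Finset ℝ).card := by simp
      _ ≤ _ := Finset.card_le_card fun x hx => by
        simp only [Finset.mem_insert, Finset.mem_singleton] at hx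
        rw [Multiset.mem_toFinset, mem_roots h0]
        rcases hx with rfl | rfl
        · exact polylogPoly_eval_zero _
        · exact polylogPoly_eval_one _
  | succ n ih =>
    have h1 := card_roots_toFinset_le_card_roots_derivative_sdiff_roots_succ (polylogPoly (n + 1))
    set D := (derivative (polylogPoly (n + 1))).roots.toFinset \
      (polylogPoly (n + 1)).roots.toFinset with hD
    have hp := ne_zero ih
    have hd : derivative (polylogPoly (n + 1)) ≠ 0 := by
      intro h
      rw [hD, h] at h1
      simp at h1
      omega
    have hx2 : (X ^ 2 - X : ℝ[X]) ≠ 0 := by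
      rw [show (X ^ 2 - X : ℝ[X]) = (X - C 1) * X by rw [map_one]; ring]
      exact mul_ne_zero (X_sub_C_ne_zero 1) X_ne_zero
    have h0 : polylogPoly (n + 2) ≠ 0 := by
      rw [polylogPoly_succ]; exact mul_ne_zero hx2 hd
    have hdis : Disjoint ({0, 1} : Finset ℝ) D := by
      rw [Finset.disjoint_left]
      intro x hx hx'
      refine (Finset.mem_sdiff.1 hx').2 ?_
      simp only [Finset.mem_insert, Finset.mem_singleton] at hx
      rw [Multiset.mem_toFinset, mem_roots hp]
      rcases hx with rfl | rfl
      · exact polylogPoly_eval_zero _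
      · exact polylogPoly_eval_one _
    calc n + 1 + 2 ≤ 2 + D.card := by omega
      _ = (({0, 1} : Finset ℝ) ∪ D).card := by
        rw [Finset.card_union_of_disjoint hdis]; simp
      _ ≤ _ := Finset.card_le_card fun x hx => by
        rw [Multiset.mem_toFinset, mem_roots h0]
        rcases Finset.mem_union.1 hx with hx | hx
        · simp only [Finset.mem_insert, Finset.mem_singleton] at hx
          rcases hx with rfl | rfl
          · exact polylogPoly_eval_zero _
          · exact polylogPoly_eval_one _
        · have := (Finset.mem_sdiff.1 hx).1
          rw [Multiset.mem_toFinset, mem_roots hd] at this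
          rw [polylogPoly_succ, IsRoot, eval_mul, this, mul_zero]

theorem eulerianPoly_coeff (n k : ℕ) : (eulerianPoly n).coeff k = eulerianCoeff n k := by
  simp only [eulerianPoly, finsetSum_coeff, coeff_C_mul, coeff_X_pow, mul_ite, mul_one, mul_zero]
  rw [Finset.sum_ite_eq]
  split_ifs with h
  · rfl
  · exact (eulerianCoeff_eq_zero (by simpa using h)).symm

theorem natDegree_eulerianPoly (n : ℕ) : (eulerianPoly (n + 1)).natDegree = n := by
  refine natDegree_eq_of_le_of_coeff_ne_zero ?_ ?_
  · rw [natDegree_le_iff_coeff_eq_zero]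
    intro k hk
    rw [eulerianPoly_coeff, eulerianCoeff_eq_zero hk]
  · rw [eulerianPoly_coeff]
    exact (eulerianCoeff_pos (by omega)).ne'

theorem eulerianPoly_ne_zero (n : ℕ) : eulerianPoly (n + 1) ≠ 0 := by
  intro h
  have := eulerianPoly_coeff (n + 1) 0
  rw [h, coeff_zero] at this
  exact (eulerianCoeff_pos (by omega)).ne this

/-- The map t ↦ (t - 1)/t sends the roots other than 0 and 1 injectively to roots of the Eulerian
polynomial. -/
theorem card_roots_toFinset_eulerianPoly (n : ℕ) :
    n ≤ (eulerianPoly (n + 1)).roots.toFinset.card := by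
  have h1 := card_roots_polylogPoly n
  have hp : polylogPoly (n + 1) ≠ 0 := by
    intro h; rw [h] at h1; simp at h1
  set S := (polylogPoly (n + 1)).roots.toFinset \ {0, 1} with hS
  have h2 : n ≤ S.card := by
    have := Finset.le_card_sdiff ({0, 1} : Finset ℝ) (polylogPoly (n + 1)).roots.toFinset
    rw [← hS] at this
    have h3 : ({0, 1} : Finset ℝ).card = 2 := by simp
    omega
  refine h2.trans (Finset.card_le_card_of_injOn (fun t => (t - 1) / t) ?_ ?_)
  · intro t ht
    rw [hS, Finset.coe_sdiff, Set.mem_sdiff, Finset.mem_coe, Multiset.mem_toFinset,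
      mem_roots hp] at ht
    simp only [Finset.coe_insert, Finset.coe_singleton, Set.mem_insert_iff,
      Set.mem_singleton_iff, not_or] at ht
    obtain ⟨h, h0, h1⟩ := ht
    rw [Finset.mem_coe, Multiset.mem_toFinset, mem_roots (eulerianPoly_ne_zero n)]
    rw [IsRoot, polylogPoly_eval _ h0] at h
    have : (t - 1) * t ^ (n + 1) ≠ 0 := mul_ne_zero (sub_ne_zero.2 h1) (pow_ne_zero _ h0)
    exact (mul_eq_zero.1 h).resolve_left this
  · intro t ht s hs hts
    simp only [hS, Finset.coe_sdiff, Set.mem_sdiff, Finset.coe_insert, Finset.coe_singleton,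
      Set.mem_insert_iff, Set.mem_singleton_iff, not_or] at ht hs
    have h0 := ht.2.1
    have h0' := hs.2.1
    simp only at hts
    rw [div_eq_div_iff h0 h0'] at hts
    linarith

theorem card_roots_eulerianPoly (n : ℕ) :
    (eulerianPoly (n + 1)).roots.card = n ∧ (eulerianPoly (n + 1)).roots.Nodup := by
  have h1 := card_roots_toFinset_eulerianPoly n
  have h2 := card_roots' (eulerianPoly (n + 1))
  rw [natDegree_eulerianPoly] at h2
  have h3 := Multiset.toFinset_card_le (eulerianPoly (n + 1)).roots
  exact ⟨by omega, Multiset.toFinset_card_eq_card_iff_nodup.1 (by omega)⟩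

theorem neg_of_mem_roots_eulerianPoly (n : ℕ) {x : ℝ} (hx : x ∈ (eulerianPoly (n + 1)).roots) :
    x < 0 := by
  by_contra! h
  have h1 := (mem_roots (eulerianPoly_ne_zero n)).1 hx
  rw [IsRoot, eulerianPoly, eval_finsetSum, Finset.sum_range_succ'] at h1
  simp only [eval_mul, eval_C, eval_pow, eval_X, pow_zero, mul_one] at h1
  have h2 : 0 ≤ ∑ i ∈ Finset.range n, eulerianCoeff (n + 1) (i + 1) * x ^ (i + 1) :=
    Finset.sum_nonneg fun i hi => mul_nonneg
      (eulerianCoeff_pos (by have := Finset.mem_range.1 hi; omega)).le (by positivity)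
  linarith [eulerianCoeff_pos (n := n + 1) (i := 0) (by omega)]

/-- The coefficients are palindromic, by the symmetry of the B-spline. -/
theorem inv_mem_roots_eulerianPoly (n : ℕ) {x : ℝ} (hx : x ∈ (eulerianPoly (n + 1)).roots) :
    x⁻¹ ∈ (eulerianPoly (n + 1)).roots := by
  have h0 := neg_of_mem_roots_eulerianPoly n hx
  rw [mem_roots (eulerianPoly_ne_zero n), IsRoot] at hx ⊢
  have : (eulerianPoly (n + 1)).eval x⁻¹ * x ^ n = (eulerianPoly (n + 1)).eval x := by
    rw [eulerianPoly, eval_finsetSum, eval_finsetSum, ← Finset.sum_range_reflect, Finset.sum_mul]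
    refine Finset.sum_congr rfl fun i hi => ?_
    have hi := Finset.mem_range.1 hi
    rw [eulerianCoeff_symm hi]
    obtain ⟨j, rfl⟩ : ∃ j, n = i + j := ⟨n - i, by omega⟩
    rw [show i + j + 1 - 1 - i = j by omega]
    simp only [eval_mul, eval_C, eval_pow, eval_X, inv_pow]
    have := h0.ne
    field_simp
    ring
  rw [hx] at this
  exact (mul_eq_zero.1 this).resolve_right (pow_ne_zero _ h0.ne)

theorem eulerFrobenius_eq (k : ℕ) : eulerFrobenius (k + 1) = eulerianPoly (2 * k + 1) := rfl

theorem exists_roots_eulerFrobenius (k : ℕ) : ∃ Q : Finset ℝ, (∀ q ∈ Q, 0 < q ∧ q < 1) ∧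
    Q.card = k ∧
    (eulerFrobenius (k + 1)).roots = Q.val.map (fun q => -q) + Q.val.map (fun q => -q⁻¹) := by
  rw [eulerFrobenius_eq]
  set R := (eulerianPoly (2 * k + 1)).roots with hR
  obtain ⟨hcard, hnd⟩ := card_roots_eulerianPoly (2 * k)
  rw [← hR] at hcard hnd
  have hneg : ∀ x ∈ R, x < 0 := fun x hx => neg_of_mem_roots_eulerianPoly _ hx
  have hinv : ∀ x ∈ R, x⁻¹ ∈ R := fun x hx => inv_mem_roots_eulerianPoly _ hx
  set S := R.toFinset.filter (fun x => -1 < x) with hS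
  set T := R.toFinset.filter (fun x => x < -1) with hT
  have hST : T = S.image (fun x => x⁻¹) := by
    ext x
    simp only [hT, hS, Finset.mem_filter, Multiset.mem_toFinset, Finset.mem_image]
    constructor
    · rintro ⟨h1, h2⟩
      refine ⟨x⁻¹, ⟨hinv x h1, ?_⟩, inv_inv x⟩
      rw [neg_lt, ← inv_neg]
      exact inv_lt_one_of_one_lt₀ (by linarith)
    · rintro ⟨y, ⟨h1, h2⟩, rfl⟩
      refine ⟨hinv y h1, ?_⟩
      rw [lt_neg, ← inv_neg]
      exact (one_lt_inv₀ (by linarith [hneg y h1])).2 (by linarith)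
  have hTc : T.card = S.card := by
    rw [hST]; exact Finset.card_image_of_injective _ inv_injective
  have hdisj : Disjoint S T := by
    rw [Finset.disjoint_left]
    intro x hx hx'
    linarith [(Finset.mem_filter.1 hx).2, (Finset.mem_filter.1 hx').2]
  have hRc : R.toFinset.card = 2 * k := by
    rw [Multiset.toFinset_card_of_nodup hnd, hcard]
  have hsub : S ∪ T ⊆ R.toFinset :=
    Finset.union_subset (Finset.filter_subset _ _) (Finset.filter_subset _ _)
  have hsub' : R.toFinset ⊆ insert (-1) (S ∪ T) := by
    intro x hx
    simp only [Finset.mem_insert, Finset.mem_union, hS, hT, Finset.mem_filter]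
    rcases lt_trichotomy x (-1) with h | h | h <;> tauto
  have hu : (S ∪ T).card = 2 * S.card := by
    rw [Finset.card_union_of_disjoint hdisj]; omega
  have h1 := Finset.card_le_card hsub
  have h2 := (Finset.card_le_card hsub').trans (Finset.card_insert_le _ _)
  -- Inversion pairs S with T, so 2 |S| ≤ 2k ≤ 2 |S| + 1. Parity settles the count and thereby
  -- excludes the root -1.
  have hSk : S.card = k := by omega
  have hR' : R.toFinset = S ∪ T :=
    (Finset.eq_of_subset_of_card_le hsub (by omega)).symm
  refine ⟨S.image (fun x => -x), ?_, ?_, ?_⟩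
  · intro q hq
    obtain ⟨x, hx, rfl⟩ := Finset.mem_image.1 hq
    simp only [hS, Finset.mem_filter, Multiset.mem_toFinset] at hx
    exact ⟨by linarith [hneg x hx.1], by linarith [hx.2]⟩
  · rw [Finset.card_image_of_injective _ neg_injective, hSk]
  · have e1 : (S.image (fun x => -x)).val = S.val.map (fun x => -x) :=
      Finset.image_val_of_injOn neg_injective.injOn
    have e2 : R = (S ∪ T).val := by
      rw [← hR', Multiset.toFinset_val, hnd.dedup]
    have e3 : (S ∪ T).val = S.val + T.val := by
      rw [← Finset.disjUnion_eq_union _ _ hdisj]; rfl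
    have e4 : T.val = S.val.map (fun x => x⁻¹) := by
      rw [hST]; exact Finset.image_val_of_injOn inv_injective.injOn
    rw [e2, e3, e4, e1, Multiset.map_map, Multiset.map_map]
    congr 1
    · simp
    · refine Multiset.map_congr rfl fun x _ => ?_
      simp [inv_neg]

theorem aeval_eq_prod_of_roots_eq {p : ℝ[X]} {Q : Finset ℝ} (hQ : ∀ q ∈ Q, 0 < q)
    (hlead : 0 < p.leadingCoeff) (hc : p.roots.card = p.natDegree)
    (hroots : p.roots = Q.val.map (fun q => -q) + Q.val.map (fun q => -q⁻¹)) :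
    ∃ K : ℝ, 0 < K ∧ ∀ z : ℂ, aeval z p = K * ∏ q ∈ Q, ((1 + q * z) * (z + q)) := by
  have hfac := C_leadingCoeff_mul_prod_multiset_X_sub_C hc
  -- The denominator comes from z + q⁻¹ = q⁻¹ (1 + q z).
  refine ⟨p.leadingCoeff / ∏ q ∈ Q, q,
    div_pos hlead (Finset.prod_pos fun q hq => hQ q hq), fun z => ?_⟩
  rw [hroots, Multiset.map_add, Multiset.prod_add, Multiset.map_map, Multiset.map_map] at hfac
  have h1 : p = C p.leadingCoeff *
      ((∏ q ∈ Q, (X - C (-q))) * ∏ q ∈ Q, (X - C (-q⁻¹))) := hfac.symm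
  rw [← Finset.prod_mul_distrib] at h1
  conv_lhs => rw [h1]
  rw [map_mul, map_prod, aeval_C]
  push_cast
  rw [div_mul_eq_mul_div, mul_div_assoc, ← Finset.prod_div_distrib]
  congr 1
  refine Finset.prod_congr rfl fun q hq => ?_
  have : (q : ℂ) ≠ 0 := Complex.ofReal_ne_zero.2 (hQ q hq).ne'
  simp only [map_neg, sub_neg_eq_add, map_mul, map_add, aeval_X, aeval_C, Complex.coe_algebraMap,
    Complex.ofReal_inv]
  field_simp
  ring

theorem aeval_eulerFrobenius_eq_prod {k : ℕ} {Q : Finset ℝ} (hQ : ∀ q ∈ Q, 0 < q ∧ q < 1)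
    (hroots : (eulerFrobenius (k + 1)).roots =
      Q.val.map (fun q => -q) + Q.val.map (fun q => -q⁻¹)) :
    ∃ K : ℝ, 0 < K ∧ ∀ z : ℂ, aeval z (eulerFrobenius (k + 1)) =
      K * ∏ q ∈ Q, ((1 + q * z) * (z + q)) := by
  refine aeval_eq_prod_of_roots_eq (fun q hq => (hQ q hq).1) ?_ ?_ hroots
  · rw [leadingCoeff, eulerFrobenius_eq, natDegree_eulerianPoly, eulerianPoly_coeff]
    exact eulerianCoeff_pos (by omega)
  · rw [eulerFrobenius_eq, natDegree_eulerianPoly]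
    exact (card_roots_eulerianPoly (2 * k)).1

/-- The k roots -q lie above -1 and the roots -q⁻¹ below it, so the root that comes k-th from 0
belongs to the largest q. -/
theorem isNthNegativeRoot_eulerFrobenius {k : ℕ} {Q : Finset ℝ} (hQ : ∀ q ∈ Q, 0 < q ∧ q < 1)
    (hcard : Q.card = k)
    (hroots : (eulerFrobenius (k + 1)).roots =
      Q.val.map (fun q => -q) + Q.val.map (fun q => -q⁻¹))
    {r : ℝ} (hr : r ∈ Q) (hmax : ∀ q ∈ Q, q ≤ r) :
    IsNthNegativeRoot (eulerFrobenius (k + 1)) k (-r) := by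
  refine ⟨?_, by linarith [(hQ r hr).1], ?_⟩
  · rw [hroots, Multiset.mem_add, Multiset.mem_map]
    exact Or.inl ⟨r, hr, rfl⟩
  · rw [hroots, Multiset.filter_add, Multiset.card_add, Multiset.filter_map, Multiset.filter_map,
      Multiset.card_map, Multiset.card_map]
    have h1 : Q.val.filter ((fun z => -r < z ∧ z < 0) ∘ fun q => -q) = (Q.erase r).val := by
      rw [← Finset.filter_val, Finset.val_inj]
      ext q
      simp only [Finset.mem_filter, Finset.mem_erase, Function.comp]
      constructor
      · rintro ⟨h, h1, h2⟩
        exact ⟨by rintro rfl; linarith, h⟩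
      · rintro ⟨h, h1⟩
        exact ⟨h1, by linarith [(hmax q h1).lt_of_ne h], by linarith [(hQ q h1).1]⟩
    have h2 : Q.val.filter ((fun z => -r < z ∧ z < 0) ∘ fun q => -q⁻¹) = 0 := by
      rw [Multiset.filter_eq_nil]
      rintro q hq ⟨h, -⟩
      have h3 := (one_lt_inv₀ (hQ q hq).1).2 (hQ q hq).2
      linarith [(hQ r hr).2]
    rw [h1, h2]
    change (Q.erase r).card + 0 + 1 = k
    rw [Finset.card_erase_of_mem hr]
    have := Finset.card_pos.2 ⟨r, hr⟩
    omega

end CardinalBSpline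

/-! ### The symbol P: product formula and two-scale relation. -/

namespace CardinalBSpline

/-- The Laurent polynomial `K ∏ (1 + q z) (1 + q / z)`. -/
noncomputable def prodSymbol (K : ℝ) (Q : Finset ℝ) (z : ℂ) : ℂ :=
  K * ∏ q ∈ Q, ((1 + q * z) * (1 + q * z⁻¹))

theorem prodSymbol_inv (K : ℝ) (Q : Finset ℝ) (z : ℂ) :
    prodSymbol K Q z⁻¹ = prodSymbol K Q z := by
  simp only [prodSymbol, inv_inv]
  congr 1
  exact Finset.prod_congr rfl fun q _ => mul_comm _ _

theorem hasSum_bspline_int (k : ℕ) (z : ℂ) :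
    HasSum (fun l : ℤ => (bspline (2 * k + 2) l : ℂ) * z ^ l)
      (z * ∑ i ∈ Finset.range (2 * k + 1), (bspline (2 * k + 2) (i + 1) : ℂ) * z ^ i) := by
  let e : ℕ ↪ ℤ := ⟨fun i => (i : ℤ) + 1, fun a b h => by simpa using h⟩
  have h := hasSum_sum_of_ne_finset_zero (s := (Finset.range (2 * k + 1)).map e)
    (f := fun l : ℤ => (bspline (2 * k + 2) l : ℂ) * z ^ l) (L := SummationFilter.unconditional ℤ) ?_
  · rw [Finset.sum_map] at h
    convert! h using 1
    rw [Finset.mul_sum]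
    refine Finset.sum_congr rfl fun i _ => ?_
    have h1 : (e i : ℤ) = ((i + 1 : ℕ) : ℤ) := rfl
    rw [h1, zpow_natCast]
    push_cast
    ring
  · intro l hl
    rcases le_or_gt l 0 with h0 | h0
    · rw [bspline_succ_succ_eq_zero_of_nonpos (2 * k) (by exact_mod_cast h0)]
      simp
    · rw [bspline_eq_zero_of_le (2 * k + 2)]
      · simp
      · by_contra! h1
        refine hl (Finset.mem_map.2 ⟨(l - 1).toNat, ?_, ?_⟩)
        · have : l < (2 * k + 2 : ℕ) := by exact_mod_cast h1
          rw [Finset.mem_range]; omega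
        · change ((l - 1).toNat : ℤ) + 1 = l
          omega

/-- Of the exponent k + 1, the part k comes from z + q = z (1 + q/z) over the k elements of `Q`. The
remaining 1 is there because the Euler–Frobenius polynomial starts with the value of the spline at
1. -/
theorem exists_hasSum_bspline_int_eq_prodSymbol {k : ℕ} {Q : Finset ℝ}
    (hQ : ∀ q ∈ Q, 0 < q ∧ q < 1) (hcard : Q.card = k)
    (hroots : (eulerFrobenius (k + 1)).roots =
      Q.val.map (fun q => -q) + Q.val.map (fun q => -q⁻¹)) :
    ∃ K : ℝ, 0 < K ∧ ∀ z : ℂ, z ≠ 0 →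
      HasSum (fun l : ℤ => (bspline (2 * k + 2) l : ℂ) * z ^ l)
        (z ^ (k + 1) * prodSymbol K Q z) := by
  obtain ⟨K, hK, h⟩ := aeval_eulerFrobenius_eq_prod hQ hroots
  have hf : ((2 * k + 1).factorial : ℝ) ≠ 0 := by positivity
  refine ⟨K / (2 * k + 1).factorial, by positivity, fun z hz => ?_⟩
  convert! hasSum_bspline_int k z using 1
  have h1 := h z
  have h2 : Polynomial.aeval z (eulerFrobenius (k + 1)) = ((2 * k + 1).factorial : ℂ) *
      ∑ i ∈ Finset.range (2 * k + 1), (bspline (2 * k + 2) (i + 1) : ℂ) * z ^ i := by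
    rw [eulerFrobenius, map_sum, Finset.mul_sum]
    refine Finset.sum_congr rfl fun i _ => ?_
    rw [map_mul, map_pow, Polynomial.aeval_X, Polynomial.aeval_C, Complex.coe_algebraMap]
    push_cast
    rw [mul_assoc]
    rfl
  have h3 : ∏ q ∈ Q, ((1 + (q : ℂ) * z) * (z + q)) =
      z ^ k * ∏ q ∈ Q, ((1 + (q : ℂ) * z) * (1 + q * z⁻¹)) := by
    rw [← hcard, ← Finset.prod_const, ← Finset.prod_mul_distrib]
    refine Finset.prod_congr rfl fun q _ => ?_
    field_simp
  have hf' : ((2 * k + 1).factorial : ℂ) ≠ 0 := by exact_mod_cast hf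
  rw [prodSymbol]
  rw [h3] at h1
  rw [h1] at h2
  refine mul_left_cancel₀ hf' ?_
  have h4 : ((2 * k + 1).factorial : ℂ) * (K / (2 * k + 1).factorial : ℝ) = K := by
    push_cast
    field_simp
  linear_combination z * h2 + z ^ (k + 1) *
    (∏ q ∈ Q, ((1 + (q : ℂ) * z) * (1 + q * z⁻¹))) * h4

/-- At integers, the two-scale relation of N_{2m} says that the even-indexed coefficients of (1 +
z)^{2m} S(z), with S(z) = z^m P(z), are 2^{2m-1} times those of S. Adding the values at z and -z
extracts the even part. -/
theorem two_scale_of_hasSum_bspline_int {k : ℕ} {P : ℂ → ℂ} (hP : ∀ z : ℂ, z ≠ 0 →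
      HasSum (fun l : ℤ => (bspline (2 * k + 2) l : ℂ) * z ^ l) (z ^ (k + 1) * P z))
    {z : ℂ} (hz : z ≠ 0) :
    4 ^ (k + 1) * P (z ^ 2) =
      (2 + z + z⁻¹) ^ (k + 1) * P z + (2 - z - z⁻¹) ^ (k + 1) * P (-z) := by
  set n := 2 * k + 2 with hn
  set S : ℂ → ℂ := fun z => z ^ (k + 1) * P z with hS
  set g : ℤ → ℂ := fun l => ∑ j ∈ Finset.range (n + 1), (n.choose j : ℂ) * bspline n ((l - j : ℤ))
    with hg
  have hg2 : ∀ l : ℤ, g (2 * l) = 2 ^ (n - 1) * bspline n l := by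
    intro l
    have h := bspline_two_scale (2 * k + 1) (l : ℝ)
    rw [inv_mul_eq_div, eq_div_iff (by positivity)] at h
    rw [hg, mul_comm (2 ^ (n - 1) : ℂ)]
    have h' := congrArg (fun x : ℝ => (x : ℂ)) h
    push_cast at h'
    simp only
    push_cast
    exact h'.symm
  have hgz : ∀ w : ℂ, w ≠ 0 → HasSum (fun l => g l * w ^ l) ((1 + w) ^ n * S w) := by
    intro w hw
    have h1 : ∀ j ∈ Finset.range (n + 1), HasSum (fun l : ℤ => (n.choose j : ℂ) *
        bspline n ((l - j : ℤ)) * w ^ l) ((n.choose j : ℂ) * w ^ j * S w) := by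
      intro j _
      have h2 := ((Equiv.subRight (j : ℤ)).hasSum_iff.2 (hP w hw)).mul_left
        ((n.choose j : ℂ) * w ^ j)
      convert! h2 using 2 with l
      simp only [Function.comp, Equiv.subRight_apply]
      rw [zpow_sub₀ hw, zpow_natCast]
      field_simp
    have h3 := hasSum_sum h1
    convert! h3 using 1
    · funext l
      rw [hg, Finset.sum_mul]
    · rw [← Finset.sum_mul, add_comm, add_pow]
      congr 1
      refine Finset.sum_congr rfl fun j _ => by simp; ring
  have h1 := (hgz z hz).add (hgz (-z) (neg_ne_zero.2 hz))
  have h2 : HasSum ((fun l => g l * z ^ l + g l * (-z) ^ l) ∘ fun l : ℤ => 2 * l)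
      ((1 + z) ^ n * S z + (1 + -z) ^ n * S (-z)) := by
    refine (Function.Injective.hasSum_iff (fun a b h => by simpa using h) fun l hl => ?_).2 h1
    have : Odd l := by
      rw [← Int.not_even_iff_odd]
      rintro ⟨r, hr⟩
      exact hl ⟨r, by simp only; omega⟩
    rw [this.neg_zpow]
    ring
  have h3 : HasSum ((fun l => g l * z ^ l + g l * (-z) ^ l) ∘ fun l : ℤ => 2 * l)
      (2 ^ n * S (z ^ 2)) := by
    convert! (hP (z ^ 2) (pow_ne_zero 2 hz)).mul_left (2 ^ n) using 2 with l
    simp only [Function.comp, hg2]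
    rw [(even_two_mul l).neg_zpow, zpow_mul]
    have e : (2 : ℂ) ^ n = 2 ^ (n - 1) * 2 := by
      rw [← pow_succ]; congr 1
    rw [e, show z ^ (2 : ℤ) = z ^ 2 from rfl]
    ring
  have h4 := h3.unique h2
  simp only [hS] at h4
  have e1 : (2 + z + z⁻¹) = (1 + z) ^ 2 / z := by field_simp; ring
  have e2 : (2 - z - z⁻¹) = -((1 + -z) ^ 2 / z) := by field_simp; ring
  have e3 : (4 : ℂ) ^ (k + 1) = 2 ^ n := by
    rw [hn, show 2 * k + 2 = 2 * (k + 1) by ring, pow_mul]; norm_num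
  have e4 : ∀ w : ℂ, w ^ n = (w ^ 2) ^ (k + 1) := by
    intro w; rw [hn, show 2 * k + 2 = 2 * (k + 1) by ring, pow_mul]
  rw [e1, e2, e3]
  have hz' : (z ^ (k + 1)) ≠ 0 := pow_ne_zero _ hz
  rw [e4 (1 + z), e4 (1 + -z), neg_pow z, ← pow_mul, mul_comm 2 (k + 1), pow_mul] at h4
  rw [neg_pow ((1 + -z) ^ 2 / z), div_pow, div_pow]
  field_simp
  refine mul_left_cancel₀ hz' ?_
  linear_combination h4

/-! ### Fourier transform of the B-spline and Poisson summation. -/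

open MeasureTheory

/-- The Fourier integral `∫ N_n(t) e^{-iωt} dt`. -/
noncomputable def bsplineFourier (n : ℕ) (ω : ℝ) : ℂ :=
  ∫ t : ℝ, (bspline n t : ℂ) * Complex.exp (-Complex.I * ω * t)

theorem norm_exp_neg_I_mul (ω t : ℝ) : ‖Complex.exp (-Complex.I * ω * t)‖ = 1 := by
  rw [show -Complex.I * ω * t = ((-ω * t : ℝ) : ℂ) * Complex.I by push_cast; ring,
    Complex.norm_exp_ofReal_mul_I]

theorem integrable_bspline_mul_exp (n : ℕ) (ω : ℝ) :
    Integrable (fun t : ℝ => (bspline n t : ℂ) * Complex.exp (-Complex.I * ω * t)) := by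
  have h1 : Integrable (Set.indicator (Set.Icc (0 : ℝ) n) (fun _ => (1 : ℝ))) :=
    (integrable_indicator_iff measurableSet_Icc).2 (integrableOn_const (by simp))
  refine h1.mono' ?_ (Eventually.of_forall fun t => ?_)
  · have := measurable_bspline n
    exact Measurable.aestronglyMeasurable (by fun_prop)
  · rw [norm_mul, norm_exp_neg_I_mul, mul_one, Complex.norm_real,
      Real.norm_of_nonneg (bspline_nonneg n t)]
    by_cases ht : t ∈ Set.Icc (0 : ℝ) n
    · rw [Set.indicator_of_mem ht]; exact bspline_le_one n t
    · rw [Set.indicator_of_notMem ht]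
      rw [Set.mem_Icc, not_and_or, not_le, not_le] at ht
      rcases ht with h | h
      · rw [bspline_eq_zero_of_neg n h]
      · rw [bspline_eq_zero_of_le n h.le]

theorem bsplineFourier_one (ω : ℝ) :
    bsplineFourier 1 ω = ∫ t in (0 : ℝ)..1, Complex.exp (-Complex.I * ω * t) := by
  rw [bsplineFourier, intervalIntegral.integral_of_le zero_le_one, ← integral_Ico_eq_integral_Ioc,
    ← integral_indicator measurableSet_Ico]
  congr 1
  funext t
  rw [bspline_one]
  by_cases ht : t ∈ Set.Ico (0 : ℝ) 1 <;> simp [ht]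

theorem bsplineFourier_succ_succ (n : ℕ) (ω : ℝ) :
    bsplineFourier (n + 2) ω = bsplineFourier 1 ω * bsplineFourier (n + 1) ω := by
  have h := integral_convolution (μ := volume) (ν := volume) (ContinuousLinearMap.mul ℝ ℂ)
    (integrable_bspline_mul_exp 1 ω) (integrable_bspline_mul_exp (n + 1) ω)
  rw [ContinuousLinearMap.mul_apply'] at h
  rw [bsplineFourier, bsplineFourier, bsplineFourier, ← h]
  congr 1
  funext t
  rw [convolution_def]
  have h1 : ∀ y : ℝ, (ContinuousLinearMap.mul ℝ ℂ ((bspline 1 y : ℂ) *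
      Complex.exp (-Complex.I * ω * y))) ((bspline (n + 1) (t - y) : ℂ) *
      Complex.exp (-Complex.I * ω * (t - y : ℝ))) =
      ((bspline 1 y * bspline (n + 1) (t - y) : ℝ) : ℂ) * Complex.exp (-Complex.I * ω * t) := by
    intro y
    rw [ContinuousLinearMap.mul_apply', show -Complex.I * ω * t =
      -Complex.I * ω * y + -Complex.I * ω * (t - y : ℝ) by push_cast; ring, Complex.exp_add]
    push_cast
    ring
  simp_rw [h1]
  rw [integral_mul_const, integral_complex_ofReal]
  congr 2
  simp only [bspline]
  rw [intervalIntegral.integral_of_le zero_le_one, ← integral_Ico_eq_integral_Ioc,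
    ← integral_indicator measurableSet_Ico]
  congr 1
  funext y
  by_cases ht : y ∈ Set.Ico (0 : ℝ) 1 <;> simp [ht]

theorem bsplineFourier_eq_pow (n : ℕ) (ω : ℝ) :
    bsplineFourier (n + 1) ω = bsplineFourier 1 ω ^ (n + 1) := by
  induction n with
  | zero => simp
  | succ n ih => rw [bsplineFourier_succ_succ, ih, pow_succ' _ (n + 1)]

theorem conj_bsplineFourier_one (ω : ℝ) :
    (starRingEnd ℂ) (bsplineFourier 1 ω) = Complex.exp (Complex.I * ω) * bsplineFourier 1 ω := by
  rw [bsplineFourier_one]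
  rcases eq_or_ne ω 0 with rfl | h
  · simp
  have hc : -Complex.I * ω ≠ 0 := by simp [h]
  have h1 : Complex.exp (Complex.I * ω) * Complex.exp (-Complex.I * ω) = 1 := by
    rw [← Complex.exp_add]; simp
  rw [integral_exp_mul_complex hc, map_div₀, map_sub, ← Complex.exp_conj, ← Complex.exp_conj]
  simp only [map_mul, map_neg, Complex.conj_I, Complex.conj_ofReal, neg_neg, Complex.ofReal_one,
    mul_one, Complex.ofReal_zero, mul_zero, Complex.exp_zero]
  rw [map_zero, Complex.exp_zero, ← mul_div_assoc, mul_sub, h1, mul_one, neg_mul, div_neg, ← neg_div, neg_sub]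

/-- Centring N_2 at the origin makes its Fourier transform real and nonnegative; its powers are
therefore the squared moduli that occur in `symbolP`. -/
theorem exp_mul_bsplineFourier_sq (ω : ℝ) :
    Complex.exp (Complex.I * ω) * bsplineFourier 1 ω ^ 2 = ((‖bsplineFourier 1 ω‖ ^ 2 : ℝ) : ℂ) := by
  have := Complex.mul_conj (bsplineFourier 1 ω)
  rw [Complex.normSq_eq_norm_sq, conj_bsplineFourier_one] at this
  rw [← this]
  ring

theorem norm_bsplineFourier_one_mul_le (ω : ℝ) : ‖bsplineFourier 1 ω‖ * |ω| ≤ 2 := by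
  rcases eq_or_ne ω 0 with rfl | h
  · simp
  have hc : -Complex.I * ω ≠ 0 := by simp [h]
  rw [bsplineFourier_one, integral_exp_mul_complex hc, norm_div]
  have : ‖-Complex.I * (ω : ℂ)‖ = |ω| := by simp
  rw [this, div_mul_cancel₀ _ (abs_ne_zero.2 h)]
  refine (norm_sub_le _ _).trans ?_
  rw [norm_exp_neg_I_mul, norm_exp_neg_I_mul]
  norm_num

theorem norm_bsplineFourier_one_le_one (ω : ℝ) : ‖bsplineFourier 1 ω‖ ≤ 1 := by
  rw [bsplineFourier_one]
  refine (intervalIntegral.norm_integral_le_of_norm_le_const (C := 1) fun t _ => ?_).trans (by simp)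
  rw [norm_exp_neg_I_mul]

/-- The transform of N_1 is at most min(1, 2/|ω|) in modulus, so already the square is summable
along an arithmetic progression. -/
theorem summable_norm_bsplineFourier_pow (k : ℕ) (θ : ℝ) :
    Summable (fun j : ℤ => ‖bsplineFourier 1 (θ + 2 * Real.pi * j)‖ ^ (2 * (k + 1))) := by
  have hpi := Real.pi_pos
  have h1 := ((Real.summable_one_div_int_add_rpow (θ / (2 * Real.pi)) 2).2 one_lt_two)
  refine Summable.of_norm_bounded_eventually h1 ?_
  have h2 : ∀ᶠ j : ℤ in cofinite, θ + 2 * Real.pi * j ≠ 0 := by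
    have : Function.Injective fun j : ℤ => θ + 2 * Real.pi * j := fun a b h => by
      simpa [hpi.ne'] using h
    exact this.tendsto_cofinite.eventually (Set.finite_singleton 0).compl_mem_cofinite
  filter_upwards [h2] with j hj
  have e1 : |(j : ℝ) + θ / (2 * Real.pi)| = |θ + 2 * Real.pi * j| / (2 * Real.pi) := by
    rw [eq_div_iff (by positivity)]
    nth_rw 2 [← abs_of_pos (by positivity : 0 < 2 * Real.pi)]
    rw [← abs_mul]
    congr 1
    field_simp
    ring
  have hpos := abs_pos.2 hj
  have h3 := norm_bsplineFourier_one_mul_le (θ + 2 * Real.pi * j)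
  have h4 : ‖bsplineFourier 1 (θ + 2 * Real.pi * j)‖ ^ 2 * |θ + 2 * Real.pi * j| ^ 2 ≤
      (2 * Real.pi) ^ 2 := by
    rw [← mul_pow]
    refine pow_le_pow_left₀ (by positivity) (h3.trans ?_) 2
    nlinarith [Real.pi_gt_three]
  rw [Real.norm_of_nonneg (by positivity), e1, Real.rpow_two, pow_mul, div_pow, one_div_div,
    le_div_iff₀ (by positivity)]
  refine le_trans (mul_le_mul_of_nonneg_right ?_ (by positivity)) h4
  refine pow_le_of_le_one (by positivity) ?_ (by omega)
  exact pow_le_one₀ (norm_nonneg _) (norm_bsplineFourier_one_le_one _)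

theorem symbolP_eq_tsum (k : ℕ) (θ : ℝ) :
    symbolP (k + 1) θ = ∑' j : ℤ, ‖bsplineFourier 1 (θ + 2 * Real.pi * j)‖ ^ (2 * (k + 1)) := by
  rw [symbolP, ← tsum_mul_left]
  refine tsum_congr fun j => ?_
  have hpi := Real.pi_pos
  have h1 : fourierHat (bspline (k + 1)) (θ + 2 * Real.pi * j) =
      ((Real.sqrt (2 * Real.pi))⁻¹ : ℂ) * bsplineFourier (k + 1) (θ + 2 * Real.pi * j) := rfl
  rw [h1, norm_mul, bsplineFourier_eq_pow, norm_pow, mul_pow, norm_inv, Complex.norm_real,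
    Real.norm_of_nonneg (Real.sqrt_nonneg _), inv_pow, Real.sq_sqrt (by positivity), ← pow_mul,
    mul_comm 2 (k + 1)]
  field_simp

theorem fourier_bspline_mul_exp (k : ℕ) (θ : ℝ) (n : ℤ) :
    FourierTransform.fourier (fun t : ℝ => (bspline (2 * k + 2) (t + (k + 1)) : ℂ) *
      Complex.exp (-Complex.I * θ * t)) (n : ℝ) =
      ((‖bsplineFourier 1 (θ + 2 * Real.pi * n)‖ ^ (2 * (k + 1)) : ℝ) : ℂ) := by
  rw [Real.fourier_real_eq_integral_exp_smul]
  set ω := θ + 2 * Real.pi * n with hω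
  have h1 : ∀ t : ℝ, Complex.exp (((-2 * Real.pi * t * n : ℝ) : ℂ) * Complex.I) •
      ((bspline (2 * k + 2) (t + (k + 1)) : ℂ) * Complex.exp (-Complex.I * θ * t)) =
      Complex.exp (Complex.I * ω * (k + 1)) * ((bspline (2 * k + 2) (t + (k + 1)) : ℂ) *
        Complex.exp (-Complex.I * ω * (t + (k + 1) : ℝ))) := by
    intro t
    have e1 : Complex.exp (((-2 * Real.pi * t * n : ℝ) : ℂ) * Complex.I) *
        Complex.exp (-Complex.I * θ * t) = Complex.exp (Complex.I * ω * (k + 1)) *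
        Complex.exp (-Complex.I * ω * (t + (k + 1) : ℝ)) := by
      rw [← Complex.exp_add, ← Complex.exp_add]
      congr 1
      rw [hω]
      push_cast
      ring
    rw [smul_eq_mul]
    linear_combination (bspline (2 * k + 2) (t + (k + 1)) : ℂ) * e1
  simp_rw [h1]
  rw [integral_const_mul, integral_add_right_eq_self (fun t : ℝ =>
    (bspline (2 * k + 2) t : ℂ) * Complex.exp (-Complex.I * ω * t)) ((k : ℝ) + 1)]
  change _ * bsplineFourier (2 * k + 2) ω = _
  rw [bsplineFourier_eq_pow, show 2 * k + 1 + 1 = 2 * (k + 1) by ring, pow_mul, pow_mul,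
    Complex.ofReal_pow, ← exp_mul_bsplineFourier_sq, mul_pow, ← Complex.exp_nat_mul]
  congr 2
  push_cast
  ring

/-- Poisson summation at 0 for the centred, modulated spline of order 2(k + 1). The spatial side is
the series of integer values at e^{-iθ}; invariance of the product under z ↦ 1/z converts it to
e^{iθ}. -/
theorem ofReal_symbolP_eq {k : ℕ} {K : ℝ} {Q : Finset ℝ} (hP : ∀ z : ℂ, z ≠ 0 →
      HasSum (fun l : ℤ => (bspline (2 * k + 2) l : ℂ) * z ^ l)
        (z ^ (k + 1) * prodSymbol K Q z)) (θ : ℝ) :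
    (symbolP (k + 1) θ : ℂ) = prodSymbol K Q (Complex.exp (θ * Complex.I)) := by
  set f : ℝ → ℂ := fun t : ℝ => (bspline (2 * k + 2) (t + (k + 1)) : ℂ) *
      Complex.exp (-Complex.I * θ * t) with hf
  have hc : Continuous f := by
    have := continuous_bspline (2 * k)
    fun_prop
  have hO : f =O[cocompact ℝ] fun x => |x| ^ (-2 : ℝ) := by
    have h0 : f =ᶠ[cocompact ℝ] 0 := by
      have : (Set.Icc (-(k + 1) : ℝ) (k + 1))ᶜ ∈ cocompact ℝ := isCompact_Icc.compl_mem_cocompact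
      filter_upwards [this] with x hx
      rw [Set.mem_compl_iff, Set.mem_Icc, not_and_or, not_le, not_le] at hx
      rcases hx with h | h
      · simp [hf, bspline_eq_zero_of_neg (2 * k + 2) (by linarith : x + (k + 1) < 0)]
      · simp [hf, bspline_eq_zero_of_le (2 * k + 2) (by push_cast; linarith :
          ((2 * k + 2 : ℕ) : ℝ) ≤ x + (k + 1))]
    exact h0.trans_isBigO (isBigO_zero _ _)
  have hs : Summable fun n : ℤ => FourierTransform.fourier f (n : ℝ) := by
    simp_rw [hf, fourier_bspline_mul_exp]
    exact_mod_cast Complex.hasSum_ofReal.2 (summable_norm_bsplineFourier_pow k θ).hasSum |>.summable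
  have h := Real.tsum_eq_tsum_fourier_of_rpow_decay_of_summable hc one_lt_two hO hs 0
  simp_rw [hf, fourier_bspline_mul_exp] at h
  rw [symbolP_eq_tsum, Complex.ofReal_tsum]
  have h1 : ∀ n : ℤ, (fourier n ((0 : ℝ) : UnitAddCircle)) = 1 := by simp
  simp only [h1, mul_one] at h
  rw [← h, ← prodSymbol_inv, ← Complex.exp_neg]
  set w := Complex.exp (-(θ * Complex.I)) with hw
  have hw0 : w ≠ 0 := Complex.exp_ne_zero _
  have h2 := ((Equiv.addRight ((k + 1 : ℕ) : ℤ)).hasSum_iff.2 (hP w hw0)).mul_left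
    ((w ^ (k + 1))⁻¹)
  rw [inv_mul_cancel_left₀ (pow_ne_zero _ hw0)] at h2
  rw [← h2.tsum_eq]
  refine tsum_congr fun n => ?_
  simp only [Function.comp, Equiv.coe_addRight]
  rw [zpow_add₀ hw0, zpow_natCast, hw, ← Complex.exp_int_mul]
  have : (w ^ (k + 1)) ≠ 0 := pow_ne_zero _ hw0
  rw [← hw]
  field_simp
  push_cast
  rw [zero_add]
  congr 2
  ring

end CardinalBSpline

/-! ### Laurent series with real coefficients, and convolution. -/

namespace CardinalBSpline

/-- The Laurent series with real coefficients `s` converges to `F` on every circle about the origin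
whose radius is a positive element of `I`. -/
def HasLaurent (s : ℤ → ℝ) (F : ℂ → ℂ) (I : Set ℝ) : Prop :=
  ∀ z : ℂ, z ≠ 0 → ‖z‖ ∈ I → HasSum (fun j : ℤ => (s j : ℂ) * z ^ j) (F z)

/-- Convolution of two-sided sequences. -/
noncomputable def conv (s t : ℤ → ℝ) (n : ℤ) : ℝ := ∑' k : ℤ, s k * t (n - k)

/-- The sequence whose generating function is that of `s` at the squared argument. -/
noncomputable def upsample (s : ℤ → ℝ) (n : ℤ) : ℝ := if Even n then s (n / 2) else 0

/-- The change of variables `(n, k) ↦ (k, n - k)`. -/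
def sumSubEquiv : ℤ × ℤ ≃ ℤ × ℤ :=
  ⟨fun p => (p.2, p.1 - p.2), fun p => (p.1 + p.2, p.1), fun p => by simp, fun p => by simp⟩

theorem hasSum_conv_of_summable {s t : ℤ → ℝ} {z : ℂ} (hz : z ≠ 0) (n : ℤ)
    (h : Summable fun k : ℤ => ((s k * t (n - k) : ℝ) : ℂ) * z ^ n) :
    HasSum (fun k : ℤ => ((s k * t (n - k) : ℝ) : ℂ) * z ^ n) ((conv s t n : ℂ) * z ^ n) := by
  have h1 : Summable fun k : ℤ => ((s k * t (n - k) : ℝ) : ℂ) := by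
    refine (h.mul_right (z ^ n)⁻¹).congr fun k => ?_
    exact mul_inv_cancel_right₀ (zpow_ne_zero n hz) _
  have h2 : HasSum (fun k : ℤ => s k * t (n - k)) (conv s t n) :=
    (Complex.summable_ofReal.1 h1).hasSum
  exact (Complex.hasSum_ofReal.2 h2).mul_right (z ^ n)

theorem hasSum_conv_mul_zpow {s t : ℤ → ℝ} {z c : ℂ} (hz : z ≠ 0)
    (h : HasSum (fun p : ℤ × ℤ => ((s p.1 : ℂ) * z ^ p.1) * ((t p.2 : ℂ) * z ^ p.2)) c) :
    HasSum (fun n => (conv s t n : ℂ) * z ^ n) c := by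
  have h1 := (sumSubEquiv).hasSum_iff.2 h
  have h2 : (fun p : ℤ × ℤ => ((s p.1 : ℂ) * z ^ p.1) * ((t p.2 : ℂ) * z ^ p.2)) ∘ sumSubEquiv =
      fun p : ℤ × ℤ => ((s p.2 * t (p.1 - p.2) : ℝ) : ℂ) * z ^ p.1 := by
    funext p
    change ((s p.2 : ℂ) * z ^ p.2) * ((t (p.1 - p.2) : ℂ) * z ^ (p.1 - p.2)) = _
    have h3 : z ^ p.2 * z ^ (p.1 - p.2) = z ^ p.1 := by
      rw [← zpow_add₀ hz, add_sub_cancel]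
    rw [← h3, Complex.ofReal_mul]
    ring
  rw [h2] at h1
  exact HasSum.prod_fiberwise h1 fun n =>
    hasSum_conv_of_summable hz n (h1.summable.prod_factor n)

theorem hasSum_mul_prod {f g : ℤ → ℂ} {a b : ℂ} (h1 : HasSum f a) (h2 : HasSum g b) :
    HasSum (fun p : ℤ × ℤ => f p.1 * g p.2) (a * b) :=
  h1.mul h2 (summable_mul_of_summable_norm (summable_norm_iff.2 h1.summable)
    (summable_norm_iff.2 h2.summable))

namespace HasLaurent

variable {s t : ℤ → ℝ} {F G : ℂ → ℂ} {I J : Set ℝ}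

theorem mono (h : HasLaurent s F I) (hJ : J ⊆ I) : HasLaurent s F J :=
  fun z hz hz' => h z hz (hJ hz')

theorem congr (h : HasLaurent s F I) (hFG : ∀ z, z ≠ 0 → ‖z‖ ∈ I → F z = G z) :
    HasLaurent s G I :=
  fun z hz hz' => hFG z hz hz' ▸ h z hz hz'

theorem summable_abs_mul (h : HasLaurent s F I) {ρ : ℝ} (hρ : 0 < ρ) (hI : ρ ∈ I) :
    Summable (fun j : ℤ => |s j| * ρ ^ j) := by
  have h1 := h ρ (Complex.ofReal_ne_zero.2 hρ.ne')
    (by rwa [Complex.norm_real, Real.norm_of_nonneg hρ.le])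
  refine (summable_norm_iff.2 h1.summable).congr fun j => ?_
  rw [norm_mul, norm_zpow, Complex.norm_real, Complex.norm_real, Real.norm_of_nonneg hρ.le,
    Real.norm_eq_abs]

theorem summable_abs (h : HasLaurent s F I) (hI : 1 ∈ I) : Summable (fun j : ℤ => |s j|) := by
  simpa using h.summable_abs_mul one_pos hI

theorem mul (hs : HasLaurent s F I) (ht : HasLaurent t G I) :
    HasLaurent (conv s t) (fun z => F z * G z) I := by
  intro z hz hI
  have h := hasSum_mul_prod (hs z hz hI) (ht z hz hI)
  exact hasSum_conv_mul_zpow hz h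

theorem const_mul (h : HasLaurent s F I) (c : ℝ) :
    HasLaurent (fun n => c * s n) (fun z => c * F z) I := by
  intro z hz hI
  convert! (h z hz hI).mul_left (c : ℂ) using 2 with j
  push_cast
  ring

theorem shift (h : HasLaurent s F I) (e : ℤ) :
    HasLaurent (fun n => s (n - e)) (fun z => z ^ e * F z) I := by
  intro z hz hI
  convert! ((Equiv.subRight e).hasSum_iff.2 (h z hz hI)).mul_left (z ^ e) using 2 with j
  simp only [Function.comp, Equiv.subRight_apply]
  rw [zpow_sub₀ hz]
  have : z ^ e ≠ 0 := zpow_ne_zero e hz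
  field_simp

theorem inv (h : HasLaurent s F I) :
    HasLaurent (fun n => s (-n)) (fun z => F z⁻¹) {ρ | ρ⁻¹ ∈ I} := by
  intro z hz hI
  convert! (Equiv.neg ℤ).hasSum_iff.2 (h z⁻¹ (inv_ne_zero hz) (by rwa [norm_inv])) using 2 with j
  simp

theorem comp_neg (h : HasLaurent s F I) :
    HasLaurent (fun n => (-1) ^ n * s n) (fun z => F (-z)) I := by
  intro z hz hI
  convert! h (-z) (neg_ne_zero.2 hz) (by rwa [norm_neg]) using 2 with j
  rw [neg_eq_neg_one_mul z, mul_zpow]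
  push_cast
  ring

theorem upsample (h : HasLaurent s F I) :
    HasLaurent (upsample s) (fun z => F (z ^ 2)) {ρ | ρ ^ 2 ∈ I} := by
  intro z hz hI
  have h1 := h (z ^ 2) (pow_ne_zero 2 hz) (by rwa [norm_pow])
  refine (Function.Injective.hasSum_iff (g := fun l : ℤ => 2 * l)
    (fun a b h => by simpa using h) fun l hl => ?_).1 ?_
  · rw [CardinalBSpline.upsample, if_neg]
    · simp
    · rintro ⟨r, hr⟩
      exact hl ⟨r, by simp only; omega⟩
  · convert! h1 using 2 with l
    simp only [Function.comp, CardinalBSpline.upsample, if_pos (even_two_mul l)]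
    rw [Int.mul_ediv_cancel_left _ two_ne_zero, zpow_mul]
    rfl

/-- Termwise integration over the unit circle. It makes coefficients unique and identifies those of
P^{-1/2} with the integrals that define `coeffC`. -/
theorem coeff_eq_integral (h : HasLaurent s F I) (hI : 1 ∈ I) (n : ℤ) :
    (s n : ℂ) = (2 * Real.pi : ℂ)⁻¹ * ∫ θ in (-Real.pi)..Real.pi,
      F (Complex.exp (θ * Complex.I)) * Complex.exp (-(n * θ * Complex.I)) := by
  have hpi := Real.pi_pos
  have h1 : HasSum (fun j : ℤ => ∫ θ in (-Real.pi)..Real.pi,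
      (s j : ℂ) * Complex.exp ((j - n : ℤ) * Complex.I * θ))
      (∫ θ in (-Real.pi)..Real.pi,
        F (Complex.exp (θ * Complex.I)) * Complex.exp (-(n * θ * Complex.I))) := by
    refine intervalIntegral.hasSum_integral_of_dominated_convergence (fun j _ => |s j|)
      (fun j => Continuous.aestronglyMeasurable (by fun_prop)) ?_ ?_ ?_ ?_
    · intro j
      refine Eventually.of_forall fun θ _ => ?_
      rw [norm_mul, Complex.norm_real, Real.norm_eq_abs, show ((j - n : ℤ) : ℂ) * Complex.I * θ =
        (((j - n : ℤ) * θ : ℝ) : ℂ) * Complex.I by push_cast; ring, Complex.norm_exp_ofReal_mul_I,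
        mul_one]
    · exact Eventually.of_forall fun θ _ => h.summable_abs hI
    · exact intervalIntegrable_const
    · refine Eventually.of_forall fun θ _ => ?_
      have h2 := (h (Complex.exp (θ * Complex.I)) (Complex.exp_ne_zero _)
        (by rwa [Complex.norm_exp_ofReal_mul_I])).mul_right (Complex.exp (-(n * θ * Complex.I)))
      convert! h2 using 2 with j
      rw [← Complex.exp_int_mul, mul_assoc (s j : ℂ), ← Complex.exp_add]
      congr 2
      push_cast
      ring
  have h3 : ∀ j : ℤ, (∫ θ in (-Real.pi)..Real.pi,
      (s j : ℂ) * Complex.exp ((j - n : ℤ) * Complex.I * θ)) =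
      if j = n then (s n : ℂ) * (2 * Real.pi) else 0 := by
    intro j
    rw [intervalIntegral.integral_const_mul]
    split_ifs with hj
    · subst hj
      simp
      left
      ring
    · have hne : ((j - n : ℤ) : ℂ) * Complex.I ≠ 0 :=
        mul_ne_zero (by exact_mod_cast sub_ne_zero.2 hj) Complex.I_ne_zero
      rw [integral_exp_mul_complex hne]
      have : Complex.exp ((j - n : ℤ) * Complex.I * (Real.pi : ℝ)) =
          Complex.exp ((j - n : ℤ) * Complex.I * ((-Real.pi : ℝ) : ℂ)) := by
        rw [Complex.exp_eq_exp_iff_exists_int]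
        exact ⟨j - n, by push_cast; ring⟩
      rw [this, sub_self, zero_div, mul_zero]
  simp_rw [h3] at h1
  have h4 := h1.unique (hasSum_ite_eq n ((s n : ℂ) * (2 * Real.pi)))
  rw [h4]
  field_simp

theorem unique (hs : HasLaurent s F I) (ht : HasLaurent t G I) (hI : 1 ∈ I)
    (hFG : ∀ z : ℂ, ‖z‖ = 1 → F z = G z) : s = t := by
  funext n
  have h1 := hs.coeff_eq_integral hI n
  have h2 := ht.coeff_eq_integral hI n
  simp_rw [fun θ : ℝ => hFG (Complex.exp (θ * Complex.I)) (Complex.norm_exp_ofReal_mul_I θ)] at h1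
  exact_mod_cast h1.trans h2.symm

theorem coeff_eq_integral_cos (h : HasLaurent s F I) (hI : 1 ∈ I) {f : ℝ → ℝ}
    (hf : ∀ θ : ℝ, F (Complex.exp (θ * Complex.I)) = f θ) (hfc : Continuous f) (n : ℤ) :
    s n = (2 * Real.pi)⁻¹ * ∫ θ in (-Real.pi)..Real.pi, Real.cos (n * θ) * f θ := by
  have h1 := h.coeff_eq_integral hI n
  simp_rw [hf] at h1
  have h2 := congrArg Complex.re h1
  rw [Complex.ofReal_re, show (2 * Real.pi : ℂ)⁻¹ = ((2 * Real.pi)⁻¹ : ℝ) by push_cast; rfl,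
    Complex.re_ofReal_mul] at h2
  rw [h2]
  congr 1
  have hc : Continuous fun θ : ℝ => (f θ : ℂ) * Complex.exp (-(n * θ * Complex.I)) := by fun_prop
  have h3 := Complex.reCLM.intervalIntegral_comp_comm 
    (hc.intervalIntegrable (μ := MeasureTheory.volume) (-Real.pi) Real.pi)
  rw [Complex.reCLM_apply] at h3
  rw [← h3]
  refine intervalIntegral.integral_congr fun θ _ => ?_
  simp only [Complex.reCLM_apply]
  rw [Complex.re_ofReal_mul, show -((n : ℂ) * θ * Complex.I) = ((-(n * θ) : ℝ) : ℂ) * Complex.I by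
    push_cast; ring, Complex.exp_ofReal_mul_I_re, Real.cos_neg, mul_comm]

end HasLaurent

/-- The conjugation symmetry lets the Taylor series be averaged with its conjugate, which leaves the
real parts of the coefficients. -/
theorem exists_hasLaurent_of_differentiableOn {F : ℂ → ℂ} {R : ℝ}
    (hd : DifferentiableOn ℂ F (Metric.ball 0 R))
    (hconj : ∀ z, ‖z‖ < R → F ((starRingEnd ℂ) z) = (starRingEnd ℂ) (F z)) :
    ∃ s : ℤ → ℝ, HasLaurent s F (Set.Iio R) := by
  set t : ℕ → ℂ := fun n => (n.factorial : ℂ)⁻¹ * iteratedDeriv n F 0 with ht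
  have h1 : ∀ z : ℂ, ‖z‖ < R → HasSum (fun n => t n * z ^ n) (F z) := by
    intro z hz
    convert! Complex.hasSum_taylorSeries_on_ball hd (z := z) (by simpa using hz) using 2 with n
    simp only [ht, sub_zero, smul_eq_mul]
    ring
  have h2 : ∀ z : ℂ, ‖z‖ < R → HasSum (fun n => (starRingEnd ℂ) (t n) * z ^ n) (F z) := by
    intro z hz
    have h3 := Complex.hasSum_conj'.2 (h1 ((starRingEnd ℂ) z) (by rwa [RCLike.norm_conj]))
    rw [← hconj _ (by rwa [RCLike.norm_conj]), Complex.conj_conj] at h3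
    convert! h3 using 2 with n
    simp
  refine ⟨fun j => if 0 ≤ j then (t j.toNat).re else 0, fun z hz hI => ?_⟩
  have h4 := ((h1 z hI).add (h2 z hI)).div_const 2
  rw [add_self_div_two] at h4
  refine (Function.Injective.hasSum_iff (Nat.cast_injective (R := ℤ)) fun l hl => ?_).1 ?_
  · have : ¬ 0 ≤ l := fun h => hl ⟨l.toNat, by simp [h]⟩
    simp [this]
  · convert! h4 using 2 with n
    simp only [Function.comp, Int.natCast_nonneg, if_true, Int.toNat_natCast, zpow_natCast]
    rw [← add_mul, Complex.add_conj]
    push_cast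
    ring

/-- Fubini with one factor merely bounded: scaling constants are a priori only square-summable,
hence bounded. -/
theorem hasSum_mul_tsum_mul_of_summable {a c u : ℤ → ℝ} {C : ℝ} (ha : ∀ j, |a j| ≤ C)
    (hc : Summable fun j => |c j|) (hu : Summable fun j => |u j|) :
    HasSum (fun j => a j * ∑' k, c k * u (j + k)) (∑' l, conv a c l * u l) := by
  set f : ℤ × ℤ → ℝ := fun p => a (p.1 - p.2) * c p.2 * u p.1 with hf
  have hs : Summable f := by
    refine Summable.of_norm_bounded ((hu.mul_of_nonneg hc (fun _ => abs_nonneg _)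
      (fun _ => abs_nonneg _)).mul_left C) fun p => ?_
    simp only [hf, norm_mul, Real.norm_eq_abs]
    calc |a (p.1 - p.2)| * |c p.2| * |u p.1| ≤ C * |c p.2| * |u p.1| := by
          gcongr; exact ha _
      _ = C * (|u p.1| * |c p.2|) := by ring
  have h1 : HasSum (fun l => conv a c l * u l) (∑' p, f p) := by
    refine hs.hasSum.prod_fiberwise fun l => ?_
    have h2 := (hs.prod_factor l).hasSum
    convert! h2 using 1
    simp only [hf]
    rw [tsum_mul_right, conv, ← (Equiv.subLeft l).tsum_eq]
    simp
  rw [h1.tsum_eq]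
  let e : ℤ × ℤ ≃ ℤ × ℤ :=
    ⟨fun p => (p.1 + p.2, p.2), fun p => (p.1 - p.2, p.2), fun p => by simp, fun p => by simp⟩
  have h3 := e.hasSum_iff.2 hs.hasSum
  have h4 : f ∘ e = fun p => a p.1 * c p.2 * u (p.1 + p.2) := by
    funext p
    simp [hf, e]
  rw [h4] at h3
  refine h3.prod_fiberwise fun j => ?_
  have h5 := (h3.summable.prod_factor j).hasSum
  simp only [mul_assoc] at h5 ⊢
  rwa [tsum_mul_left] at h5

theorem conv_assoc {a c u : ℤ → ℝ} {C : ℝ} (ha : ∀ j, |a j| ≤ C)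
    (hc : Summable fun j => |c j|) (hu : Summable fun j => |u j|) :
    conv (conv a c) u = conv a (conv c u) := by
  funext n
  have h := hasSum_mul_tsum_mul_of_summable ha hc (u := fun l => u (n - l))
    ((Equiv.subLeft n).summable_iff.2 hu)
  rw [conv, ← h.tsum_eq, conv]
  refine tsum_congr fun j => ?_
  rw [conv]
  simp only [sub_sub]

theorem abs_conv_le {a c : ℤ → ℝ} {C : ℝ} (ha : ∀ j, |a j| ≤ C)
    (hc : Summable fun j => |c j|) (n : ℤ) : |conv a c n| ≤ C * ∑' j, |c j| := by
  have h1 : Summable fun k => |c (n - k)| := (Equiv.subLeft n).summable_iff.2 hc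
  have h2 : HasSum (fun k => C * |c (n - k)|) (C * ∑' j, |c j|) := by
    rw [← (Equiv.subLeft n).tsum_eq]
    exact h1.hasSum.mul_left C
  rw [← Real.norm_eq_abs, conv]
  refine tsum_of_norm_bounded h2 fun k => ?_
  rw [norm_mul]
  exact mul_le_mul_of_nonneg_right (ha k) (abs_nonneg _)

end CardinalBSpline

/-! ### Darboux's method for an inverse square-root singularity. -/

namespace CardinalBSpline

/-- The normalized central binomial coefficient `4⁻ⁿ (2n choose n)`. -/
noncomputable def binomHalf (n : ℕ) : ℝ := (n.centralBinom : ℝ) / 4 ^ n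

theorem binomHalf_pos (n : ℕ) : 0 < binomHalf n :=
  div_pos (by exact_mod_cast n.centralBinom_pos) (by positivity)

theorem binomHalf_succ (n : ℕ) : (2 * n + 2) * binomHalf (n + 1) = (2 * n + 1) * binomHalf n := by
  have h : ((n : ℝ) + 1) * (n + 1).centralBinom = 2 * (2 * n + 1) * n.centralBinom := by
    exact_mod_cast n.succ_mul_centralBinom_succ
  simp only [binomHalf, pow_succ]
  field_simp
  linear_combination 2 * h

theorem binomHalf_antitone : Antitone binomHalf := by
  refine antitone_nat_of_succ_le fun n => ?_
  have h1 := binomHalf_succ n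
  have h2 := binomHalf_pos n
  have h3 := binomHalf_pos (n + 1)
  nlinarith [(Nat.cast_nonneg n : (0 : ℝ) ≤ n)]

/-- The sequence (n + 1) `binomHalf n` increases. The resulting linear loss in k is harmless against
the geometric decay in `summable_bound`. -/
theorem binomHalf_le_mul (n k : ℕ) : binomHalf n ≤ (k + 1) * binomHalf (n + k) := by
  have hm : Monotone fun n : ℕ => ((n : ℝ) + 1) * binomHalf n := by
    refine monotone_nat_of_le_succ fun n => ?_
    have h1 := binomHalf_succ n
    have h2 := binomHalf_pos (n + 1)
    have h3 := binomHalf_pos n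
    have hn : (0 : ℝ) ≤ n := Nat.cast_nonneg n
    push_cast
    have : ((n : ℝ) + 2) * binomHalf (n + 1) * (2 * n + 2) =
        (n + 2) * (2 * n + 1) * binomHalf n := by linear_combination (n + 2) * h1
    have h4 : (n + 1) * binomHalf n * (2 * n + 2) ≤ (n + 2) * (2 * n + 1) * binomHalf n := by
      nlinarith [mul_nonneg hn h3.le]
    have h5 : (0 : ℝ) < 2 * n + 2 := by positivity
    have := le_of_mul_le_mul_right (h4.trans_eq this.symm) h5
    linarith
  have h := hm (Nat.le_add_right n k)
  simp only at h
  push_cast at h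
  have h3 := binomHalf_pos (n + k)
  have hn : (0 : ℝ) ≤ n := Nat.cast_nonneg n
  have hk : (0 : ℝ) ≤ k := Nat.cast_nonneg k
  have h6 : ((n : ℝ) + k + 1) * binomHalf (n + k) ≤ (n + 1) * ((k + 1) * binomHalf (n + k)) := by
    nlinarith [mul_nonneg (mul_nonneg hn hk) h3.le]
  exact le_of_mul_le_mul_left (h.trans h6) (by positivity)

/-- With b_n = `binomHalf n`, the sequence n b_n² increases, while (2n + 1) b_n² decreases from 1
and so bounds it. Only positivity of the limit is needed, not its value. -/
theorem exists_tendsto_binomHalf_mul_sqrt :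
    ∃ c : ℝ, 0 < c ∧ Tendsto (fun n : ℕ => binomHalf n * √n) atTop (𝓝 c) := by
  have hv : ∀ n : ℕ, (2 * n + 1) * binomHalf n ^ 2 ≤ 1 := by
    intro n
    induction n with
    | zero => simp [binomHalf]
    | succ n ih =>
      have h1 := binomHalf_succ n
      refine le_trans ?_ ih
      have hn : (0 : ℝ) ≤ n := Nat.cast_nonneg n
      have h4 : (0 : ℝ) < (2 * n + 2) ^ 2 := by positivity
      refine le_of_mul_le_mul_left ?_ h4
      have : ((2 : ℝ) * n + 2) ^ 2 * ((2 * (n + 1 : ℕ) + 1) * binomHalf (n + 1) ^ 2) =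
          (2 * n + 3) * ((2 * n + 1) * binomHalf n) ^ 2 := by
        rw [← h1]; push_cast; ring
      rw [this]
      nlinarith [mul_nonneg (by positivity : (0 : ℝ) ≤ 2 * n + 1) (sq_nonneg (binomHalf n))]
  have hu : Monotone fun n : ℕ => (n : ℝ) * binomHalf n ^ 2 := by
    refine monotone_nat_of_le_succ fun n => ?_
    have h1 := binomHalf_succ n
    have hn : (0 : ℝ) ≤ n := Nat.cast_nonneg n
    have h4 : (0 : ℝ) < (2 * n + 2) ^ 2 := by positivity
    refine le_of_mul_le_mul_left ?_ h4
    have : ((2 : ℝ) * n + 2) ^ 2 * (((n + 1 : ℕ) : ℝ) * binomHalf (n + 1) ^ 2) =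
        (n + 1) * ((2 * n + 1) * binomHalf n) ^ 2 := by
      rw [← h1]; push_cast; ring
    rw [this]
    nlinarith [mul_nonneg (by positivity : (0 : ℝ) ≤ n + 1) (sq_nonneg (binomHalf n))]
  have hbdd : BddAbove (Set.range fun n : ℕ => (n : ℝ) * binomHalf n ^ 2) := by
    refine ⟨1, ?_⟩
    rintro _ ⟨n, rfl⟩
    have := hv n
    have hn : (0 : ℝ) ≤ n := Nat.cast_nonneg n
    simp only
    nlinarith [sq_nonneg (binomHalf n), mul_nonneg hn (sq_nonneg (binomHalf n))]
  have ht := tendsto_atTop_ciSup hu hbdd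
  set L := ⨆ n : ℕ, (n : ℝ) * binomHalf n ^ 2
  have hL : 0 < L := by
    have h1 : ((1 : ℕ) : ℝ) * binomHalf 1 ^ 2 ≤ L := le_ciSup hbdd 1
    have h2 := binomHalf_pos 1
    refine lt_of_lt_of_le ?_ h1
    positivity
  refine ⟨√L, Real.sqrt_pos.2 hL, (ht.sqrt).congr fun n => ?_⟩
  rw [Real.sqrt_mul (Nat.cast_nonneg n), Real.sqrt_sq (binomHalf_pos n).le, mul_comm]

theorem tendsto_binomHalf_add_div (k : ℕ) :
    Tendsto (fun n : ℕ => binomHalf (n + k) / binomHalf n) atTop (𝓝 1) := by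
  have h1 : Tendsto (fun n : ℕ => binomHalf (n + 1) / binomHalf n) atTop (𝓝 1) := by
    have h2 : Tendsto (fun n : ℕ => (1 : ℝ) / ((n : ℝ) + 1)) atTop (𝓝 0) :=
      tendsto_one_div_add_atTop_nhds_zero_nat
    have h3 := (h2.div_const 2).const_sub 1
    rw [zero_div, sub_zero] at h3
    refine h3.congr fun n => ?_
    have h4 := binomHalf_succ n
    have h5 := binomHalf_pos n
    have h6 : (n : ℝ) + 1 ≠ 0 := by positivity
    rw [eq_div_iff h5.ne']
    field_simp
    linear_combination -h4
  induction k with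
  | zero =>
    refine tendsto_const_nhds.congr fun n => ?_
    rw [add_zero, div_self (binomHalf_pos n).ne']
  | succ k ih =>
    have h2 := ((tendsto_add_atTop_iff_nat k).2 h1).mul ih
    rw [one_mul] at h2
    refine h2.congr fun n => ?_
    rw [div_mul_div_cancel₀ (binomHalf_pos _).ne', add_assoc]

/-- The coefficients of `(1 + q w) ^ (-1/2)`, as a two-sided sequence. -/
noncomputable def invSqrtCoeff (q : ℝ) (j : ℤ) : ℝ :=
  if 0 ≤ j then (-q) ^ j * binomHalf j.toNat else 0

theorem invSqrtCoeff_natCast (q : ℝ) (n : ℕ) : invSqrtCoeff q n = (-q) ^ n * binomHalf n := by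
  simp [invSqrtCoeff]

theorem choose_neg_half (n : ℕ) : Ring.choose (-(1 / 2) : ℂ) n = (-1) ^ n * binomHalf n := by
  induction n with
  | zero => simp [binomHalf]
  | succ n ih =>
    have h1 := Ring.choose_add_smul_choose (-(1 / 2) - n : ℂ) 1 n
    rw [sub_add_cancel, Ring.choose_one_right, ih, add_comm 1 n, Nat.choose_succ_self_right, nsmul_eq_mul] at h1
    have h2 : (2 * (n : ℂ) + 2) * binomHalf (n + 1) = (2 * n + 1) * binomHalf n := by
      exact_mod_cast congrArg (fun x : ℝ => (x : ℂ)) (binomHalf_succ n)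
    have h3 : ((n + 1 : ℕ) : ℂ) ≠ 0 := by exact_mod_cast Nat.succ_ne_zero n
    refine mul_left_cancel₀ h3 (h1.trans ?_)
    push_cast
    rw [pow_succ]
    linear_combination (-1 : ℂ) ^ n / 2 * h2

theorem hasLaurent_invSqrtCoeff {q : ℝ} (hq : 0 < q) :
    HasLaurent (invSqrtCoeff q) (fun w => (1 + q * w) ^ (-(1 / 2) : ℂ)) (Set.Iio q⁻¹) := by
  intro z hz hI
  have hz1 : ‖(q : ℂ) * z‖ < 1 := by
    rw [norm_mul, Complex.norm_real, Real.norm_of_nonneg hq.le]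
    have := mul_lt_mul_of_pos_left (Set.mem_Iio.1 hI) hq
    rwa [mul_inv_cancel₀ hq.ne'] at this
  have h1 := (Complex.one_add_cpow_hasFPowerSeriesOnBall_zero (a := -(1 / 2))).hasSum
    (y := (q : ℂ) * z) (by
      rw [Metric.mem_eball, edist_zero_right, ← ofReal_norm]
      exact ENNReal.ofReal_lt_one.2 hz1)
  refine (Function.Injective.hasSum_iff (Nat.cast_injective (R := ℤ)) fun l hl => ?_).1 ?_
  · have : ¬ 0 ≤ l := fun h => hl ⟨l.toNat, by simp [h]⟩
    simp [invSqrtCoeff, this]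
  · rw [zero_add] at h1
    convert! h1 using 2 with n
    simp only [Function.comp, binomialSeries_apply, choose_neg_half, List.ofFn_const,
      List.prod_replicate, smul_eq_mul, invSqrtCoeff_natCast, zpow_natCast]
    push_cast
    rw [neg_pow, mul_pow]
    ring

theorem tendsto_invSqrtCoeff_div {q : ℝ} (hq : 0 < q) (k : ℤ) :
    Tendsto (fun n : ℕ => invSqrtCoeff q (n - k) / invSqrtCoeff q n) atTop (𝓝 ((-q) ^ (-k))) := by
  have hq' : -q ≠ 0 := neg_ne_zero.2 hq.ne'
  have hmain : ∀ (i j : ℕ), Tendsto (fun n : ℕ => invSqrtCoeff q ((n + i : ℕ) : ℤ) /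
      invSqrtCoeff q ((n + j : ℕ) : ℤ)) atTop (𝓝 ((-q) ^ ((i : ℤ) - j))) := by
    intro i j
    have h1 := ((tendsto_binomHalf_add_div i).div (tendsto_binomHalf_add_div j) one_ne_zero).const_mul
      ((-q) ^ ((i : ℤ) - j))
    rw [div_one, mul_one] at h1
    refine h1.congr fun n => ?_
    simp only [Pi.div_apply]
    rw [invSqrtCoeff_natCast, invSqrtCoeff_natCast, zpow_sub₀ hq', zpow_natCast, zpow_natCast,
      pow_add, pow_add]
    have := (binomHalf_pos n).ne'
    have := (binomHalf_pos (n + j)).ne'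
    have := pow_ne_zero n hq'
    field_simp
  rcases le_or_gt 0 k with h | h
  · obtain ⟨j, rfl⟩ := Int.eq_ofNat_of_zero_le h
    have h1 := hmain 0 j
    rw [Nat.cast_zero, zero_sub] at h1
    refine (tendsto_add_atTop_iff_nat j).1 (h1.congr fun n => ?_)
    congr 2
    push_cast
    ring
  · obtain ⟨j, hj⟩ := Int.eq_ofNat_of_zero_le (by omega : 0 ≤ -k)
    obtain rfl : k = -j := by omega
    have := hmain j 0
    simp only [add_zero, Nat.cast_zero, sub_zero, neg_neg, sub_neg_eq_add, Nat.cast_add] at this ⊢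
    exact this

/-- A bound uniform in n: this is the majorant for dominated convergence in Darboux's method. -/
theorem abs_invSqrtCoeff_div_le {q : ℝ} (hq : 0 < q) (n : ℕ) (k : ℤ) :
    |invSqrtCoeff q (n - k) / invSqrtCoeff q n| ≤ (|k| + 1 : ℤ) * q ^ (-k) := by
  have hk0 : (0 : ℝ) ≤ ((|k| + 1 : ℤ) : ℝ) := by positivity
  rcases lt_or_ge (n : ℤ) k with h | h
  · rw [invSqrtCoeff, if_neg (by omega), zero_div, abs_zero]
    positivity
  obtain ⟨i, hi⟩ := Int.eq_ofNat_of_zero_le (by omega : 0 ≤ (n : ℤ) - k)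
  have hk : -k = (i : ℤ) - n := by omega
  have hb : binomHalf i / binomHalf n ≤ ((|k| + 1 : ℤ) : ℝ) := by
    rw [div_le_iff₀ (binomHalf_pos n)]
    rcases le_or_gt i n with h1 | h1
    · obtain ⟨l, rfl⟩ := Nat.exists_eq_add_of_le h1
      have : |k| = l := by
        rw [show k = l by push_cast at hi; omega]; simp
      rw [this]
      exact_mod_cast binomHalf_le_mul i l
    · have h2 := binomHalf_antitone h1.le
      have h3 : (1 : ℝ) ≤ ((|k| + 1 : ℤ) : ℝ) := by
        exact_mod_cast (by have := abs_nonneg k; omega : (1 : ℤ) ≤ |k| + 1)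
      nlinarith [binomHalf_pos n]
  rw [hi, hk, invSqrtCoeff_natCast, invSqrtCoeff_natCast, abs_div, abs_mul, abs_mul, abs_pow,
    abs_pow, abs_neg, abs_of_pos hq, abs_of_pos (binomHalf_pos _), abs_of_pos (binomHalf_pos _),
    zpow_sub₀ hq.ne', zpow_natCast, zpow_natCast]
  calc q ^ i * binomHalf i / (q ^ n * binomHalf n)
      = (binomHalf i / binomHalf n) * (q ^ i / q ^ n) := by ring
    _ ≤ _ := mul_le_mul_of_nonneg_right hb (by positivity)

theorem exists_forall_add_one_mul_pow_le {x : ℝ} (h0 : 0 ≤ x) (h1 : x < 1) :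
    ∃ C : ℝ, 0 ≤ C ∧ ∀ n : ℕ, ((n : ℝ) + 1) * x ^ n ≤ C := by
  have h2 := (tendsto_self_mul_const_pow_of_lt_one h0 h1).add
    (tendsto_pow_atTop_nhds_zero_of_lt_one h0 h1)
  obtain ⟨C, hC⟩ := h2.bddAbove_range
  refine ⟨C, ?_, fun n => ?_⟩
  · refine le_trans ?_ (hC ⟨0, rfl⟩)
    simp
  · refine le_trans (le_of_eq ?_) (hC ⟨n, rfl⟩)
    simp only
    ring

/-- For k ≥ 0 a radius ρ < R with q ρ² > 1 gives (k + 1) q^{-k} ≤ C ρ^{2k}, which is summable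
against g. For k < 0 the factor q^{-k} itself decays. -/
theorem summable_bound {q R : ℝ} (hq : 0 < q) (hq1 : q < 1) (hR0 : 0 < R) (hR : q⁻¹ < R ^ 2)
    {g : ℤ → ℝ} {G : ℂ → ℂ} (hg : HasLaurent g G (Set.Ico 1 R)) (s : ℤ) :
    Summable fun k : ℤ => (|k| + 1 : ℤ) * q ^ (-k) * |g (2 * k + s)| := by
  have h1R : 1 < R := by
    have : (1 : ℝ) < q⁻¹ := (one_lt_inv₀ hq).2 hq1
    nlinarith
  obtain ⟨ρ, hρ0, hρR, hρq⟩ : ∃ ρ : ℝ, 1 < ρ ∧ ρ < R ∧ q⁻¹ < ρ ^ 2 := by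
    obtain ⟨x, hx1, hx2⟩ := exists_between hR
    have hx : 1 < x := ((one_lt_inv₀ hq).2 hq1).trans hx1
    have hsq : √x ^ 2 = x := Real.sq_sqrt (by linarith)
    refine ⟨√x, ?_, ?_, by rwa [hsq]⟩
    · rwa [Real.lt_sqrt zero_le_one, one_pow]
    · rwa [Real.sqrt_lt' hR0]
  have hρ : 0 < ρ := by linarith
  have hinj : Function.Injective fun k : ℤ => 2 * k + s := fun a b h => by simpa using h
  have s1 := (hg.summable_abs_mul hρ ⟨hρ0.le, hρR⟩).comp_injective hinj
  have s2 := (hg.summable_abs ⟨le_rfl, h1R⟩).comp_injective hinj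
  have hx1 : (q * ρ ^ 2)⁻¹ < 1 := by
    refine inv_lt_one_of_one_lt₀ ?_
    have := mul_lt_mul_of_pos_left hρq hq
    rwa [mul_inv_cancel₀ hq.ne'] at this
  obtain ⟨C1, hC1, hb1⟩ := exists_forall_add_one_mul_pow_le (by positivity) hx1
  obtain ⟨C2, hC2, hb2⟩ := exists_forall_add_one_mul_pow_le hq.le hq1
  refine Summable.of_nonneg_of_le (fun k => ?_) (fun k => ?_)
    ((s1.mul_left (C1 * ρ ^ (-s))).add (s2.mul_left C2))
  · have : (0 : ℝ) ≤ ((|k| + 1 : ℤ) : ℝ) := by positivity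
    positivity
  · simp only [Function.comp]
    have hA : (0 : ℝ) ≤ C1 * ρ ^ (-s) * (|g (2 * k + s)| * ρ ^ (2 * k + s)) := by positivity
    have hB : (0 : ℝ) ≤ C2 * |g (2 * k + s)| := by positivity
    rcases le_or_gt 0 k with h | h
    · refine le_trans ?_ (le_add_of_nonneg_right hB)
      obtain ⟨j, rfl⟩ := Int.eq_ofNat_of_zero_le h
      have h3 := hb1 j
      have e1 : C1 * ρ ^ (-s) * (|g (2 * (j : ℤ) + s)| * ρ ^ (2 * (j : ℤ) + s)) =
          C1 * ρ ^ (2 * j) * |g (2 * (j : ℤ) + s)| := by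
        rw [zpow_add₀ hρ.ne', zpow_neg, show (2 * (j : ℤ)) = ((2 * j : ℕ) : ℤ) by push_cast; ring,
          zpow_natCast]
        have := zpow_ne_zero s hρ.ne'
        field_simp
      rw [e1]
      refine mul_le_mul_of_nonneg_right ?_ (abs_nonneg _)
      rw [zpow_neg, zpow_natCast]
      have e2 : ((j : ℝ) + 1) * (q ^ j)⁻¹ = ((j : ℝ) + 1) * ((q * ρ ^ 2)⁻¹) ^ j * ρ ^ (2 * j) := by
        rw [inv_pow, mul_pow, ← pow_mul]
        field_simp
      simp only [Nat.abs_cast, Int.cast_add, Int.cast_natCast, Int.cast_one]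
      rw [e2]
      exact mul_le_mul_of_nonneg_right h3 (by positivity)
    · refine le_trans ?_ (le_add_of_nonneg_left hA)
      obtain ⟨j, hj⟩ := Int.eq_ofNat_of_zero_le (by omega : 0 ≤ -k)
      obtain rfl : k = -j := by omega
      refine mul_le_mul_of_nonneg_right ?_ (abs_nonneg _)
      simpa using hb2 j

theorem conv_upsample_eq_tsum (s g : ℤ → ℝ) (n e : ℤ) :
    conv (upsample s) g (2 * n + e) = ∑' k : ℤ, s (n - k) * g (2 * k + e) := by
  have h1 : Function.support (fun k : ℤ => upsample s k * g (2 * n + e - k)) ⊆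
      Set.range fun l : ℤ => 2 * l := by
    intro k hk
    by_contra hl
    refine hk ?_
    simp only
    rw [upsample, if_neg, zero_mul]
    rintro ⟨r, hr⟩
    exact hl ⟨r, by simp only; omega⟩
  rw [conv, ← Function.Injective.tsum_eq (g := fun l : ℤ => 2 * l)
    (fun a b h => by simpa using h) h1, ← (Equiv.subLeft n).tsum_eq]
  refine tsum_congr fun k => ?_
  simp only [Equiv.subLeft_apply]
  rw [upsample, if_pos (even_two_mul _), Int.mul_ediv_cancel_left _ two_ne_zero]
  congr 2
  ring

/-- Darboux asymptotics for the coefficients of `(1 + q z²) ^ (-1/2) * G z`. -/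
theorem tendsto_conv_upsample_invSqrtCoeff {q R : ℝ} (hq : 0 < q) (hq1 : q < 1) (hR0 : 0 < R)
    (hR : q⁻¹ < R ^ 2) {g : ℤ → ℝ} {G : ℂ → ℂ} (hg : HasLaurent g G (Set.Ico 1 R)) {z : ℂ}
    (hz : z ^ 2 = -(q : ℂ)⁻¹) (hG : G z ^ 2 ≠ G (-z) ^ 2) (s : ℤ) :
    ∃ L : ℝ, L ≠ 0 ∧ Tendsto (fun n : ℕ => conv (upsample (invSqrtCoeff q)) g (2 * n + s) /
      invSqrtCoeff q n) atTop (𝓝 L) := by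
  refine ⟨∑' k : ℤ, (-q) ^ (-k) * g (2 * k + s), ?_, ?_⟩
  · have hz0 : z ≠ 0 := by
      rintro rfl
      have : (q : ℂ) ≠ 0 := Complex.ofReal_ne_zero.2 hq.ne'
      simp [this] at hz
    have hnz : ‖z‖ ^ 2 = q⁻¹ := by
      rw [← norm_pow, hz, norm_neg, norm_inv, Complex.norm_real, Real.norm_of_nonneg hq.le]
    have hmem : ‖z‖ ∈ Set.Ico 1 R := by
      have : (1 : ℝ) < q⁻¹ := (one_lt_inv₀ hq).2 hq1
      exact ⟨by nlinarith [norm_nonneg z], by nlinarith [norm_nonneg z]⟩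
    -- Adding (-1)^s times the series at -z keeps the exponents 2k + s, and z^{2k} = (-q)^{-k}. So
    -- the limit equals (G(z) + (-1)^s G(-z)) / (2 z^s), and its vanishing would give G(z)² =
    -- G(-z)².
    have h1 := (hg z hz0 hmem).add ((hg (-z) (neg_ne_zero.2 hz0) (by rwa [norm_neg])).mul_left
      ((-1) ^ s))
    have h2 : HasSum ((fun j : ℤ => (g j : ℂ) * z ^ j + (-1) ^ s * ((g j : ℂ) * (-z) ^ j)) ∘
        fun k : ℤ => 2 * k + s) (G z + (-1) ^ s * G (-z)) := by
      refine (Function.Injective.hasSum_iff (fun a b h => by simpa using h) fun l hl => ?_).2 h1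
      have h3 : Odd (l + s) := by
        rw [← Int.not_even_iff_odd]
        rintro ⟨r, hr⟩
        exact hl ⟨r - s, by simp only; omega⟩
      have h4 : (-1 : ℂ) ^ (l + s) = -1 := h3.neg_one_zpow
      rw [zpow_add₀ (by norm_num)] at h4
      rw [neg_eq_neg_one_mul z, mul_zpow]
      linear_combination (g l : ℂ) * z ^ l * h4
    have h5 : ∀ k : ℤ, ((fun j : ℤ => (g j : ℂ) * z ^ j + (-1) ^ s * ((g j : ℂ) * (-z) ^ j)) ∘
        fun k : ℤ => 2 * k + s) k = (((-q) ^ (-k) * g (2 * k + s) : ℝ) : ℂ) * (2 * z ^ s) := by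
      intro k
      simp only [Function.comp]
      have e1 : (-1 : ℂ) ^ s * (-1 : ℂ) ^ (2 * k + s) = 1 := by
        rw [← zpow_add₀ (by norm_num)]
        exact Even.neg_one_zpow ⟨k + s, by ring⟩
      have e2 : z ^ (2 * k + s) = ((-q) ^ (-k) : ℝ) * z ^ s := by
        rw [zpow_add₀ hz0, zpow_mul, show z ^ (2 : ℤ) = z ^ 2 from rfl, hz]
        push_cast
        rw [← inv_neg, inv_zpow, zpow_neg]
      have e3 : (-z) ^ (2 * k + s) = (-1) ^ (2 * k + s) * z ^ (2 * k + s) := by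
        rw [neg_eq_neg_one_mul z, mul_zpow]
      rw [e3, e2, Complex.ofReal_mul]
      linear_combination (g (2 * k + s) : ℂ) * (((-q) ^ (-k) : ℝ) * z ^ s) * e1
    rw [funext h5] at h2
    intro h0
    have h6 : (∑' k : ℤ, (((-q) ^ (-k) * g (2 * k + s) : ℝ) : ℂ) * (2 * z ^ s)) = 0 := by
      rw [tsum_mul_right, ← Complex.ofReal_tsum, h0]
      simp
    rw [h2.tsum_eq] at h6
    apply hG
    rw [eq_neg_of_add_eq_zero_left h6, neg_sq, mul_pow]
    rcases Int.even_or_odd s with he | he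
    · rw [he.neg_one_zpow]; ring
    · rw [he.neg_one_zpow]; ring
  · have h1 : ∀ n : ℕ, conv (upsample (invSqrtCoeff q)) g (2 * n + s) / invSqrtCoeff q n =
        ∑' k : ℤ, invSqrtCoeff q (n - k) / invSqrtCoeff q n * g (2 * k + s) := by
      intro n
      rw [conv_upsample_eq_tsum, ← tsum_div_const]
      exact tsum_congr fun k => by ring
    simp_rw [h1]
    refine tendsto_tsum_of_dominated_convergence (summable_bound hq hq1 hR0 hR hg s) (fun k => ?_)
      (Eventually.of_forall fun n k => ?_)
    · exact (tendsto_invSqrtCoeff_div hq k).mul_const _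
    · rw [norm_mul, Real.norm_eq_abs, Real.norm_eq_abs]
      exact mul_le_mul_of_nonneg_right (abs_invSqrtCoeff_div_le hq n k) (abs_nonneg _)

end CardinalBSpline

/-! ### Arguments along the imaginary axis, and fractional powers of products. -/

namespace CardinalBSpline

/-- `w` is nonzero and `φ` is one of its arguments. -/
def HasPhase (w : ℂ) (φ : ℝ) : Prop := ∃ A : ℝ, 0 < A ∧ w = A * Complex.exp (φ * Complex.I)

namespace HasPhase

theorem mul {w w' : ℂ} {φ φ' : ℝ} (h : HasPhase w φ) (h' : HasPhase w' φ') :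
    HasPhase (w * w') (φ + φ') := by
  obtain ⟨A, hA, rfl⟩ := h
  obtain ⟨B, hB, rfl⟩ := h'
  refine ⟨A * B, mul_pos hA hB, ?_⟩
  push_cast
  rw [add_mul, Complex.exp_add]
  ring

theorem pow {w : ℂ} {φ : ℝ} (h : HasPhase w φ) (n : ℕ) : HasPhase (w ^ n) (n * φ) := by
  obtain ⟨A, hA, rfl⟩ := h
  refine ⟨A ^ n, pow_pos hA n, ?_⟩
  rw [mul_pow, ← Complex.exp_nat_mul]
  push_cast
  ring_nf

theorem prod {ι : Type*} {s : Finset ι} {w : ι → ℂ} {φ : ι → ℝ}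
    (h : ∀ i ∈ s, HasPhase (w i) (φ i)) : HasPhase (∏ i ∈ s, w i) (∑ i ∈ s, φ i) := by
  classical
  induction s using Finset.induction_on with
  | empty => exact ⟨1, one_pos, by simp⟩
  | insert a s ha ih =>
    rw [Finset.prod_insert ha, Finset.sum_insert ha]
    exact (h a (Finset.mem_insert_self a s)).mul
      (ih fun i hi => h i (Finset.mem_insert_of_mem hi))

theorem const_mul {w : ℂ} {φ : ℝ} (h : HasPhase w φ) {K : ℝ} (hK : 0 < K) :
    HasPhase (K * w) φ := by
  obtain ⟨A, hA, rfl⟩ := h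
  exact ⟨K * A, mul_pos hK hA, by push_cast; ring⟩

theorem one_add_mul_I (t : ℝ) : HasPhase (1 + t * Complex.I) (Real.arctan t) := by
  have h : 0 < √(1 + t ^ 2) := Real.sqrt_pos.2 (by positivity)
  refine ⟨√(1 + t ^ 2), h, ?_⟩
  rw [Complex.exp_mul_I, ← Complex.ofReal_cos, ← Complex.ofReal_sin, Real.cos_arctan,
    Real.sin_arctan]
  have h' : (√(1 + t ^ 2) : ℂ) ≠ 0 := Complex.ofReal_ne_zero.2 h.ne'
  push_cast
  field_simp

theorem re_eq {w : ℂ} {φ : ℝ} (h : HasPhase w φ) : ∃ A : ℝ, 0 < A ∧ w.re = A * Real.cos φ ∧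
    w.im = A * Real.sin φ := by
  obtain ⟨A, hA, rfl⟩ := h
  exact ⟨A, hA, by rw [Complex.re_ofReal_mul, Complex.exp_ofReal_mul_I_re],
    by rw [Complex.im_ofReal_mul, Complex.exp_ofReal_mul_I_im]⟩

end HasPhase

theorem conj_prodSymbol (K : ℝ) (Q : Finset ℝ) (z : ℂ) :
    prodSymbol K Q ((starRingEnd ℂ) z) = (starRingEnd ℂ) (prodSymbol K Q z) := by
  simp [prodSymbol, map_prod]

/-- The continuous argument of `(2 + z + z⁻¹) ^ m * prodSymbol K Q z` along `z = i y`. -/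
noncomputable def phase (m : ℕ) (Q : Finset ℝ) (y : ℝ) : ℝ :=
  m * Real.arctan ((y - y⁻¹) / 2) + ∑ q ∈ Q, (Real.arctan (q * y) + Real.arctan (-(q * y⁻¹)))

theorem two_add_I_mul_eq {y : ℝ} (hy : 0 < y) :
    2 + Complex.I * y + (Complex.I * y)⁻¹ = (2 : ℝ) * (1 + ((y - y⁻¹) / 2 : ℝ) * Complex.I) := by
  have : (y : ℂ) ≠ 0 := Complex.ofReal_ne_zero.2 hy.ne'
  rw [mul_inv, Complex.inv_I]
  push_cast
  ring

theorem hasPhase_phase (m : ℕ) {K : ℝ} (hK : 0 < K) (Q : Finset ℝ) {y : ℝ} (hy : 0 < y) :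
    HasPhase ((2 + Complex.I * y + (Complex.I * y)⁻¹) ^ m * prodSymbol K Q (Complex.I * y))
      (phase m Q y) := by
  refine HasPhase.mul ?_ ?_
  · rw [two_add_I_mul_eq hy]
    exact ((HasPhase.one_add_mul_I _).const_mul two_pos).pow m
  · refine (HasPhase.prod fun q _ => ?_).const_mul hK
    refine HasPhase.mul ?_ ?_
    · convert HasPhase.one_add_mul_I (q * y) using 1
      push_cast
      ring
    · convert HasPhase.one_add_mul_I (-(q * y⁻¹)) using 1
      rw [mul_inv, Complex.inv_I]
      push_cast
      ring

theorem phase_one (m : ℕ) (Q : Finset ℝ) : phase m Q 1 = 0 := by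
  simp [phase, Real.arctan_neg]

theorem continuousOn_phase (m : ℕ) (Q : Finset ℝ) : ContinuousOn (phase m Q) (Set.Ioi 0) := by
  have h : ContinuousOn (fun y : ℝ => y⁻¹) (Set.Ioi 0) :=
    continuousOn_inv₀.mono fun y hy => (ne_of_gt hy : y ≠ 0)
  have ha := Real.continuous_arctan
  unfold phase
  refine ContinuousOn.add (continuousOn_const.mul (ha.comp_continuousOn ?_))
    (continuousOn_finsetSum _ fun q _ => ContinuousOn.add (ha.comp_continuousOn ?_)
      (ha.comp_continuousOn ?_))
  · exact (continuousOn_id.sub h).div_const 2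
  · exact continuousOn_const.mul continuousOn_id
  · exact (continuousOn_const.mul h).neg

/-- At z = iy one has -z = z̄, so the two summands of the two-scale relation are conjugate. When the
first is purely imaginary they cancel. -/
theorem prodSymbol_neg_sq_eq_zero_of_phase {m : ℕ} {K : ℝ} (hK : 0 < K) {Q : Finset ℝ}
    (htwo : ∀ z : ℂ, z ≠ 0 → 4 ^ m * prodSymbol K Q (z ^ 2) =
      (2 + z + z⁻¹) ^ m * prodSymbol K Q z + (2 - z - z⁻¹) ^ m * prodSymbol K Q (-z))
    {y : ℝ} (hy : 0 < y) (hph : phase m Q y = Real.pi / 2) :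
    prodSymbol K Q (-(y : ℂ) ^ 2) = 0 := by
  have hz : Complex.I * (y : ℂ) ≠ 0 :=
    mul_ne_zero Complex.I_ne_zero (Complex.ofReal_ne_zero.2 hy.ne')
  have h1 := htwo _ hz
  have hc : (starRingEnd ℂ) (Complex.I * (y : ℂ)) = -(Complex.I * y) := by simp
  have h2 : (2 - Complex.I * y - (Complex.I * y)⁻¹) ^ m * prodSymbol K Q (-(Complex.I * y)) =
      (starRingEnd ℂ) ((2 + Complex.I * y + (Complex.I * y)⁻¹) ^ m *
        prodSymbol K Q (Complex.I * y)) := by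
    rw [map_mul, ← conj_prodSymbol, hc, map_pow, map_add, map_add, map_inv₀, hc, inv_neg]
    congr 2
    rw [Complex.conj_ofNat]
    ring
  obtain ⟨A, hA, hre, -⟩ := (hasPhase_phase m hK Q hy).re_eq
  rw [hph, Real.cos_pi_div_two, mul_zero] at hre
  rw [h2, Complex.add_conj, hre, mul_zero, Complex.ofReal_zero, mul_pow, Complex.I_sq,
    neg_one_mul] at h1
  exact (mul_eq_zero.1 h1).resolve_left (pow_ne_zero _ (by norm_num))

theorem exists_of_prodSymbol_neg_sq_eq_zero {K : ℝ} (hK : 0 < K) {Q : Finset ℝ} {y : ℝ}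
    (hy : 0 < y) (h : prodSymbol K Q (-(y : ℂ) ^ 2) = 0) :
    ∃ q ∈ Q, q * y ^ 2 = 1 ∨ q = y ^ 2 := by
  have hy' : (y : ℂ) ≠ 0 := Complex.ofReal_ne_zero.2 hy.ne'
  rw [prodSymbol] at h
  obtain ⟨q, hq, h1⟩ := Finset.prod_eq_zero_iff.1
    ((mul_eq_zero.1 h).resolve_left (Complex.ofReal_ne_zero.2 hK.ne'))
  refine ⟨q, hq, ?_⟩
  rcases mul_eq_zero.1 h1 with h2 | h2
  · left
    have : (q : ℂ) * y ^ 2 = 1 := by linear_combination -h2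
    exact_mod_cast this
  · right
    rw [inv_neg] at h2
    field_simp at h2
    have : (q : ℂ) = y ^ 2 := by linear_combination -h2
    exact_mod_cast this

theorem one_lt_of_mul_sq_eq_one {r y : ℝ} (hr0 : 0 < r) (hr1 : r < 1) (hy : 0 < y)
    (h : r * y ^ 2 = 1) : 1 < y := by
  by_contra! hcon
  have h1 : y ^ 2 ≤ 1 := pow_le_one₀ hy.le hcon
  nlinarith

/-- The sum over `Q` in `phase` is positive beyond 1. If the claim failed, `phase`, which is 0 at 1,
would take the value π/2 at some t in (1, y). Then P(-t²) = 0, so q t² = 1 for some q in `Q`,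
against q t² ≤ r t² < r y² = 1. -/
theorem mul_arctan_lt_pi_div_two {m : ℕ} {K : ℝ} (hK : 0 < K) {Q : Finset ℝ}
    (hQ : ∀ q ∈ Q, 0 < q ∧ q < 1)
    (htwo : ∀ z : ℂ, z ≠ 0 → 4 ^ m * prodSymbol K Q (z ^ 2) =
      (2 + z + z⁻¹) ^ m * prodSymbol K Q z + (2 - z - z⁻¹) ^ m * prodSymbol K Q (-z))
    {r : ℝ} (hr : r ∈ Q) (hmax : ∀ q ∈ Q, q ≤ r) {y : ℝ} (hy : 0 < y) (hyr : r * y ^ 2 = 1) :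
    m * Real.arctan ((y - y⁻¹) / 2) < Real.pi / 2 := by
  have hr01 := hQ r hr
  have hy1 : 1 < y := one_lt_of_mul_sq_eq_one hr01.1 hr01.2 hy hyr
  by_contra! hcon
  have hph : Real.pi / 2 < phase m Q y := by
    refine lt_of_le_of_lt hcon (lt_add_of_pos_right _ (Finset.sum_pos (fun q hq => ?_) ⟨r, hr⟩))
    rw [Real.arctan_neg, ← sub_eq_add_neg, sub_pos]
    refine Real.arctan_strictMono (mul_lt_mul_of_pos_left ?_ (hQ q hq).1)
    exact (inv_lt_one_of_one_lt₀ hy1).trans hy1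
  have hc : ContinuousOn (phase m Q) (Set.Icc 1 y) :=
    (continuousOn_phase m Q).mono fun t ht => lt_of_lt_of_le one_pos ht.1
  have hivt := intermediate_value_Icc hy1.le hc
  obtain ⟨t, ht, htp⟩ := hivt ⟨by rw [phase_one]; positivity, hph.le⟩
  have ht0 : 0 < t := lt_of_lt_of_le one_pos ht.1
  have hty : t < y := ht.2.lt_of_ne (by rintro rfl; exact hph.ne' htp)
  obtain ⟨q, hq, h⟩ := exists_of_prodSymbol_neg_sq_eq_zero hK ht0
    (prodSymbol_neg_sq_eq_zero_of_phase hK htwo ht0 htp)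
  have hq01 := hQ q hq
  rcases h with h | h
  · have h1 : q * t ^ 2 ≤ r * t ^ 2 := mul_le_mul_of_nonneg_right (hmax q hq) (by positivity)
    have h2 : r * t ^ 2 < r * y ^ 2 :=
      mul_lt_mul_of_pos_left (pow_lt_pow_left₀ hty ht0.le two_ne_zero) hr01.1
    linarith
  · nlinarith [ht.1]

/-- Equality would give w = (-1)^m w̄ for w = (2 + z + 1/z)^m, z = iy, making w real or purely
imaginary. Its argument lies strictly between 0 and π/2. -/
theorem one_add_pow_ne_one_sub_pow {m : ℕ} (hm : 1 ≤ m) {K : ℝ} (hK : 0 < K) {Q : Finset ℝ}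
    (hQ : ∀ q ∈ Q, 0 < q ∧ q < 1)
    (htwo : ∀ z : ℂ, z ≠ 0 → 4 ^ m * prodSymbol K Q (z ^ 2) =
      (2 + z + z⁻¹) ^ m * prodSymbol K Q z + (2 - z - z⁻¹) ^ m * prodSymbol K Q (-z))
    {r : ℝ} (hr : r ∈ Q) (hmax : ∀ q ∈ Q, q ≤ r) {y : ℝ} (hy : 0 < y) (hyr : r * y ^ 2 = 1) :
    (1 + Complex.I * y) ^ (2 * m) ≠ (1 - Complex.I * y) ^ (2 * m) := by
  intro heq
  have hr01 := hQ r hr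
  have hy1 : 1 < y := one_lt_of_mul_sq_eq_one hr01.1 hr01.2 hy hyr
  have hlt := mul_arctan_lt_pi_div_two hK hQ htwo hr hmax hy hyr
  set t := Real.arctan ((y - y⁻¹) / 2) with ht
  have hpos : 0 < (m : ℝ) * t := by
    refine mul_pos (by exact_mod_cast hm) (Real.arctan_pos.2 ?_)
    have := inv_lt_one_of_one_lt₀ hy1
    linarith
  set z := Complex.I * (y : ℂ) with hz
  have hz0 : z ≠ 0 := mul_ne_zero Complex.I_ne_zero (Complex.ofReal_ne_zero.2 hy.ne')
  have hc : (starRingEnd ℂ) z = -z := by simp [hz]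
  have hw : HasPhase ((2 + z + z⁻¹) ^ m) (m * t) := by
    rw [hz, two_add_I_mul_eq hy]
    exact ((HasPhase.one_add_mul_I _).const_mul two_pos).pow m
  have h1 : (2 + z + z⁻¹) ^ m = (-1) ^ m * (starRingEnd ℂ) ((2 + z + z⁻¹) ^ m) := by
    have e1 : 2 + z + z⁻¹ = (1 + z) ^ 2 / z := by field_simp; ring
    have e2 : (starRingEnd ℂ) (2 + z + z⁻¹) = -((1 - z) ^ 2 / z) := by
      rw [map_add, map_add, map_inv₀, hc, Complex.conj_ofNat]
      field_simp
      ring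
    rw [map_pow, e2, e1, neg_pow ((1 - z) ^ 2 / z), div_pow, div_pow, ← pow_mul, ← pow_mul, heq,
      ← mul_assoc, ← mul_pow]
    norm_num
  obtain ⟨A, hA, hre, him⟩ := hw.re_eq
  have hcos : 0 < A * Real.cos (m * t) :=
    mul_pos hA (Real.cos_pos_of_mem_Ioo ⟨by linarith [Real.pi_pos], hlt⟩)
  have hsin : 0 < A * Real.sin (m * t) :=
    mul_pos hA (Real.sin_pos_of_pos_of_lt_pi hpos (by linarith [Real.pi_pos]))
  rcases Nat.even_or_odd m with he | he
  · rw [he.neg_one_pow, one_mul] at h1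
    have h2 := congrArg Complex.im h1
    rw [Complex.conj_im, him] at h2
    linarith
  · rw [he.neg_one_pow] at h1
    have h2 := congrArg Complex.re h1
    rw [neg_one_mul, Complex.neg_re, Complex.conj_re, hre] at h2
    linarith

/-- `∏ (1 + q z) ^ s` with principal powers. -/
noncomputable def rootProd (Q : Finset ℝ) (s : ℝ) (z : ℂ) : ℂ :=
  ∏ q ∈ Q, (1 + q * z) ^ (s : ℂ)

section rootProd

variable {Q : Finset ℝ} {z : ℂ}

theorem norm_ofReal_mul_lt_one {q : ℝ} (hq : 0 < q) (h : q * ‖z‖ < 1) : ‖(q : ℂ) * z‖ < 1 := by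
  rwa [norm_mul, Complex.norm_real, Real.norm_of_nonneg hq.le]

theorem one_add_mem_slitPlane {q : ℝ} (hq : 0 < q) (h : q * ‖z‖ < 1) :
    1 + (q : ℂ) * z ∈ Complex.slitPlane :=
  Complex.mem_slitPlane_of_norm_lt_one (norm_ofReal_mul_lt_one hq h)

theorem differentiableAt_rootProd (hQ : ∀ q ∈ Q, 0 < q) (h : ∀ q ∈ Q, q * ‖z‖ < 1) (s : ℝ) :
    DifferentiableAt ℂ (rootProd Q s) z := by
  unfold rootProd
  refine DifferentiableAt.fun_finsetProd fun q hq => ?_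
  refine DifferentiableAt.cpow (by fun_prop) (by fun_prop)
    (one_add_mem_slitPlane (hQ q hq) (h q hq))

theorem conj_rootProd (hQ : ∀ q ∈ Q, 0 < q) (h : ∀ q ∈ Q, q * ‖z‖ < 1) (s : ℝ) :
    rootProd Q s ((starRingEnd ℂ) z) = (starRingEnd ℂ) (rootProd Q s z) := by
  rw [rootProd, rootProd, map_prod]
  refine Finset.prod_congr rfl fun q hq => ?_
  have := Complex.slitPlane_arg_ne_pi (one_add_mem_slitPlane (hQ q hq) (h q hq))
  rw [show 1 + (q : ℂ) * (starRingEnd ℂ) z = (starRingEnd ℂ) (1 + q * z) by simp,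
    Complex.conj_cpow _ _ this, Complex.conj_ofReal]

theorem rootProd_mul (hQ : ∀ q ∈ Q, 0 < q) (h : ∀ q ∈ Q, q * ‖z‖ < 1) (s t : ℝ) :
    rootProd Q s z * rootProd Q t z = rootProd Q (s + t) z := by
  rw [rootProd, rootProd, rootProd, ← Finset.prod_mul_distrib]
  refine Finset.prod_congr rfl fun q hq => ?_
  rw [Complex.ofReal_add, Complex.cpow_add _ _
    (Complex.slitPlane_ne_zero (one_add_mem_slitPlane (hQ q hq) (h q hq)))]

theorem rootProd_zero (Q : Finset ℝ) (z : ℂ) : rootProd Q 0 z = 1 := by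
  simp [rootProd]

theorem rootProd_one (Q : Finset ℝ) (z : ℂ) : rootProd Q 1 z = ∏ q ∈ Q, (1 + q * z) := by
  simp [rootProd]

theorem rootProd_half_sq (hQ : ∀ q ∈ Q, 0 < q) (h : ∀ q ∈ Q, q * ‖z‖ < 1) :
    rootProd Q (1 / 2) z ^ 2 = ∏ q ∈ Q, (1 + q * z) := by
  rw [sq, rootProd_mul hQ h, ← rootProd_one]
  norm_num

theorem rootProd_neg_half_sq (hQ : ∀ q ∈ Q, 0 < q) (h : ∀ q ∈ Q, q * ‖z‖ < 1) :
    rootProd Q (-(1 / 2)) z ^ 2 = (∏ q ∈ Q, (1 + q * z))⁻¹ := by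
  refine eq_inv_of_mul_eq_one_left ?_
  rw [← rootProd_half_sq hQ h, ← mul_pow, rootProd_mul hQ h, neg_add_cancel, rootProd_zero,
    one_pow]

theorem prod_one_add_ne_zero (hQ : ∀ q ∈ Q, 0 < q) (h : ∀ q ∈ Q, q * ‖z‖ < 1) :
    ∏ q ∈ Q, (1 + (q : ℂ) * z) ≠ 0 :=
  Finset.prod_ne_zero_iff.2 fun q hq =>
    Complex.slitPlane_ne_zero (one_add_mem_slitPlane (hQ q hq) (h q hq))

end rootProd

end CardinalBSpline

/-! ### Powers of the symbol, and coefficient asymptotics of the wavelet symbol. -/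

namespace CardinalBSpline

/-- The power `(prodSymbol K Q z) ^ s`, holomorphic in an annulus about the unit circle. -/
noncomputable def symbolPow (K : ℝ) (Q : Finset ℝ) (s : ℝ) (z : ℂ) : ℂ :=
  ((K ^ s : ℝ) : ℂ) * (rootProd Q s z * rootProd Q s z⁻¹)

section symbolPow

variable {K r : ℝ} {Q : Finset ℝ} {z : ℂ}

theorem mul_norm_lt_one (hr0 : 0 < r) (hmax : ∀ q ∈ Q, q ≤ r) (hz : ‖z‖ < r⁻¹) :
    ∀ q ∈ Q, q * ‖z‖ < 1 := fun q hq => by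
  calc q * ‖z‖ ≤ r * ‖z‖ := mul_le_mul_of_nonneg_right (hmax q hq) (norm_nonneg z)
    _ < r * r⁻¹ := mul_lt_mul_of_pos_left hz hr0
    _ = 1 := mul_inv_cancel₀ hr0.ne'

theorem mul_norm_lt_one_of_norm_eq_one (hQ : ∀ q ∈ Q, 0 < q ∧ q < 1) (hz : ‖z‖ = 1) :
    ∀ q ∈ Q, q * ‖z‖ < 1 := fun q hq => by
  rw [hz, mul_one]; exact (hQ q hq).2

theorem symbolPow_inv (K : ℝ) (Q : Finset ℝ) (s : ℝ) (z : ℂ) :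
    symbolPow K Q s z⁻¹ = symbolPow K Q s z := by
  rw [symbolPow, symbolPow, inv_inv, mul_comm (rootProd Q s z⁻¹)]

theorem exists_hasLaurent_symbolPow (K : ℝ) (hQ : ∀ q ∈ Q, 0 < q) (hr0 : 0 < r)
    (hmax : ∀ q ∈ Q, q ≤ r) (s : ℝ) :
    ∃ a : ℤ → ℝ, HasLaurent a (symbolPow K Q s) (Set.Ioo r r⁻¹) := by
  obtain ⟨b, hb⟩ := exists_hasLaurent_of_differentiableOn (F := rootProd Q s) (R := r⁻¹)
    (fun z hz => (differentiableAt_rootProd hQ (mul_norm_lt_one hr0 hmax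
      (by simpa using hz)) s).differentiableWithinAt)
    (fun z hz => conj_rootProd hQ (mul_norm_lt_one hr0 hmax hz) s)
  refine ⟨_, (((hb.mono ?_).mul (hb.inv.mono ?_)).const_mul (K ^ s))⟩
  · exact fun ρ hρ => hρ.2
  · exact fun ρ hρ => (inv_lt_inv₀ (hr0.trans hρ.1) hr0).2 hρ.1

theorem symbolPow_mul (hK : 0 < K) (hQ : ∀ q ∈ Q, 0 < q ∧ q < 1) (hz : ‖z‖ = 1) (s t : ℝ) :
    symbolPow K Q s z * symbolPow K Q t z = symbolPow K Q (s + t) z := by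
  have hQ0 : ∀ q ∈ Q, 0 < q := fun q hq => (hQ q hq).1
  have h1 := mul_norm_lt_one_of_norm_eq_one hQ hz
  have h2 := mul_norm_lt_one_of_norm_eq_one (z := z⁻¹) hQ (by rw [norm_inv, hz, inv_one])
  rw [symbolPow, symbolPow, symbolPow, ← rootProd_mul hQ0 h1, ← rootProd_mul hQ0 h2,
    Real.rpow_add hK]
  push_cast
  ring

theorem symbolPow_zero (K : ℝ) (Q : Finset ℝ) (z : ℂ) : symbolPow K Q 0 z = 1 := by
  simp [symbolPow, rootProd_zero]

theorem symbolPow_one (K : ℝ) (Q : Finset ℝ) (z : ℂ) : symbolPow K Q 1 z = prodSymbol K Q z := by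
  rw [symbolPow, rootProd_one, rootProd_one, ← Finset.prod_mul_distrib, Real.rpow_one, prodSymbol]

theorem exists_pos_symbolPow_eq (hK : 0 < K) (hQ : ∀ q ∈ Q, 0 < q ∧ q < 1) (hz : ‖z‖ = 1) (s : ℝ) :
    ∃ x : ℝ, 0 < x ∧ symbolPow K Q s z = x := by
  have hQ0 : ∀ q ∈ Q, 0 < q := fun q hq => (hQ q hq).1
  have h1 := mul_norm_lt_one_of_norm_eq_one hQ hz
  have hne : rootProd Q s z ≠ 0 := by
    intro h
    have := rootProd_mul hQ0 h1 s (-s)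
    rw [h, zero_mul, add_neg_cancel, rootProd_zero] at this
    exact zero_ne_one this
  refine ⟨K ^ s * Complex.normSq (rootProd Q s z),
    mul_pos (Real.rpow_pos_of_pos hK s) (Complex.normSq_pos.2 hne), ?_⟩
  rw [symbolPow, Complex.inv_eq_conj hz, conj_rootProd hQ0 h1, Complex.mul_conj]
  push_cast
  rfl

end symbolPow

section Laurent

variable {k : ℕ} {K r : ℝ} {Q : Finset ℝ}

/-- The power law shows that the square of the left side inverts P, and positivity on the unit
circle selects the root. -/
theorem symbolPow_half_exp (hK : 0 < K) (hQ : ∀ q ∈ Q, 0 < q ∧ q < 1)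
    (hP : ∀ θ : ℝ, (symbolP (k + 1) θ : ℂ) = prodSymbol K Q (Complex.exp (θ * Complex.I)))
    (θ : ℝ) : 0 < symbolP (k + 1) θ ∧
      symbolPow K Q (-(1 / 2)) (Complex.exp (θ * Complex.I)) =
        ((√(symbolP (k + 1) θ))⁻¹ : ℝ) := by
  have hz := Complex.norm_exp_ofReal_mul_I θ
  obtain ⟨x, hx, hxe⟩ := exists_pos_symbolPow_eq hK hQ hz (-(1 / 2))
  have h1 := symbolPow_mul hK hQ hz (-(1 / 2)) (-(1 / 2))
  have h2 := symbolPow_mul hK hQ hz (-(1 / 2) + -(1 / 2)) 1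
  rw [show (-(1 / 2) + -(1 / 2) + 1 : ℝ) = 0 by norm_num, symbolPow_zero, symbolPow_one, ← h1, hxe,
    ← hP] at h2
  have h3 : x * x * symbolP (k + 1) θ = 1 := by exact_mod_cast h2
  have h4 : symbolP (k + 1) θ = x⁻¹ ^ 2 := by
    field_simp
    linear_combination h3
  refine ⟨by rw [h4]; positivity, ?_⟩
  rw [hxe, h4, Real.sqrt_sq (by positivity), inv_inv]

theorem continuous_inv_sqrt_symbolP (hK : 0 < K) (hQ : ∀ q ∈ Q, 0 < q ∧ q < 1)
    (hP : ∀ θ : ℝ, (symbolP (k + 1) θ : ℂ) = prodSymbol K Q (Complex.exp (θ * Complex.I))) :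
    Continuous fun θ => (√(symbolP (k + 1) θ))⁻¹ := by
  have h1 : Continuous (symbolP (k + 1)) := by
    have h2 : symbolP (k + 1) = fun θ : ℝ =>
        (prodSymbol K Q (Complex.exp (θ * Complex.I))).re := by
      funext θ
      rw [← hP, Complex.ofReal_re]
    rw [h2]
    simp only [prodSymbol, ← Complex.exp_neg]
    fun_prop
  exact h1.sqrt.inv₀ fun θ => (Real.sqrt_pos.2 (symbolPow_half_exp hK hQ hP θ).1).ne'

theorem hasLaurent_coeffC (hK : 0 < K) (hQ : ∀ q ∈ Q, 0 < q ∧ q < 1) (hr0 : 0 < r) (hr1 : r < 1)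
    (hmax : ∀ q ∈ Q, q ≤ r)
    (hP : ∀ θ : ℝ, (symbolP (k + 1) θ : ℂ) = prodSymbol K Q (Complex.exp (θ * Complex.I))) :
    HasLaurent (coeffC (k + 1)) (symbolPow K Q (-(1 / 2))) (Set.Ioo r r⁻¹) := by
  obtain ⟨a, ha⟩ := exists_hasLaurent_symbolPow K (fun q hq => (hQ q hq).1) hr0 hmax (-(1 / 2))
  have h1 : a = coeffC (k + 1) := by
    funext n
    rw [ha.coeff_eq_integral_cos ⟨hr1, (one_lt_inv₀ hr0).2 hr1⟩
      (fun θ => (symbolPow_half_exp hK hQ hP θ).2) (continuous_inv_sqrt_symbolP hK hQ hP) n, coeffC]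
    simp only [div_eq_mul_inv]
  rwa [← h1]

/-- The symbol `(1 - z)ᵐ √(P(-z) / (P(z) P(z²)))` without the singular factor `√(1 + r z²)` and
without its constant. -/
noncomputable def regularPart (m : ℕ) (Q : Finset ℝ) (r : ℝ) (z : ℂ) : ℂ :=
  ((1 - z) ^ m * rootProd Q (1 / 2) (-z) * rootProd Q (-(1 / 2)) z *
      rootProd (Q.erase r) (-(1 / 2)) (z ^ 2)) *
    (rootProd Q (1 / 2) (-z⁻¹) * rootProd Q (-(1 / 2)) z⁻¹ *
      rootProd Q (-(1 / 2)) (z⁻¹ ^ 2))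

/-- The circle of radius R encloses the singularities ±i r^{-1/2}, but neither those of P(±z)^{±1/2}
outside the unit circle nor those of P(z²)^{-1/2} there that come from the other q. -/
theorem exists_radius (hQ : ∀ q ∈ Q, 0 < q ∧ q < 1) (hr : r ∈ Q) (hmax : ∀ q ∈ Q, q ≤ r) :
    ∃ R : ℝ, 0 < R ∧ r⁻¹ < R ^ 2 ∧ R < r⁻¹ ∧ ∀ q ∈ Q.erase r, q * R ^ 2 < 1 := by
  have hr01 := hQ r hr
  have hri : 0 < r⁻¹ := inv_pos.2 hr01.1
  have h1 : ∀ᶠ x in 𝓝[>] r⁻¹, x < r⁻¹ ^ 2 := by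
    refine mem_nhdsWithin_of_mem_nhds (Iio_mem_nhds ?_)
    have : 1 < r⁻¹ := (one_lt_inv₀ hr01.1).2 hr01.2
    nlinarith
  have h2 : ∀ᶠ x in 𝓝[>] r⁻¹, ∀ q ∈ Q.erase r, x < q⁻¹ := by
    rw [Finset.eventually_all]
    intro q hq
    refine mem_nhdsWithin_of_mem_nhds (Iio_mem_nhds ?_)
    have hq' := Finset.mem_erase.1 hq
    exact (inv_lt_inv₀ hr01.1 (hQ q hq'.2).1).2 ((hmax q hq'.2).lt_of_ne hq'.1)
  obtain ⟨x, h1, h2, h3⟩ := (h1.and (h2.and self_mem_nhdsWithin)).exists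
  have hx : 0 < x := hri.trans h3
  refine ⟨√x, Real.sqrt_pos.2 hx, by rwa [Real.sq_sqrt hx.le], ?_, fun q hq => ?_⟩
  · rwa [Real.sqrt_lt' hri]
  · rw [Real.sq_sqrt hx.le]
    have hq0 := (hQ q (Finset.mem_erase.1 hq).2).1
    have := mul_lt_mul_of_pos_left (h2 q hq) hq0
    rwa [mul_inv_cancel₀ hq0.ne'] at this

/-- The first bracket of `regularPart` is holomorphic for |z| < R. The second is holomorphic in 1/z
for |1/z| < r^{-1/2}, which covers |z| ≥ 1; there r need not be removed. -/
theorem exists_hasLaurent_regularPart (m : ℕ) (hQ : ∀ q ∈ Q, 0 < q ∧ q < 1) (hr : r ∈ Q)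
    (hmax : ∀ q ∈ Q, q ≤ r) {R : ℝ} (hR1 : R < r⁻¹)
    (hR2 : ∀ q ∈ Q.erase r, q * R ^ 2 < 1) :
    ∃ g : ℤ → ℝ, HasLaurent g (regularPart m Q r) (Set.Ico 1 R) := by
  have hr01 := hQ r hr
  have hQ0 : ∀ q ∈ Q, 0 < q := fun q hq => (hQ q hq).1
  have hQe : ∀ q ∈ Q.erase r, 0 < q := fun q hq => hQ0 q (Finset.mem_erase.1 hq).2
  have hlt : ∀ {z : ℂ} {R : ℝ}, R < r⁻¹ → ‖z‖ < R → ∀ q ∈ Q, q * ‖z‖ < 1 := fun h hz =>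
    mul_norm_lt_one hr01.1 hmax (hz.trans h)
  have hlte : ∀ {z : ℂ}, ‖z‖ < R → ∀ q ∈ Q.erase r, q * ‖z ^ 2‖ < 1 := fun {z} hz q hq => by
    refine lt_of_le_of_lt (mul_le_mul_of_nonneg_left ?_ (hQe q hq).le) (hR2 q hq)
    rw [norm_pow]
    exact pow_le_pow_left₀ (norm_nonneg z) hz.le 2
  obtain ⟨R', hR'1, hR'2, hR'r⟩ : ∃ R' : ℝ, 1 < R' ∧ R' ^ 2 = r⁻¹ ∧ R' < r⁻¹ := by
    have h1 : 1 < r⁻¹ := (one_lt_inv₀ hr01.1).2 hr01.2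
    refine ⟨√(r⁻¹), ?_, Real.sq_sqrt (by linarith), ?_⟩
    · rwa [Real.lt_sqrt zero_le_one, one_pow]
    · rw [Real.sqrt_lt' (by linarith)]
      nlinarith
  have hlt2 : ∀ {z : ℂ}, ‖z‖ < R' → ∀ q ∈ Q, q * ‖z ^ 2‖ < 1 := fun {z} hz =>
    mul_norm_lt_one hr01.1 hmax (by
      rw [norm_pow, ← hR'2]
      exact pow_lt_pow_left₀ hz (norm_nonneg z) two_ne_zero)
  have hneg : ∀ {z : ℂ}, (∀ q ∈ Q, q * ‖z‖ < 1) → ∀ q ∈ Q, q * ‖-z‖ < 1 := fun h => by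
    simpa only [norm_neg] using h
  obtain ⟨a, ha⟩ := exists_hasLaurent_of_differentiableOn (R := R)
    (F := fun z => (1 - z) ^ m * rootProd Q (1 / 2) (-z) * rootProd Q (-(1 / 2)) z *
      rootProd (Q.erase r) (-(1 / 2)) (z ^ 2))
    (fun z hz => by
      have hz : ‖z‖ < R := by simpa using hz
      have d1 := (differentiableAt_rootProd hQ0 (hneg (hlt hR1 hz)) (1 / 2)).comp z
        differentiableAt_id.neg
      have d2 := differentiableAt_rootProd hQ0 (hlt hR1 hz) (-(1 / 2))
      have d3 := DifferentiableAt.comp (f := fun w : ℂ => w ^ 2) z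
        (differentiableAt_rootProd hQe (hlte hz) (-(1 / 2))) (by fun_prop)
      have d0 : DifferentiableAt ℂ (fun z : ℂ => (1 - z) ^ m) z := by fun_prop
      exact (((d0.mul d1).mul d2).mul d3).differentiableWithinAt)
    (fun z hz => by
      simp only [map_mul, map_pow, map_sub, map_one]
      rw [← map_neg, ← map_pow, conj_rootProd hQ0 (hneg (hlt hR1 hz)),
        conj_rootProd hQ0 (hlt hR1 hz), conj_rootProd hQe (hlte hz)])
  obtain ⟨b, hb⟩ := exists_hasLaurent_of_differentiableOn (R := R')
    (F := fun z => rootProd Q (1 / 2) (-z) * rootProd Q (-(1 / 2)) z *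
      rootProd Q (-(1 / 2)) (z ^ 2))
    (fun z hz => by
      have hz : ‖z‖ < R' := by simpa using hz
      have d1 := (differentiableAt_rootProd hQ0 (hneg (hlt hR'r hz)) (1 / 2)).comp z
        differentiableAt_id.neg
      have d2 := differentiableAt_rootProd hQ0 (hlt hR'r hz) (-(1 / 2))
      have d3 := DifferentiableAt.comp (f := fun w : ℂ => w ^ 2) z
        (differentiableAt_rootProd hQ0 (hlt2 hz) (-(1 / 2))) (by fun_prop)
      exact ((d1.mul d2).mul d3).differentiableWithinAt)
    (fun z hz => by
      simp only [map_mul]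
      rw [← map_neg, ← map_pow, conj_rootProd hQ0 (hneg (hlt hR'r hz)),
        conj_rootProd hQ0 (hlt hR'r hz), conj_rootProd hQ0 (hlt2 hz)])
  refine ⟨conv a fun n => b (-n), ((ha.mono ?_).mul (hb.inv.mono ?_)).congr fun z _ _ => ?_⟩
  · exact fun ρ hρ => hρ.2
  · exact fun ρ hρ => lt_of_le_of_lt (inv_le_one_of_one_le₀ hρ.1) hR'1
  · rfl

theorem symbol_eq_invSqrt_mul_regularPart (m : ℕ) (hK : 0 < K) (hr : r ∈ Q) (z : ℂ) :
    (1 - z) ^ m * symbolPow K Q (1 / 2) (-z) * symbolPow K Q (-(1 / 2)) (z ^ 2) *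
        symbolPow K Q (-(1 / 2)) z =
      ((K ^ (-(1 / 2) : ℝ) : ℝ) : ℂ) *
        ((1 + r * z ^ 2) ^ (-(1 / 2) : ℂ) * regularPart m Q r z) := by
  have h1 : rootProd Q (-(1 / 2)) (z ^ 2) =
      (1 + r * z ^ 2) ^ (-(1 / 2) : ℂ) * rootProd (Q.erase r) (-(1 / 2)) (z ^ 2) := by
    rw [rootProd, ← Finset.mul_prod_erase Q _ hr, rootProd]
    push_cast
    rfl
  have h2 : ((K ^ (1 / 2 : ℝ) : ℝ) : ℂ) * ((K ^ (-(1 / 2) : ℝ) : ℝ) : ℂ) = 1 := by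
    rw [← Complex.ofReal_mul, ← Real.rpow_add hK, add_neg_cancel, Real.rpow_zero,
      Complex.ofReal_one]
  simp only [symbolPow, regularPart, h1, inv_neg, inv_pow]
  linear_combination ((1 - z) ^ m * rootProd Q (1 / 2) (-z) * rootProd Q (-(1 / 2)) z *
      rootProd (Q.erase r) (-(1 / 2)) (z ^ 2)) *
    (rootProd Q (1 / 2) (-z⁻¹) * rootProd Q (-(1 / 2)) z⁻¹ *
      rootProd Q (-(1 / 2)) ((z ^ 2)⁻¹)) * (1 + r * z ^ 2) ^ (-(1 / 2) : ℂ) *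
      ((K ^ (-(1 / 2) : ℝ) : ℝ) : ℂ) * h2

/-- Squaring removes the roots: G(z)² is (1 - z)^{2m} P(-z)/P(z) times a factor even in z. Equality
would mean (1 - z)^{2m} P(-z)² = (1 + z)^{2m} P(z)². Since P(z²) = 0, the two-scale relation gives
(1 + z)^{4m} P(z)² = (1 - z)^{4m} P(-z)², and together these yield (1 + z)^{2m} = (1 - z)^{2m}. -/
theorem regularPart_sq_ne {m : ℕ} (hm : 1 ≤ m) (hK : 0 < K) (hQ : ∀ q ∈ Q, 0 < q ∧ q < 1)
    (htwo : ∀ z : ℂ, z ≠ 0 → 4 ^ m * prodSymbol K Q (z ^ 2) =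
      (2 + z + z⁻¹) ^ m * prodSymbol K Q z + (2 - z - z⁻¹) ^ m * prodSymbol K Q (-z))
    (hr : r ∈ Q) (hmax : ∀ q ∈ Q, q ≤ r) {y : ℝ} (hy : 0 < y) (hyr : r * y ^ 2 = 1) :
    regularPart m Q r (Complex.I * y) ^ 2 ≠ regularPart m Q r (-(Complex.I * y)) ^ 2 := by
  have hr01 := hQ r hr
  have hy1 := one_lt_of_mul_sq_eq_one hr01.1 hr01.2 hy hyr
  have hne := one_add_pow_ne_one_sub_pow hm hK hQ htwo hr hmax hy hyr
  set z := Complex.I * (y : ℂ) with hz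
  have hz0 : z ≠ 0 := mul_ne_zero Complex.I_ne_zero (Complex.ofReal_ne_zero.2 hy.ne')
  have hnz : ‖z‖ = y := by
    rw [hz, norm_mul, Complex.norm_I, one_mul, Complex.norm_real, Real.norm_of_nonneg hy.le]
  have hz2 : z ^ 2 = -(y : ℂ) ^ 2 := by rw [hz, mul_pow, Complex.I_sq]; ring
  have hQ0 : ∀ q ∈ Q, 0 < q := fun q hq => (hQ q hq).1
  have hQe : ∀ q ∈ Q.erase r, 0 < q := fun q hq => hQ0 q (Finset.mem_erase.1 hq).2
  have b1 : ∀ q ∈ Q, q * ‖z‖ < 1 := fun q hq => by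
    rw [hnz]
    have := mul_le_mul_of_nonneg_right (hmax q hq) hy.le
    nlinarith
  have b1' : ∀ q ∈ Q, q * ‖-z‖ < 1 := by simpa only [norm_neg] using b1
  have hzi : ‖z⁻¹‖ < 1 := by rw [norm_inv, hnz]; exact inv_lt_one_of_one_lt₀ hy1
  have b2 : ∀ q ∈ Q, q * ‖z⁻¹‖ < 1 := fun q hq => by
    have := hQ q hq
    nlinarith [norm_nonneg z⁻¹]
  have b2' : ∀ q ∈ Q, q * ‖-z⁻¹‖ < 1 := by simpa only [norm_neg] using b2
  have b3 : ∀ q ∈ Q, q * ‖z⁻¹ ^ 2‖ < 1 := fun q hq => by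
    rw [norm_pow]
    have := hQ q hq
    have h2 : ‖z⁻¹‖ ^ 2 ≤ 1 := pow_le_one₀ (norm_nonneg _) hzi.le
    nlinarith
  have b4 : ∀ q ∈ Q.erase r, q * ‖z ^ 2‖ < 1 := fun q hq => by
    have hq' := Finset.mem_erase.1 hq
    have h1 := (hmax q hq'.2).lt_of_ne hq'.1
    rw [norm_pow, hnz, ← hyr]
    exact mul_lt_mul_of_pos_right h1 (by positivity)
  set A := ∏ q ∈ Q, (1 + (q : ℂ) * z) with hA
  set A' := ∏ q ∈ Q, (1 + (q : ℂ) * -z) with hA'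
  set B := ∏ q ∈ Q, (1 + (q : ℂ) * z⁻¹) with hB
  set B' := ∏ q ∈ Q, (1 + (q : ℂ) * -z⁻¹) with hB'
  set V := (∏ q ∈ Q.erase r, (1 + (q : ℂ) * z ^ 2))⁻¹ * (∏ q ∈ Q, (1 + (q : ℂ) * z⁻¹ ^ 2))⁻¹
    with hV
  have hA0 : A ≠ 0 := prod_one_add_ne_zero hQ0 b1
  have hA0' : A' ≠ 0 := prod_one_add_ne_zero hQ0 b1'
  have hB0 : B ≠ 0 := prod_one_add_ne_zero hQ0 b2
  have hB0' : B' ≠ 0 := prod_one_add_ne_zero hQ0 b2'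
  have hV0 : V ≠ 0 := mul_ne_zero (inv_ne_zero (prod_one_add_ne_zero hQe b4))
    (inv_ne_zero (prod_one_add_ne_zero hQ0 b3))
  have hG1 : regularPart m Q r z ^ 2 = (1 - z) ^ (2 * m) * A' * A⁻¹ * (B' * B⁻¹) * V := by
    rw [regularPart]
    simp only [mul_pow]
    rw [rootProd_half_sq hQ0 b1', rootProd_half_sq hQ0 b2', rootProd_neg_half_sq hQ0 b1,
      rootProd_neg_half_sq hQ0 b2, rootProd_neg_half_sq hQe b4, rootProd_neg_half_sq hQ0 b3,
      ← pow_mul, mul_comm m 2]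
    ring
  have hG2 : regularPart m Q r (-z) ^ 2 = (1 + z) ^ (2 * m) * A * A'⁻¹ * (B * B'⁻¹) * V := by
    rw [regularPart]
    simp only [mul_pow, neg_neg, inv_neg, neg_sq, sub_neg_eq_add]
    rw [rootProd_half_sq hQ0 b1, rootProd_half_sq hQ0 b2, rootProd_neg_half_sq hQ0 b1',
      rootProd_neg_half_sq hQ0 b2', rootProd_neg_half_sq hQe b4, rootProd_neg_half_sq hQ0 b3,
      ← pow_mul, mul_comm m 2]
    ring
  intro heq
  rw [hG1, hG2] at heq
  have h1 : (1 - z) ^ (2 * m) * (A' * B') ^ 2 = (1 + z) ^ (2 * m) * (A * B) ^ 2 := by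
    have := mul_right_cancel₀ hV0 heq
    field_simp at this
    linear_combination this
  have hP0 : prodSymbol K Q (z ^ 2) = 0 := by
    rw [prodSymbol]
    refine mul_eq_zero_of_right _ (Finset.prod_eq_zero hr (mul_eq_zero_of_left ?_ _))
    rw [hz2]
    have : (r : ℂ) * y ^ 2 = 1 := by exact_mod_cast hyr
    linear_combination -this
  have h2 := htwo z hz0
  rw [hP0, mul_zero] at h2
  have e1 : prodSymbol K Q z = K * (A * B) := by
    rw [prodSymbol, Finset.prod_mul_distrib]
  have e2 : prodSymbol K Q (-z) = K * (A' * B') := by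
    rw [prodSymbol, Finset.prod_mul_distrib, inv_neg]
  have e3 : 2 + z + z⁻¹ = (1 + z) ^ 2 / z := by field_simp; ring
  have e4 : 2 - z - z⁻¹ = -((1 - z) ^ 2 / z) := by field_simp; ring
  have hK' : (K : ℂ) ≠ 0 := Complex.ofReal_ne_zero.2 hK.ne'
  have hzm : z ^ m ≠ 0 := pow_ne_zero m hz0
  have h3 : (1 + z) ^ (2 * m) * (A * B) = -((-1) ^ m * ((1 - z) ^ (2 * m) * (A' * B'))) := by
    rw [e1, e2, e3, e4, neg_pow ((1 - z) ^ 2 / z), div_pow, div_pow, ← pow_mul, ← pow_mul] at h2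
    refine mul_left_cancel₀ (div_ne_zero hK' hzm) ?_
    linear_combination -h2
  have h4 : ((1 + z) ^ (2 * m) * (A * B)) ^ 2 = ((1 - z) ^ (2 * m) * (A' * B')) ^ 2 := by
    rw [h3, neg_sq, mul_pow ((-1) ^ m), ← pow_mul, mul_comm m 2, pow_mul]
    norm_num
  have hA1 : (1 + z) ^ (2 * m) ≠ 0 := by
    refine pow_ne_zero _ fun h => ?_
    have := congrArg Complex.re h
    simp [hz] at this
  have h5 : (1 + z) ^ (2 * m) * (A * B) ^ 2 * (1 + z) ^ (2 * m) =
      (1 + z) ^ (2 * m) * (A * B) ^ 2 * (1 - z) ^ (2 * m) := by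
    linear_combination h4 + (1 - z) ^ (2 * m) * h1
  exact hne (mul_left_cancel₀ (mul_ne_zero hA1 (pow_ne_zero 2 (mul_ne_zero hA0 hB0))) h5)

/-- Coefficient asymptotics of the symbol `(1 - z)ᵐ √(P(-z) / (P(z) P(z²)))`. -/
theorem exists_hasLaurent_tendsto {m : ℕ} (hm : 1 ≤ m) (hK : 0 < K)
    (hQ : ∀ q ∈ Q, 0 < q ∧ q < 1)
    (htwo : ∀ z : ℂ, z ≠ 0 → 4 ^ m * prodSymbol K Q (z ^ 2) =
      (2 + z + z⁻¹) ^ m * prodSymbol K Q z + (2 - z - z⁻¹) ^ m * prodSymbol K Q (-z))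
    (hr : r ∈ Q) (hmax : ∀ q ∈ Q, q ≤ r) :
    ∃ h : ℤ → ℝ, HasLaurent h (fun z => (1 - z) ^ m * symbolPow K Q (1 / 2) (-z) *
        symbolPow K Q (-(1 / 2)) (z ^ 2) * symbolPow K Q (-(1 / 2)) z) {1} ∧
      ∀ s : ℤ, ∃ L : ℝ, L ≠ 0 ∧
        Tendsto (fun n : ℕ => h (2 * n + s) / invSqrtCoeff r n) atTop (𝓝 L) := by
  have hr01 := hQ r hr
  obtain ⟨R, hR0, hRr, hR1, hR2⟩ := exists_radius hQ hr hmax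
  obtain ⟨g, hg⟩ := exists_hasLaurent_regularPart m hQ hr hmax hR1 hR2
  have h1r : 1 < r⁻¹ := (one_lt_inv₀ hr01.1).2 hr01.2
  have h1R : 1 < R := by nlinarith
  refine ⟨fun n => K ^ (-(1 / 2) : ℝ) * conv (upsample (invSqrtCoeff r)) g n, ?_, fun s => ?_⟩
  · have h1 := ((((hasLaurent_invSqrtCoeff hr01.1).upsample).mono (J := {1}) ?_).mul
      (hg.mono (J := {1}) ?_)).const_mul (K ^ (-(1 / 2) : ℝ))
    · exact h1.congr fun z _ _ => (symbol_eq_invSqrt_mul_regularPart m hK hr z).symm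
    · rintro _ rfl
      simpa using h1r
    · rintro _ rfl
      exact ⟨le_rfl, h1R⟩
  · have hy : 0 < √(r⁻¹) := Real.sqrt_pos.2 (by positivity)
    have hyr : r * √(r⁻¹) ^ 2 = 1 := by
      rw [Real.sq_sqrt (by positivity), mul_inv_cancel₀ hr01.1.ne']
    obtain ⟨L, hL, ht⟩ := tendsto_conv_upsample_invSqrtCoeff hr01.1 hr01.2 hR0 hRr hg
      (z := Complex.I * √(r⁻¹)) (by
        rw [mul_pow, Complex.I_sq, ← Complex.ofReal_pow, Real.sq_sqrt (by positivity)]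
        push_cast
        ring) (regularPart_sq_ne hm hK hQ htwo hr hmax hy hyr) s
    refine ⟨K ^ (-(1 / 2) : ℝ) * L, mul_ne_zero (Real.rpow_pos_of_pos hK _).ne' hL, ?_⟩
    refine (ht.const_mul _).congr fun n => ?_
    rw [mul_div_assoc]

end Laurent

end CardinalBSpline

/-! ### Refinement and convolution of B-spline series. -/

namespace CardinalBSpline

/-- The coefficients of the two-scale relation of the B-spline of order `k + 1`. -/
noncomputable def refineSeq (k : ℕ) (j : ℤ) : ℝ :=
  if 0 ≤ j then (2 ^ k)⁻¹ * ((k + 1).choose j.toNat : ℝ) else 0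

theorem hasSum_refineSeq_smul {E : Type*} [AddCommMonoid E] [Module ℝ E] [TopologicalSpace E]
    (k : ℕ) (f : ℤ → E) :
    HasSum (fun j => refineSeq k j • f j)
      (∑ n ∈ Finset.range (k + 2), ((2 ^ k)⁻¹ * ((k + 1).choose n : ℝ)) • f n) := by
  refine (Function.Injective.hasSum_iff (g := fun n : ℕ => (n : ℤ)) Nat.cast_injective
    fun j hj => ?_).1 ?_
  · have : ¬ 0 ≤ j := fun h => hj ⟨j.toNat, Int.toNat_of_nonneg h⟩
    rw [refineSeq, if_neg this, zero_smul]
  · have h1 : ∀ n : ℕ, refineSeq k n = (2 ^ k)⁻¹ * ((k + 1).choose n : ℝ) := fun n => by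
      simp [refineSeq]
    have h2 : ((fun j => refineSeq k j • f j) ∘ fun n : ℕ => (n : ℤ)) =
        fun n : ℕ => ((2 ^ k)⁻¹ * ((k + 1).choose n : ℝ)) • f n := by
      funext n
      simp only [Function.comp, h1]
    rw [h2]
    refine hasSum_sum_of_ne_finset_zero fun n hn => ?_
    rw [Nat.choose_eq_zero_of_lt (not_le.1 fun h => hn (Finset.mem_range.2 (by omega)))]
    simp

theorem hasLaurent_refineSeq (k : ℕ) :
    HasLaurent (refineSeq k) (fun z => (2 ^ k)⁻¹ * (1 + z) ^ (k + 1)) {1} := by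
  intro z _ _
  convert! hasSum_refineSeq_smul k (fun j : ℤ => z ^ j) using 1
  · beta_reduce
    rw [add_comm 1 z, add_pow, Finset.mul_sum]
    refine Finset.sum_congr rfl fun n _ => ?_
    rw [Complex.real_smul]
    push_cast
    simp only [one_pow, zpow_natCast]
    ring

theorem summable_abs_bspline_shift (n : ℕ) (x : ℝ) :
    Summable fun l : ℤ => |bspline n (x - l)| := by
  simpa using (summable_mul_bspline n x 1).abs

theorem tsum_mul_bspline_eq_tsum_conv (k : ℕ) {c : ℤ → ℝ} (hc : Summable fun j => |c j|) (x : ℝ) :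
    ∑' j : ℤ, c j * bspline (k + 1) (x - j) =
      ∑' l : ℤ, conv (upsample c) (refineSeq k) l * bspline (k + 1) (2 * x - l) := by
  have hbd : ∀ j, |upsample c j| ≤ ∑' i, |c i| := fun j => by
    rw [upsample]
    split_ifs
    · exact hc.le_tsum (j / 2) fun i _ => abs_nonneg _
    · rw [abs_zero]
      exact tsum_nonneg fun i => abs_nonneg _
  have h1 := hasSum_mul_tsum_mul_of_summable hbd
    ((hasLaurent_refineSeq k).summable_abs rfl) (summable_abs_bspline_shift (k + 1) (2 * x))
  have h2 : ∀ i : ℤ, ∑' l : ℤ, refineSeq k l * bspline (k + 1) (2 * x - ((2 * i + l : ℤ) : ℝ)) =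
      bspline (k + 1) (x - i) := fun i => by
    have h3 := (hasSum_refineSeq_smul k
      fun l : ℤ => bspline (k + 1) (2 * x - ((2 * i + l : ℤ) : ℝ))).tsum_eq
    simp only [smul_eq_mul] at h3
    rw [h3, bspline_two_scale, Finset.mul_sum]
    refine Finset.sum_congr rfl fun n _ => ?_
    rw [mul_assoc]
    congr 3
    push_cast
    ring
  rw [← h1.tsum_eq]
  refine (HasSum.tsum_eq ?_).symm
  refine (Function.Injective.hasSum_iff (g := fun l : ℤ => 2 * l)
    (fun a b h => by simpa using h) fun l hl => ?_).1 ?_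
  · rw [upsample, if_neg, zero_mul]
    rintro ⟨i, hi⟩
    exact hl ⟨i, by simp only; omega⟩
  · convert! (summable_mul_bspline (k + 1) x c).hasSum using 2 with i
    simp only [Function.comp, h2]
    rw [upsample, if_pos (even_two_mul i), Int.mul_ediv_cancel_left _ two_ne_zero]

theorem hasSum_mul_tsum_mul_bspline (n : ℕ) {a c : ℤ → ℝ} {C : ℝ} (ha : ∀ j, |a j| ≤ C)
    (hc : Summable fun j => |c j|) (x : ℝ) :
    HasSum (fun j : ℤ => a j * ∑' i : ℤ, c i * bspline n (x - j - i))
      (∑' l : ℤ, conv a c l * bspline n (x - l)) := by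
  convert! hasSum_mul_tsum_mul_of_summable ha hc (summable_abs_bspline_shift n x) using 7
  push_cast
  ring

theorem abs_le_sqrt_tsum_sq {a : ℤ → ℝ} (h : Summable fun j => a j ^ 2) (j : ℤ) :
    |a j| ≤ √(∑' i, a i ^ 2) :=
  Real.abs_le_sqrt (h.le_tsum j fun _ _ => sq_nonneg _)

theorem summable_sq_of_summable_abs {a : ℤ → ℝ} (h : Summable fun j => |a j|) :
    Summable fun j => a j ^ 2 := by
  refine Summable.of_nonneg_of_le (fun j => sq_nonneg _) (fun j => ?_) (h.mul_left (∑' i, |a i|))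
  rw [← sq_abs, sq]
  exact mul_le_mul_of_nonneg_right (h.le_tsum j fun i _ => abs_nonneg _) (abs_nonneg _)

theorem hasLaurent_single : HasLaurent (Pi.single 0 1) (fun _ => 1) {1} := by
  intro z _ _
  convert! hasSum_single (0 : ℤ) (f := fun j : ℤ => ((Pi.single 0 1 : ℤ → ℝ) j : ℂ) * z ^ j)
    fun j hj => by simp [hj] using 1
  simp

theorem conv_single (a : ℤ → ℝ) : conv a (Pi.single 0 1) = a := by
  funext n
  rw [conv, tsum_eq_single n fun k hk => by simp [sub_eq_zero, hk.symm]]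
  simp

/-- A summable convolution inverse of `c` also acts on bounded sequences, by `conv_assoc`. -/
theorem eq_zero_of_conv_eq_zero {e c g : ℤ → ℝ} {C : ℝ} (he : ∀ j, |e j| ≤ C)
    (hc : Summable fun j => |c j|) (hg : Summable fun j => |g j|)
    (hcg : conv c g = Pi.single 0 1) (h : conv e c = 0) : e = 0 := by
  rw [← conv_single e, ← hcg, ← conv_assoc he hc hg, h]
  funext n
  simp [conv]

end CardinalBSpline

/-! ### Scaling constants and B-spline coefficients of the wavelet. -/

namespace CardinalBSpline

section ScalingSequence

variable {k : ℕ} {a g : ℤ → ℝ}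

theorem hasSum_mul_scalingFunction (hc : Summable fun j => |coeffC (k + 1) j|) {C : ℝ}
    (ha : ∀ j, |a j| ≤ C) (x : ℝ) :
    HasSum (fun j : ℤ => a j * scalingFunction (k + 1) (x - j))
      (∑' l : ℤ, conv a (coeffC (k + 1)) l * bspline (k + 1) (x - l)) :=
  hasSum_mul_tsum_mul_bspline (k + 1) ha hc x

theorem isScalingSequence_of_conv_eq (hc : Summable fun j => |coeffC (k + 1) j|)
    (ha : Summable fun j => |a j|)
    (h : conv a (coeffC (k + 1)) = conv (upsample (coeffC (k + 1))) (refineSeq k)) :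
    IsScalingSequence (scalingFunction (k + 1)) a := by
  refine ⟨summable_sq_of_summable_abs ha, fun x => ?_⟩
  have h1 := hasSum_mul_scalingFunction hc
    (fun j => ha.le_tsum j fun _ _ => abs_nonneg _) (2 * x)
  rwa [h, ← tsum_mul_bspline_eq_tsum_conv k hc x] at h1

/-- The difference `e` of two solutions is bounded. Independence of the B-spline shifts kills its
convolution with `coeffC`, and inverting `coeffC` kills `e`. -/
theorem IsScalingSequence.unique (hc : Summable fun j => |coeffC (k + 1) j|)
    (hg : Summable fun j => |g j|) (hcg : conv (coeffC (k + 1)) g = Pi.single 0 1) {b : ℤ → ℝ}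
    (ha : IsScalingSequence (scalingFunction (k + 1)) a)
    (hb : IsScalingSequence (scalingFunction (k + 1)) b) : a = b := by
  have hbd : ∀ j, |(a - b) j| ≤ √(∑' i, a i ^ 2) + √(∑' i, b i ^ 2) := fun j =>
    (abs_sub _ _).trans (add_le_add (abs_le_sqrt_tsum_sq ha.1 j) (abs_le_sqrt_tsum_sq hb.1 j))
  refine sub_eq_zero.1 (eq_zero_of_conv_eq_zero hbd hc hg hcg ?_)
  refine eq_zero_of_hasSum_mul_bspline k _ _ (abs_conv_le hbd hc) fun x => ?_
  have h1 := hasSum_mul_scalingFunction hc hbd x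
  have h2 : HasSum (fun j : ℤ => (a - b) j * scalingFunction (k + 1) (x - j)) 0 := by
    have h3 := (ha.2 (x / 2)).sub (hb.2 (x / 2))
    rw [mul_div_cancel₀ x two_ne_zero, sub_self] at h3
    convert! h3 using 2 with j
    rw [Pi.sub_apply, sub_mul]
  rw [← h1.unique h2]
  exact (summable_mul_bspline (k + 1) x _).hasSum

theorem wavelet_eq_sum_activeIdx (hc : Summable fun j => |coeffC (k + 1) j|) {C : ℝ}
    (ha : ∀ j, |a j| ≤ C) (x : ℝ) :
    wavelet (scalingFunction (k + 1)) a x = ∑ j ∈ activeIdx (k + 1) x,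
      conv (fun j => (-1) ^ j * a (1 - j)) (coeffC (k + 1)) j * bspline (k + 1) (2 * x - j) := by
  have h1 := hasSum_mul_scalingFunction hc (a := fun j => (-1) ^ j * a (1 - j)) (C := C)
    (fun j => by rw [abs_mul, abs_zpow, abs_neg, abs_one, one_zpow, one_mul]; exact ha _) (2 * x)
  rw [wavelet, h1.tsum_eq]
  exact (hasSum_mul_bspline_of_mem (k + 1) le_rfl le_rfl _).tsum_eq

end ScalingSequence

section WaveletCoefficients

variable {k : ℕ} {K r : ℝ} {Q : Finset ℝ}

/-- The generating function of the B-spline coefficients of the wavelet, up to a monomial factor. -/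
noncomputable def waveletSymbol (m : ℕ) (K : ℝ) (Q : Finset ℝ) (z : ℂ) : ℂ :=
  (1 - z) ^ m * symbolPow K Q (1 / 2) (-z) * symbolPow K Q (-(1 / 2)) (z ^ 2) *
    symbolPow K Q (-(1 / 2)) z

theorem one_sub_inv_pow {z : ℂ} (hz : z ≠ 0) (m : ℕ) :
    (1 - z⁻¹) ^ m = (-1) ^ m * (z ^ (-(m : ℤ)) * (1 - z) ^ m) := by
  rw [zpow_neg, zpow_natCast, ← inv_pow, ← mul_pow, ← mul_pow]
  congr 1
  field_simp
  ring

theorem waveletSymbol_inv (m : ℕ) (K : ℝ) (Q : Finset ℝ) {z : ℂ} (hz : z ≠ 0) :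
    waveletSymbol m K Q z⁻¹ = (-1) ^ m * (z ^ (-(m : ℤ)) * waveletSymbol m K Q z) := by
  rw [waveletSymbol, waveletSymbol, one_sub_inv_pow hz, ← inv_neg, symbolPow_inv, inv_pow,
    symbolPow_inv, symbolPow_inv]
  ring

/-- P is invariant under z ↦ 1/z, so only (1 - z)^m contributes to the symmetry. This transfers the
asymptotics at +∞ to -∞. -/
theorem coeff_neg_of_hasLaurent_waveletSymbol {m : ℕ} {h : ℤ → ℝ}
    (hh : HasLaurent h (waveletSymbol m K Q) {1}) (n : ℤ) : h (-n) = (-1) ^ m * h (n + m) := by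
  have h1 := (hh.inv.mono (J := {1}) (by simp)).unique
    ((hh.shift (-(m : ℤ))).const_mul ((-1) ^ m)) rfl fun z hz => by
      rw [waveletSymbol_inv m K Q (norm_pos_iff.1 (hz ▸ one_pos))]
      push_cast
      rfl
  simpa using congrFun h1 n

/-- The scaling constants are built as the coefficients of 2^{-k} (1 + z)^{k+1} P(z)^{1/2}
P(z²)^{-1/2}. The map a_j ↦ (-1)^j a_{1-j} replaces z by -1/z and adds a monomial, which accounts
for the sign and the shift by k. -/
theorem exists_wavelet_coefficients (hK : 0 < K) (hQ : ∀ q ∈ Q, 0 < q ∧ q < 1)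
    (hP : ∀ θ : ℝ, (symbolP (k + 1) θ : ℂ) = prodSymbol K Q (Complex.exp (θ * Complex.I)))
    (hr : r ∈ Q) (hmax : ∀ q ∈ Q, q ≤ r) {h : ℤ → ℝ}
    (hh : HasLaurent h (waveletSymbol (k + 1) K Q) {1}) :
    ∃ a, IsScalingSequence (scalingFunction (k + 1)) a ∧
      (∀ b, IsScalingSequence (scalingFunction (k + 1)) b → b = a) ∧
      ∀ x, wavelet (scalingFunction (k + 1)) a x = ∑ j ∈ activeIdx (k + 1) x,
        ((-1) ^ k * (2 ^ k)⁻¹ * h (j + k)) * bspline (k + 1) (2 * x - j) := by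
  have hr01 := hQ r hr
  have h1mem : ({1} : Set ℝ) ⊆ Set.Ioo r r⁻¹ :=
    Set.singleton_subset_iff.2 ⟨hr01.2, (one_lt_inv₀ hr01.1).2 hr01.2⟩
  have hc := (hasLaurent_coeffC hK hQ hr01.1 hr01.2 hmax hP).mono h1mem
  obtain ⟨g, hg⟩ := exists_hasLaurent_symbolPow K (fun q hq => (hQ q hq).1) hr01.1 hmax (1 / 2)
  replace hg := hg.mono h1mem
  have hu := hc.upsample.mono (J := {1}) (by simp)
  have ha := ((hasLaurent_refineSeq k).mul hg).mul hu
  set a := conv (conv (refineSeq k) g) (upsample (coeffC (k + 1))) with ha_def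
  have hc1 := hc.summable_abs rfl
  have ha1 := ha.summable_abs rfl
  have hhalf : ∀ z : ℂ, ‖z‖ = 1 →
      symbolPow K Q (-(1 / 2)) z * symbolPow K Q (1 / 2) z = 1 := fun z hz => by
    rw [symbolPow_mul hK hQ hz, neg_add_cancel, symbolPow_zero]
  have hcg : conv (coeffC (k + 1)) g = Pi.single 0 1 :=
    (hc.mul hg).unique hasLaurent_single rfl hhalf
  have hac : conv a (coeffC (k + 1)) = conv (upsample (coeffC (k + 1))) (refineSeq k) :=
    (ha.mul hc).unique (hu.mul (hasLaurent_refineSeq k)) rfl fun z hz => by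
      linear_combination ((2 ^ k)⁻¹ * (1 + z) ^ (k + 1)) * symbolPow K Q (-(1 / 2)) (z ^ 2) *
        hhalf z hz
  have hsc := isScalingSequence_of_conv_eq hc1 ha1 hac
  refine ⟨a, hsc, fun b hb => hb.unique hc1 (hg.summable_abs rfl) hcg hsc, fun x => ?_⟩
  rw [wavelet_eq_sum_activeIdx hc1 (fun j => ha1.le_tsum j fun _ _ => abs_nonneg _) x]
  have hb := ((ha.inv.mono (J := {1}) (by simp)).shift 1).comp_neg.mul hc
  have hd := hb.unique ((hh.shift (-(k : ℤ))).const_mul ((-1) ^ k * (2 ^ k)⁻¹)) rfl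
    fun z hz => by
      have hz0 : z ≠ 0 := norm_pos_iff.1 (hz ▸ one_pos)
      have h2 : (1 + (-z)⁻¹) ^ (k + 1) =
          (-1) ^ (k + 1) * (z ^ (-((k + 1 : ℕ) : ℤ)) * (1 - z) ^ (k + 1)) := by
        rw [← one_sub_inv_pow hz0, inv_neg, sub_eq_add_neg]
      have h3 : z ^ (-(k : ℤ)) = z * z ^ (-((k + 1 : ℕ) : ℤ)) := by
        rw [← zpow_one_add₀ hz0]
        congr 1
        push_cast
        ring
      rw [waveletSymbol, h2, symbolPow_inv, inv_pow, neg_sq, symbolPow_inv, h3, zpow_one]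
      push_cast
      ring
  have hd' : ∀ j, conv (fun j => (-1) ^ j * a (1 - j)) (coeffC (k + 1)) j =
      (-1) ^ k * (2 ^ k)⁻¹ * h (j + k) := fun j => by
    have := congrFun hd j
    simp only [sub_neg_eq_add, neg_sub] at this
    exact this
  simp only [hd']

end WaveletCoefficients

end CardinalBSpline

/-! ### From coefficient asymptotics to the wavelet. -/

namespace CardinalBSpline

/-- Here √μ = (1 - r)/(2√r) and √(μ + 1) = (1 + r)/(2√r), so the quotient in `alphaOf` is 1/r. -/
theorem alphaOf_muOf_neg {r : ℝ} (hr0 : 0 < r) (hr1 : r < 1) :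
    alphaOf (muOf (-r)) = -Real.log r := by
  have hs : 0 < √r := Real.sqrt_pos.2 hr0
  have hsq : √r ^ 2 = r := Real.sq_sqrt hr0.le
  have h1 : muOf (-r) = ((1 - r) / (2 * √r)) ^ 2 := by
    rw [muOf, abs_neg, abs_of_pos hr0, div_pow, mul_pow, hsq]
    ring
  have h2 : muOf (-r) + 1 = ((1 + r) / (2 * √r)) ^ 2 := by
    rw [muOf, abs_neg, abs_of_pos hr0, div_pow, mul_pow, hsq]
    field_simp
    ring
  rw [alphaOf, h2, h1, Real.sqrt_sq (by positivity),
    Real.sqrt_sq (div_nonneg (by linarith) (by positivity)), ← Real.log_inv]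
  congr 1
  rw [← add_div, ← sub_div, div_div_div_cancel_right₀ (by positivity),
    show 1 + r + (1 - r) = 2 by ring, show 1 + r - (1 - r) = 2 * r by ring, div_mul_cancel_left₀
    two_ne_zero]

theorem tendsto_atTop_int_of_even_odd {α : Type*} {f : ℤ → α} {l : Filter α}
    (h : ∀ p : ℕ, p < 2 → Tendsto (fun n : ℕ => f (2 * n + p)) atTop l) : Tendsto f atTop l := by
  intro s hs
  obtain ⟨N, hN⟩ := eventually_atTop.1
    (((h 0 (by norm_num)).eventually hs).and ((h 1 (by norm_num)).eventually hs))
  refine mem_atTop_sets.2 ⟨2 * N, fun j hj => ?_⟩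
  obtain ⟨n, hn⟩ := Int.eq_ofNat_of_zero_le (show 0 ≤ j / 2 by omega)
  have h1 := hN n (by omega)
  rcases Int.emod_two_eq_zero_or_one j with hj | hj
  · rw [show j = 2 * n + (0 : ℕ) by omega]
    exact h1.1
  · rw [show j = 2 * n + (1 : ℕ) by omega]
    exact h1.2

theorem tendsto_cofinite_int_of_even_odd {α : Type*} {f : ℤ → α} {l : Filter α}
    (h : ∀ p : ℕ, p < 2 → Tendsto (fun n : ℕ => f (2 * n + p)) atTop l)
    (h' : ∀ p : ℕ, p < 2 → Tendsto (fun n : ℕ => f (-(2 * n + p))) atTop l) :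
    Tendsto f cofinite l := by
  rw [Int.cofinite_eq]
  refine tendsto_sup.2 ⟨?_, tendsto_atTop_int_of_even_odd h⟩
  have h1 := (tendsto_atTop_int_of_even_odd (f := fun j => f (-j)) h').comp
    tendsto_neg_atBot_atTop
  simpa [Function.comp_def] using h1

theorem rIdx_two_mul_add {p : ℕ} (hp : p < 2) (n : ℕ) : rIdx (2 * n + p) = n := by
  rw [rIdx]
  omega

theorem rIdx_neg (j : ℤ) : rIdx (-j) = rIdx j := by
  rw [rIdx, rIdx, Int.natAbs_neg]

theorem mainCoeff_two_mul_add (α : ℝ) (E : SignType → ZMod 2 → ℝ) {p n : ℕ} (hp : p < 2)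
    (hn : 0 < n) : mainCoeff α E (2 * n + p) =
      E 1 p * ((-1) ^ n * (Real.exp (-α * n) / √n)) := by
  have h1 : ((2 * n + p : ℤ) : ZMod 2) = p := by
    push_cast
    rw [show (2 : ZMod 2) = 0 from rfl, zero_mul, zero_add]
  rw [mainCoeff, rIdx_two_mul_add hp, h1, sign_pos (by omega)]
  ring

theorem mainCoeff_neg_two_mul_add (α : ℝ) (E : SignType → ZMod 2 → ℝ) {p n : ℕ} (hp : p < 2)
    (hn : 0 < n) : mainCoeff α E (-(2 * n + p)) =
      E (-1) p * ((-1) ^ n * (Real.exp (-α * n) / √n)) := by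
  have h1 : ((-(2 * n + p) : ℤ) : ZMod 2) = p := by
    push_cast
    rw [show (2 : ZMod 2) = 0 from rfl, zero_mul, zero_add, ZMod.neg_eq_self_mod_two]
  rw [mainCoeff, rIdx_neg, rIdx_two_mul_add hp, h1, sign_neg (by omega)]
  ring

theorem tendsto_div_mainCoeff {α : ℝ} {E : SignType → ZMod 2 → ℝ} {d : ℤ → ℝ}
    (hE : ∀ σ : SignType, σ ≠ 0 → ∀ p : ZMod 2, E σ p ≠ 0)
    (h : ∀ p : ℕ, p < 2 → Tendsto
      (fun n : ℕ => d (2 * n + p) / ((-1) ^ n * (Real.exp (-α * n) / √n))) atTop (𝓝 (E 1 p)))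
    (h' : ∀ p : ℕ, p < 2 → Tendsto
      (fun n : ℕ => d (-(2 * n + p)) / ((-1) ^ n * (Real.exp (-α * n) / √n))) atTop
        (𝓝 (E (-1) p))) :
    Tendsto (fun j => d j / mainCoeff α E j) cofinite (𝓝 1) := by
  refine tendsto_cofinite_int_of_even_odd (fun p hp => ?_) (fun p hp => ?_)
  · have h1 := (h p hp).div_const (E 1 p)
    rw [div_self (hE 1 (by decide) p)] at h1
    refine h1.congr' ((eventually_gt_atTop 0).mono fun n hn => ?_)
    beta_reduce
    rw [mainCoeff_two_mul_add α E hp hn, div_div, mul_comm (E 1 p)]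
  · have h1 := (h' p hp).div_const (E (-1) p)
    rw [div_self (hE (-1) (by decide) p)] at h1
    refine h1.congr' ((eventually_gt_atTop 0).mono fun n hn => ?_)
    beta_reduce
    rw [mainCoeff_neg_two_mul_add α E hp hn, div_div, mul_comm (E (-1) p)]

theorem abs_sub_le_of_mem_activeIdx {m : ℕ} {x : ℝ} {j : ℤ} (hj : j ∈ activeIdx m x) :
    |2 * x - j| ≤ m := by
  rw [activeIdx, Finset.mem_Icc, Int.ceil_le, Int.le_floor] at hj
  rw [abs_of_nonneg (by linarith)]
  linarith

theorem two_mul_abs_sub_le {m : ℕ} {x : ℝ} {j : ℤ} (hj : j ∈ activeIdx m x) :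
    2 * |x| - m ≤ |(j : ℝ)| := by
  have h1 := abs_sub_le_of_mem_activeIdx hj
  have h2 := abs_sub_abs_le_abs_sub (2 * x) j
  rw [abs_mul, abs_two] at h2
  linarith

theorem eventually_forall_mem_activeIdx (m : ℕ) {p : ℤ → Prop} (hp : ∀ᶠ j in cofinite, p j) :
    ∀ᶠ x : ℝ in cocompact ℝ, ∀ j ∈ activeIdx m x, p j := by
  obtain ⟨B, hB⟩ := ((eventually_cofinite.1 hp).image fun j : ℤ => |(j : ℝ)|).bddAbove
  have h1 := (tendsto_norm_cocompact_atTop (E := ℝ)).eventually_gt_atTop ((B + m) / 2)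
  refine h1.mono fun x hx j hj => ?_
  by_contra hpj
  have h2 : |(j : ℝ)| ≤ B := hB ⟨j, hpj, rfl⟩
  have h3 := two_mul_abs_sub_le hj
  rw [Real.norm_eq_abs] at hx
  linarith

/-- For |j| ≤ 1 one has r_j = 0, and division by √0 makes `mainCoeff` zero; a relative error makes
sense only beyond these indices. -/
theorem eventually_two_le_natAbs : ∀ᶠ j : ℤ in cofinite, 2 ≤ j.natAbs := by
  refine eventually_cofinite.2 ((Set.finite_Icc (-1 : ℤ) 1).subset fun j hj => ?_)
  simp only [Set.mem_ofPred_eq, Set.mem_Icc] at hj ⊢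
  omega

theorem mainCoeff_ne_zero {α : ℝ} {E : SignType → ZMod 2 → ℝ}
    (hE : ∀ σ : SignType, σ ≠ 0 → ∀ p : ZMod 2, E σ p ≠ 0) {j : ℤ} (hj : 2 ≤ j.natAbs) :
    mainCoeff α E j ≠ 0 := by
  have h1 : (0 : ℝ) < rIdx j := by
    rw [Nat.cast_pos, rIdx]
    omega
  have h2 : j ≠ 0 := by omega
  exact mul_ne_zero (mul_ne_zero (by simp) (hE _ (by simpa using h2) _))
    (div_pos (Real.exp_pos _) (Real.sqrt_pos.2 h1)).ne'

/-- Active indices lie within m of 2x, so r_j ≥ |x| - (m + 1)/2, which bounds the exponential. The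
lower bound on |x| turns this into r_j ≥ |x|/2 for the square root. -/
theorem abs_mainCoeff_le {α B : ℝ} (hα : 0 ≤ α) {E : SignType → ZMod 2 → ℝ}
    (hB : ∀ σ p, |E σ p| ≤ B) {m : ℕ} {x : ℝ} (hx : (m + 1 : ℝ) ≤ |x|) {j : ℤ}
    (hj : j ∈ activeIdx m x) :
    |mainCoeff α E j| ≤
      B * Real.exp (α * ((m + 1) / 2)) * √2 * (Real.exp (-α * |x|) / √|x|) := by
  have hB0 : 0 ≤ B := (abs_nonneg _).trans (hB 0 0)
  have h1 := two_mul_abs_sub_le hj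
  have h2 : |(j : ℝ)| ≤ 2 * rIdx j + 1 := by
    rw [← Int.cast_abs, Int.abs_eq_natAbs, Int.cast_natCast, rIdx]
    have : j.natAbs ≤ 2 * (j.natAbs / 2) + 1 := by omega
    exact_mod_cast this
  have hx0 : 0 < |x| := by linarith [(Nat.cast_nonneg m : (0 : ℝ) ≤ m)]
  have h3 : |x| - (m + 1) / 2 ≤ rIdx j := by linarith
  have h4 : |x| / 2 ≤ rIdx j := by linarith
  have h5 : Real.exp (-α * rIdx j) ≤ Real.exp (α * ((m + 1) / 2)) * Real.exp (-α * |x|) := by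
    rw [← Real.exp_add]
    refine Real.exp_le_exp.2 ?_
    nlinarith
  have h6 : (√(rIdx j : ℝ))⁻¹ ≤ √2 / √|x| := by
    rw [← Real.sqrt_div zero_le_two, ← Real.sqrt_inv]
    refine Real.sqrt_le_sqrt ?_
    rw [← inv_div]
    exact inv_anti₀ (by positivity) h4
  rw [mainCoeff, abs_mul, abs_mul, abs_pow, abs_neg, abs_one, one_pow, one_mul,
    abs_of_nonneg (by positivity : 0 ≤ Real.exp (-α * rIdx j) / √(rIdx j : ℝ)), div_eq_mul_inv]
  calc _ ≤ B * ((Real.exp (α * ((m + 1) / 2)) * Real.exp (-α * |x|)) * (√2 / √|x|)) := by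
        gcongr
        exact hB _ _
    _ = _ := by ring

theorem sum_activeIdx_bspline (n : ℕ) (x : ℝ) :
    ∑ j ∈ activeIdx (n + 1) x, bspline (n + 1) (2 * x - j) = 1 := by
  have h := hasSum_mul_bspline_of_mem (n + 1) (le_refl (2 * x)) le_rfl (fun _ => 1)
  simp only [one_mul] at h
  exact h.unique (hasSum_bspline_shifts n (2 * x))

/-- The active B-splines are nonnegative with sum 1, so the sum is a weighted average and inherits
any bound uniform over the active indices. -/
theorem isLittleO_sum_mainCoeff {α : ℝ} (hα : 0 ≤ α) (E : SignType → ZMod 2 → ℝ) (n : ℕ)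
    {ε : ℤ → ℝ} (hε : Tendsto ε cofinite (𝓝 0)) :
    (fun x : ℝ => ∑ j ∈ activeIdx (n + 1) x,
        mainCoeff α E j * ε j * bspline (n + 1) (2 * x - j))
      =o[cocompact ℝ] fun x : ℝ => Real.exp (-α * |x|) / √|x| := by
  obtain ⟨B, hB⟩ : ∃ B, ∀ σ p, |E σ p| ≤ B := by
    obtain ⟨B, hB⟩ := (Set.finite_range fun q : SignType × ZMod 2 => |E q.1 q.2|).bddAbove
    exact ⟨B, fun σ p => hB ⟨(σ, p), rfl⟩⟩
  have hB0 : 0 ≤ B := (abs_nonneg _).trans (hB 0 0)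
  set A := B * Real.exp (α * (((n + 1 : ℕ) + 1) / 2)) * √2 with hA
  have hA0 : 0 ≤ A := by positivity
  refine isLittleO_iff.2 fun δ hδ => ?_
  have h1 : ∀ᶠ j in cofinite, |ε j| ≤ δ / (A + 1) := by
    have := hε.eventually (Metric.closedBall_mem_nhds 0 (div_pos hδ (by positivity : 0 < A + 1)))
    simpa using this
  have h2 := (tendsto_norm_cocompact_atTop (E := ℝ)).eventually_ge_atTop ((n + 1 : ℕ) + 1 : ℝ)
  filter_upwards [eventually_forall_mem_activeIdx (n + 1) h1, h2] with x hx hx'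
  have hg : 0 ≤ Real.exp (-α * |x|) / √|x| := by positivity
  calc _ ≤ ∑ j ∈ activeIdx (n + 1) x,
        (A * (Real.exp (-α * |x|) / √|x|)) * (δ / (A + 1)) * bspline (n + 1) (2 * x - j) := by
        refine norm_sum_le_of_le _ fun j hj => ?_
        rw [norm_mul, norm_mul, Real.norm_eq_abs, Real.norm_eq_abs,
          Real.norm_of_nonneg (bspline_nonneg (n + 1) _)]
        exact mul_le_mul_of_nonneg_right (mul_le_mul (abs_mainCoeff_le hα hB hx' hj) (hx j hj)
          (abs_nonneg _) (by positivity)) (bspline_nonneg (n + 1) _)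
    _ = A * (δ / (A + 1)) * (Real.exp (-α * |x|) / √|x|) := by
        rw [← Finset.mul_sum, sum_activeIdx_bspline]
        ring
    _ ≤ δ * ‖Real.exp (-α * |x|) / √|x|‖ := by
        rw [Real.norm_of_nonneg hg]
        refine mul_le_mul_of_nonneg_right ?_ hg
        rw [mul_div_assoc', div_le_iff₀ (by positivity)]
        nlinarith

theorem exists_asymptotics_of_tendsto {α : ℝ} (hα : 0 ≤ α) {E : SignType → ZMod 2 → ℝ} (n : ℕ)
    (hE : ∀ σ : SignType, σ ≠ 0 → ∀ p : ZMod 2, E σ p ≠ 0) {d : ℤ → ℝ}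
    (hd : Tendsto (fun j => d j / mainCoeff α E j) cofinite (𝓝 1)) {ψ : ℝ → ℝ}
    (hψ : ∀ x, ψ x = ∑ j ∈ activeIdx (n + 1) x, d j * bspline (n + 1) (2 * x - j)) :
    (∃ ε : ℤ → ℝ, Tendsto ε cofinite (𝓝 0) ∧ ∀ᶠ x : ℝ in cocompact ℝ,
      ψ x = ∑ j ∈ activeIdx (n + 1) x,
        mainCoeff α E j * (1 + ε j) * bspline (n + 1) (2 * x - j)) ∧
    (fun x : ℝ => ψ x - ∑ j ∈ activeIdx (n + 1) x,
        mainCoeff α E j * bspline (n + 1) (2 * x - j))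
      =o[cocompact ℝ] fun x : ℝ => Real.exp (-α * |x|) / √|x| := by
  have hε : Tendsto (fun j => d j / mainCoeff α E j - 1) cofinite (𝓝 0) := by
    simpa using hd.sub_const 1
  have h1 : ∀ᶠ x : ℝ in cocompact ℝ, ψ x = ∑ j ∈ activeIdx (n + 1) x,
      mainCoeff α E j * (1 + (d j / mainCoeff α E j - 1)) * bspline (n + 1) (2 * x - j) := by
    refine (eventually_forall_mem_activeIdx (n + 1) eventually_two_le_natAbs).mono fun x hx => ?_
    rw [hψ]
    refine Finset.sum_congr rfl fun j hj => ?_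
    rw [add_sub_cancel, mul_div_cancel₀ _ (mainCoeff_ne_zero hE (hx j hj))]
  refine ⟨⟨_, hε, h1⟩, (isLittleO_sum_mainCoeff hα E n hε).congr' ?_ EventuallyEq.rfl⟩
  refine h1.mono fun x hx => ?_
  beta_reduce
  rw [hx, ← Finset.sum_sub_distrib]
  exact Finset.sum_congr rfl fun j _ => by ring

theorem tendsto_div_of_tendsto_div_invSqrtCoeff {r : ℝ} (hr : 0 < r) {cb : ℝ}
    (hcb : Tendsto (fun n : ℕ => binomHalf n * √n) atTop (𝓝 cb)) {u : ℕ → ℝ} {l : ℝ}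
    (hu : Tendsto (fun n : ℕ => u n / invSqrtCoeff r n) atTop (𝓝 l)) :
    Tendsto (fun n : ℕ => u n / ((-1) ^ n * (Real.exp (-(-Real.log r) * n) / √n))) atTop
      (𝓝 (l * cb)) := by
  refine (hu.mul hcb).congr' ((eventually_gt_atTop 0).mono fun n hn => ?_)
  have h1 : Real.exp (-(-Real.log r) * n) = r ^ n := by
    rw [neg_neg, mul_comm, Real.exp_nat_mul, Real.exp_log hr]
  have h2 : (-r) ^ n = (-1) ^ n * r ^ n := by rw [← mul_pow, neg_one_mul]
  have h3 := (binomHalf_pos n).ne'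
  have h4 : ((-1 : ℝ) ^ n) ≠ 0 := by simp
  have h5 : √(n : ℝ) ≠ 0 := (Real.sqrt_pos.2 (Nat.cast_pos.2 hn)).ne'
  have h6 : r ^ n ≠ 0 := pow_ne_zero n hr.ne'
  beta_reduce
  rw [invSqrtCoeff_natCast, h1, h2]
  field_simp

end CardinalBSpline

theorem theoremA (m : ℕ) (hm : 2 ≤ m) :
    ∃ lam : ℝ, IsNthNegativeRoot (eulerFrobenius m) (m - 1) lam ∧
    (∃! a : ℤ → ℝ, IsScalingSequence (scalingFunction m) a) ∧
    ∀ a : ℤ → ℝ, IsScalingSequence (scalingFunction m) a →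
      ∃ E : SignType → ZMod 2 → ℝ,
        (∀ σ : SignType, σ ≠ 0 → ∀ p : ZMod 2, E σ p ≠ 0) ∧
        (∃ ε : ℤ → ℝ, Tendsto ε cofinite (𝓝 0) ∧
          ∀ᶠ x : ℝ in cocompact ℝ,
            wavelet (scalingFunction m) a x =
              ∑ j ∈ activeIdx m x,
                mainCoeff (alphaOf (muOf lam)) E j * (1 + ε j) * bspline m (2 * x - j)) ∧
        (fun x : ℝ => wavelet (scalingFunction m) a x -
            ∑ j ∈ activeIdx m x,
              mainCoeff (alphaOf (muOf lam)) E j * bspline m (2 * x - j))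
          =o[cocompact ℝ]
            (fun x : ℝ => Real.exp (-alphaOf (muOf lam) * |x|) / Real.sqrt |x|) := by
  obtain ⟨k, rfl⟩ : ∃ k, m = k + 1 := ⟨m - 1, by omega⟩
  obtain ⟨Q, hQ, hcard, hroots⟩ := exists_roots_eulerFrobenius k
  have hne : Q.Nonempty := Finset.card_pos.1 (by omega)
  obtain ⟨r, hr, hmax⟩ : ∃ r ∈ Q, ∀ q ∈ Q, q ≤ r := ⟨Q.max' hne, Q.max'_mem hne, Q.le_max'⟩
  obtain ⟨K, hK, hP⟩ := exists_hasSum_bspline_int_eq_prodSymbol hQ hcard hroots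
  have hr01 := hQ r hr
  obtain ⟨h, hh, hlim⟩ := exists_hasLaurent_tendsto (Nat.le_add_left 1 k) hK hQ
    (fun z hz => two_scale_of_hasSum_bspline_int hP hz) hr hmax
  obtain ⟨a, ha, huniq, hwav⟩ :=
    exists_wavelet_coefficients hK hQ (ofReal_symbolP_eq hP) hr hmax hh
  choose L hL0 hL using hlim
  obtain ⟨cb, hcb0, hcb⟩ := exists_tendsto_binomHalf_mul_sqrt
  refine ⟨-r, isNthNegativeRoot_eulerFrobenius hQ hcard hroots hr hmax, ⟨a, ha, huniq⟩, ?_⟩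
  intro b hb
  rw [huniq b hb, alphaOf_muOf_neg hr01.1 hr01.2]
  set κ : ℝ := (-1) ^ k * (2 ^ k)⁻¹ with hκ
  have hκ0 : κ ≠ 0 := mul_ne_zero (by simp) (by positivity)
  -- For j = 2n + p > 0 the relevant coefficient of W has index 2n + (p + k). For j = -(2n + p) the
  -- symmetry of W moves it to 2n + (p + 1), with the sign (-1)^{k+1}. The value at sign 0 is
  -- immaterial, as it affects only j = 0.
  set E : SignType → ZMod 2 → ℝ := fun σ p =>
    if σ = 1 then κ * L (p.val + k) * cb else κ * (-1) ^ (k + 1) * L (p.val + 1) * cb with hE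
  have hE0 : ∀ σ : SignType, σ ≠ 0 → ∀ p : ZMod 2, E σ p ≠ 0 := fun σ _ p => by
    simp only [hE]
    split_ifs
    · exact mul_ne_zero (mul_ne_zero hκ0 (hL0 _)) hcb0.ne'
    · exact mul_ne_zero (mul_ne_zero (mul_ne_zero hκ0 (by simp)) (hL0 _)) hcb0.ne'
  have hval : ∀ p : ℕ, p < 2 → (p : ZMod 2).val = p := fun p hp => ZMod.val_natCast_of_lt hp
  refine ⟨E, hE0, exists_asymptotics_of_tendsto
    (neg_nonneg.2 (Real.log_nonpos hr01.1.le hr01.2.le)) k hE0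
    (tendsto_div_mainCoeff hE0 (fun p hp => ?_) (fun p hp => ?_)) hwav⟩
  · refine tendsto_div_of_tendsto_div_invSqrtCoeff hr01.1 hcb ?_
    rw [hval p hp]
    refine ((hL (p + k)).const_mul κ).congr fun n => ?_
    rw [mul_div_assoc, add_assoc]
  · simp only [hE, if_neg (show (-1 : SignType) ≠ 1 by decide)]
    refine tendsto_div_of_tendsto_div_invSqrtCoeff hr01.1 hcb ?_
    rw [hval p hp]
    refine ((hL (p + 1)).const_mul (κ * (-1) ^ (k + 1))).congr fun n => ?_
    have h1 : h (-(2 * n + p) + k) = (-1) ^ (k + 1) * h (2 * n + (p + 1)) := by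
      rw [show (-(2 * n + p) + k : ℤ) = -(2 * n + p - k) by ring,
        coeff_neg_of_hasLaurent_waveletSymbol hh]
      congr 2
      push_cast
      ring
    rw [h1]
    ring
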